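/- Let $(\mathscr A,\varphi)$ be a tracial $W^*$-probability space, i.e. a von Neumann algebra $\mathscr A$ with a unital, positive, faithful, tracial, normal linear functional $\varphi$, and let $S=(S_t)_{t\ge 0}$ be a free Brownian motion in it. For $f\in L^2(\mathbb R_+^n)$ let $I_n(f)$ be the multiple Wigner integral of $f$ with respect to $S$, that is, the continuous linear extension to $L^2(\mathbb R_+^n)\to L^2(\mathscr A,\varphi)$ of the map that sends the indicator function of $(a_1,b_1]\times\dots\times(a_n,b_n]$, with pairwise disjoint intervals, to $(S_{b_1}-S_{a_1})\cdots(S_{b_n}-S_{a_n})$. Let $I_k\otimes I_m$ be the bi-integral on $L^2(\mathbb R_+^{k})\otimes L^2(\mathbb R_+^{m})\cong L^2(\mathbb R_+^{k+m})$, the continuous linear extension of $g\otimes h\mapsto I_k(g)\otimes I_m(h)$ with values in $L^2(\mathscr A\otimes\mathscr A,\varphi\otimes\varphi)$. The free gradient acts by $$\nabla_t I_n(f)=\sum_{k=1}^{n} I_{k-1}\otimes I_{n-k}\big(f_t^{(k)}\big),\qquad f_t^{(k)}(x_1,\dots,x_{n-1})=f(x_1,\dots,x_{k-1},t,x_k,\dots,x_{n-1}),$$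 and $N_0^{-1}I_n(f)=\frac1n I_n(f)$ for $n\ge1$. Write $(A\otimes B)\sharp(C\otimes D)=(AC)\otimes(DB)$ and $(A\otimes B)^*=A^*\otimes B^*$. **Theorem.** Let $n\ge 1$ and let $f\in L^2(\mathbb R_+^n)$ be symmetric (real-valued and invariant under all permutations of its variables, almost everywhere) with $\|f\|_{L^2(\mathbb R_+^n)}=1$. Then $F=I_n(f)$ is a self-adjoint element of $\mathscr A$, the integral $\int_{\mathbb R_+}\nabla_s(N_0^{-1}F)\,\sharp\,(\nabla_sF)^*\,ds$ belongs to $L^2(\mathscr A\otimes\mathscr A,\varphi\otimes\varphi)$, and $$\varphi\otimes\varphi\left(\left|\int_{\mathbb R_+}\nabla_s\big(N_0^{-1}F\big)\,\sharp\,\big(\nabla_sF\big)^{*}\,ds-1\otimes1\right|^2\right)\le C_n\big(\varphi(F^4)-2\big),$$ where $C_n=\frac1{n^2}\max\{P_n(\lfloor u_0\rfloor),P_n(\lceil u_0\rceil)\}$ with $$P_n(u)=\tfrac13u^2(n-u+1)\big(2(n-u)^2+4(n-u)+3\big),$$ $$u_0=\frac15\left(4(n+1)-\frac{r(n)}{\sqrt[3]4}-\frac{2n^2+4n-3}{\sqrt[3]2\,r(n)}\right),$$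 $$r(n)=\sqrt[3]{4n^3+12n^2+5\sqrt2\sqrt{4n^4+16n^3+20n^2+8n+5}+22n+14}.$$ (The integral is understood through its pairings with the elements $A\otimes B$, $A,B\in\mathscr A$.) -/

import Mathlib

open MeasureTheory
open scoped NNReal ENNReal TensorProduct InnerProductSpace ComplexOrder

noncomputable section

universe u

/-- A tracial W*-probability space: a von Neumann algebra acting on the Hilbert space `H`, with a
unital, positive, faithful, tracial, σ-weakly continuous (normal) linear functional `φ`. -/
structure TracialWStarSpace (H : Type u) [NormedAddCommGroup H] [InnerProductSpace ℂ H]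
    [CompleteSpace H] where
  /-- the von Neumann algebra -/
  vN : VonNeumannAlgebra H
  /-- the trace -/
  φ : vN.toStarSubalgebra →ₗ[ℂ] ℂ
  φ_one : φ 1 = 1
  φ_nonneg : ∀ a : vN.toStarSubalgebra, 0 ≤ φ (star a * a)
  φ_faithful : ∀ a : vN.toStarSubalgebra, φ (a * star a) = 0 → a = 0
  φ_trace : ∀ a b : vN.toStarSubalgebra, φ (a * b) = φ (b * a)
  φ_normal : ∃ ξ η : ℕ → H, Summable (fun i => ‖ξ i‖ ^ 2) ∧ Summable (fun i => ‖η i‖ ^ 2) ∧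
    ∀ a : vN.toStarSubalgebra, HasSum (fun i => ⟪ξ i, (a : H →L[ℂ] H) (η i)⟫_ℂ) (φ a)

namespace TracialWStarSpace

variable {H : Type u} [NormedAddCommGroup H] [InnerProductSpace ℂ H] [CompleteSpace H]

/-- The elements of the von Neumann algebra, as a unital complex *-algebra. -/
abbrev Alg (W : TracialWStarSpace H) : Type u := W.vN.toStarSubalgebra

/-! ### The spaces `L²(𝒜, φ)` and `L²(𝒜 ⊗ 𝒜, φ ⊗ φ)` -/

/-- A copy of the algebra, to be equipped with the inner product `⟪x, y⟫ = φ (x* y)`. -/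
def PreL2 (W : TracialWStarSpace H) : Type u := W.Alg

instance (W : TracialWStarSpace H) : AddCommGroup W.PreL2 := inferInstanceAs (AddCommGroup W.Alg)
instance (W : TracialWStarSpace H) : Module ℂ W.PreL2 := inferInstanceAs (Module ℂ W.Alg)

/-- The identity map from the algebra to its copy. -/
def toPre (W : TracialWStarSpace H) : W.Alg ≃ₗ[ℂ] W.PreL2 := LinearEquiv.refl ℂ _

theorem φ_star (W : TracialWStarSpace H) (a : W.Alg) :
    W.φ (star a) = (starRingEnd ℂ) (W.φ a) := by
  have key : ∀ c : ℂ, (W.φ (star (c • (1 : W.Alg) + a) * (c • (1 : W.Alg) + a))).im = 0 :=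
    fun c => (Complex.nonneg_iff.mp (W.φ_nonneg _)).2.symm
  have ha : (W.φ (star a * a)).im = 0 := (Complex.nonneg_iff.mp (W.φ_nonneg a)).2.symm
  have expand : ∀ c : ℂ, W.φ (star (c • (1 : W.Alg) + a) * (c • (1 : W.Alg) + a)) =
      (starRingEnd ℂ c) * c + (starRingEnd ℂ c) * W.φ a + c * W.φ (star a)
        + W.φ (star a * a) := by
    intro c
    simp only [star_add, star_smul, star_one, add_mul, mul_add, smul_mul_assoc, mul_smul_comm,
      one_mul, mul_one, map_add, map_smul, W.φ_one, smul_eq_mul]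
    simp only [starRingEnd_apply]
    ring
  have h1 := key 1
  have h2 := key Complex.I
  rw [expand] at h1 h2
  simp at h1 h2
  apply Complex.ext <;> simp <;> linarith

/-- The inner product `⟪x, y⟫ = φ (x* y)`. -/
@[reducible] def core (W : TracialWStarSpace H) : InnerProductSpace.Core ℂ W.PreL2 where
  inner x y := W.φ (star (W.toPre.symm x) * W.toPre.symm y)
  conj_inner_symm x y := by rw [← W.φ_star]; simp
  re_inner_nonneg x := (Complex.nonneg_iff.mp (W.φ_nonneg _)).1
  add_left x y z := by simp [add_mul]
  smul_left x y r := by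
    rw [map_smul, star_smul, smul_mul_assoc, map_smul, smul_eq_mul, starRingEnd_apply]
  definite x hx := by
    have h : W.φ (W.toPre.symm x * star (W.toPre.symm x)) = 0 := by rw [W.φ_trace]; exact hx
    simpa using W.φ_faithful _ h

instance (W : TracialWStarSpace H) : NormedAddCommGroup W.PreL2 :=
  W.core.toNormedAddCommGroup

instance (W : TracialWStarSpace H) : InnerProductSpace ℂ W.PreL2 :=
  .ofCore W.core.toCore

/-- `L²(𝒜, φ)`: the completion of `𝒜` for the norm `‖x‖₂ = φ(x* x)^{1/2} = φ(x x*)^{1/2}`. -/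
abbrev L2 (W : TracialWStarSpace H) : Type u := UniformSpace.Completion W.PreL2

/-- `L²(𝒜 ⊗ 𝒜, φ ⊗ φ)`: the completion of the algebraic tensor product for the inner product
`⟪a ⊗ b, c ⊗ d⟫ = φ(a* c) φ(b* d) = (φ ⊗ φ)((a ⊗ b)* (c ⊗ d))`.
In particular `(φ ⊗ φ)(|X|²) = ‖X‖²` for `X` in this space. -/
abbrev L2Tensor (W : TracialWStarSpace H) : Type u :=
  UniformSpace.Completion (W.PreL2 ⊗[ℂ] W.PreL2)

/-- The inclusion of `𝒜` in `L²(𝒜, φ)`. -/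
def toL2 (W : TracialWStarSpace H) (a : W.Alg) : W.L2 := (W.toPre a : W.L2)

/-- The elementary tensor `a ⊗ b` in `L²(𝒜 ⊗ 𝒜, φ ⊗ φ)`. -/
def tmul (W : TracialWStarSpace H) (a b : W.Alg) : W.L2Tensor :=
  ((W.toPre a ⊗ₜ[ℂ] W.toPre b : W.PreL2 ⊗[ℂ] W.PreL2) : W.L2Tensor)

/-! ### The action `♯` -/

/-- The action `(a ⊗ b) ♯ (c ⊗ d) = (a c) ⊗ (d b)` of `a ⊗ b` on the algebraic tensor product. -/
def sharpAlg (W : TracialWStarSpace H) (a b : W.Alg) :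
    W.PreL2 ⊗[ℂ] W.PreL2 →ₗ[ℂ] W.PreL2 ⊗[ℂ] W.PreL2 :=
  TensorProduct.map
    (W.toPre.toLinearMap ∘ₗ LinearMap.mulLeft ℂ a ∘ₗ W.toPre.symm.toLinearMap)
    (W.toPre.toLinearMap ∘ₗ LinearMap.mulRight ℂ b ∘ₗ W.toPre.symm.toLinearMap)

/-- The action `(a ⊗ b) ♯ V` on `L²(𝒜 ⊗ 𝒜, φ ⊗ φ)`: the extension by continuity of `sharpAlg`
(a bounded operator for `‖·‖₂`, of norm at most `‖a‖ ‖b‖`). -/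
def sharp (W : TracialWStarSpace H) (a b : W.Alg) : W.L2Tensor → W.L2Tensor :=
  UniformSpace.Completion.map (W.sharpAlg a b)

/-- For biprocesses `U, V : ℝ₊ → L²(𝒜 ⊗ 𝒜, φ ⊗ φ)`, `W.IsSharpIntegral U V G` says that the integral
`∫ U_s ♯ (V_s)* ds` over `ℝ₊` is the element `G` of `L²(𝒜 ⊗ 𝒜, φ ⊗ φ)`.

The product of two elements of `L²` is an element of `L¹`, i.e. it is known through
its pairings with bounded elements, here `a ⊗ b`; and
`(φ ⊗ φ)((a ⊗ b)* (U ♯ V*)) = ⟪(a ⊗ b) ♯ V, U⟫` by the trace property. Since the `a ⊗ b` span a dense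
subspace, there is at most one such `G`. -/
def IsSharpIntegral (W : TracialWStarSpace H) (U V : ℝ → W.L2Tensor) (G : W.L2Tensor) : Prop :=
  ∀ a b : W.Alg,
    IntegrableOn (fun s => ⟪W.sharp a b (V s), U s⟫_ℂ) (Set.Ici 0) ∧
    ⟪W.tmul a b, G⟫_ℂ = ∫ s in Set.Ici (0 : ℝ), ⟪W.sharp a b (V s), U s⟫_ℂ

/-! ### Semicircular elements, freeness, free Brownian motion -/

/-- `X` has the centred semicircular law of variance `t > 0`: it is self-adjoint and its moments are
those of the density `(2πt)⁻¹ √(4t - x²)` on `|x| < 2√t`. -/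
def IsSemicircular (W : TracialWStarSpace H) (X : W.Alg) (t : ℝ) : Prop :=
  IsSelfAdjoint X ∧ ∀ k : ℕ, W.φ (X ^ k) =
    ((∫ x in (-(2 * √t))..(2 * √t), x ^ k * ((2 * Real.pi * t)⁻¹ * √(4 * t - x ^ 2)) : ℝ) : ℂ)

/-- `X` is free from the von Neumann subalgebra `N`: every alternating product of
centred polynomials in `X` and centred elements of `N` is centred. The label `true` marks the
factors that are polynomials in `X`. -/
def IsFreeFrom (W : TracialWStarSpace H) (X : W.Alg) (N : VonNeumannAlgebra H) : Prop :=
  ∀ l : List (Bool × W.Alg), l ≠ [] →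
    l.IsChain (fun p q => p.1 ≠ q.1) →
    (∀ p ∈ l, W.φ p.2 = 0 ∧
      (p.1 = true → ∃ P : Polynomial ℂ, p.2 = Polynomial.aeval X P) ∧
      (p.1 = false → (p.2 : H →L[ℂ] H) ∈ N)) →
    W.φ (l.map Prod.snd).prod = 0

/-- A free Brownian motion on a tracial W*-probability space. -/
structure FreeBrownianMotion (W : TracialWStarSpace H) where
  /-- the filtration -/
  filtration : ℝ≥0 → VonNeumannAlgebra H
  filtration_le : ∀ t, filtration t ≤ W.vN
  filtration_mono : Monotone filtration
  /-- the process -/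
  S : ℝ≥0 → W.Alg
  S_zero : S 0 = 0
  adapted : ∀ t, (S t : H →L[ℂ] H) ∈ filtration t
  semicircular : ∀ t, 0 < t → W.IsSemicircular (S t) t
  free_increment : ∀ u t, u < t → W.IsFreeFrom (S t - S u) (filtration u)
  semicircular_increment : ∀ u t : ℝ≥0, u < t → W.IsSemicircular (S t - S u) ((t : ℝ) - u)

end TracialWStarSpace

/-! ### Kernels -/

/-- Lebesgue measure on `ℝ₊ⁿ`, as a measure on `ℝⁿ`. -/
def lebPos (n : ℕ) : Measure (Fin n → ℝ) := Measure.pi fun _ => volume.restrict (Set.Ici 0)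

instance (n : ℕ) : SigmaFinite (lebPos n) := by unfold lebPos; infer_instance

/-- A kernel on `ℝ₊ⁿ` is (fully) symmetric if it is real-valued and invariant under all permutations
of the variables, almost everywhere. -/
def IsFullySymmetric {n : ℕ} (f : (Fin n → ℝ) → ℂ) : Prop :=
  (∀ᵐ x ∂lebPos n, (f x).im = 0) ∧
  ∀ σ : Equiv.Perm (Fin n), ∀ᵐ x ∂lebPos n, f (fun i => x (σ i)) = f x

/-- The box `∏ᵢ (aᵢ, bᵢ]` in `ℝ₊ⁿ`. -/
def box {n : ℕ} (a b : Fin n → ℝ≥0) : Set (Fin n → ℝ) :=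
  Set.univ.pi fun i => Set.Ioc (a i : ℝ) (b i)

theorem measurableSet_box {n : ℕ} (a b : Fin n → ℝ≥0) : MeasurableSet (box a b) :=
  MeasurableSet.univ_pi fun _ => measurableSet_Ioc

theorem lebPos_box_ne_top {n : ℕ} (a b : Fin n → ℝ≥0) : lebPos n (box a b) ≠ ∞ := by
  rw [lebPos, box, Measure.pi_pi]
  refine ENNReal.prod_ne_top fun i _ => ne_top_of_le_ne_top ?_ (Measure.restrict_apply_le _ _)
  simp

/-- The indicator function of a box, as an element of `L²(ℝ₊ⁿ)`. -/
def boxIndicator {n : ℕ} (a b : Fin n → ℝ≥0) : Lp ℂ 2 (lebPos n) :=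
  indicatorConstLp 2 (measurableSet_box a b) (lebPos_box_ne_top a b) (1 : ℂ)

namespace TracialWStarSpace.FreeBrownianMotion

variable {H : Type u} [NormedAddCommGroup H] [InnerProductSpace ℂ H] [CompleteSpace H]
  {W : TracialWStarSpace H}

/-! ### Wigner integrals -/

/-- The list of increments `S_{bᵢ} - S_{aᵢ}`, in the order of the index `i`. -/
def increments (B : FreeBrownianMotion W) {n : ℕ} (a b : Fin n → ℝ≥0) : List W.Alg :=
  List.ofFn fun i => B.S (b i) - B.S (a i)

/-- The graph of `Iₙ`: the closure, in `L²(ℝ₊ⁿ) × L²(𝒜, φ)`, of the graph of the linear map that sends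
the indicator function of `(a₁, b₁] × ⋯ × (aₙ, bₙ]`, for pairwise disjoint intervals, to
`(S_{b₁} - S_{a₁}) ⋯ (S_{bₙ} - S_{aₙ})`. -/
def wignerGraph (B : FreeBrownianMotion W) (n : ℕ) : Submodule ℂ (Lp ℂ 2 (lebPos n) × W.L2) :=
  (Submodule.span ℂ {p | ∃ a b : Fin n → ℝ≥0, a ≤ b ∧
    (∀ i j, i ≠ j → Disjoint (Set.Ioc (a i) (b i)) (Set.Ioc (a j) (b j))) ∧
    p = (boxIndicator a b, W.toL2 (B.increments a b).prod)}).topologicalClosure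

open Classical in
/-- The multiple Wigner integral `Iₙ(f)` of `f ∈ L²(ℝ₊ⁿ)`. (By the Wigner isometry the graph is that
of an everywhere defined isometry; the value `0` is only taken if `f` is not in `L²`.) -/
def wignerIntegral (B : FreeBrownianMotion W) (n : ℕ) (f : (Fin n → ℝ) → ℂ) : W.L2 :=
  if h : ∃ X : W.L2, ∃ hf : MemLp f 2 (lebPos n), (hf.toLp f, X) ∈ B.wignerGraph n then
    h.choose else 0

/-- The graph of the bi-integral `I_k ⊗ I_{n-k}` on `L²(ℝ₊ᵏ) ⊗ L²(ℝ₊ⁿ⁻ᵏ) ≅ L²(ℝ₊ⁿ)`, where the first `k`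
variables belong to the left factor: the closure of the graph of the linear map that sends
`1_R ⊗ 1_R'` to `I_k(1_R) ⊗ I_{n-k}(1_R')`, for boxes `R`, `R'` as in the definition of the Wigner
integral (the sides of `R` are pairwise disjoint, and so are those of `R'`). -/
def biGraph (B : FreeBrownianMotion W) (n k : ℕ) :
    Submodule ℂ (Lp ℂ 2 (lebPos n) × W.L2Tensor) :=
  (Submodule.span ℂ {p | ∃ a b : Fin n → ℝ≥0, a ≤ b ∧
    (∀ i j : Fin n, i ≠ j → ((i : ℕ) < k ↔ (j : ℕ) < k) →
      Disjoint (Set.Ioc (a i) (b i)) (Set.Ioc (a j) (b j))) ∧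
    p = (boxIndicator a b, W.tmul ((B.increments a b).take k).prod
      ((B.increments a b).drop k).prod)}).topologicalClosure

open Classical in
/-- The Wigner bi-integral `I_k ⊗ I_{n-k} (f)` of `f ∈ L²(ℝ₊ⁿ)`, `k ≤ n`. -/
def biIntegral (B : FreeBrownianMotion W) (n k : ℕ) (f : (Fin n → ℝ) → ℂ) : W.L2Tensor :=
  if h : ∃ X : W.L2Tensor, ∃ hf : MemLp f 2 (lebPos n), (hf.toLp f, X) ∈ B.biGraph n k then
    h.choose else 0

/-- The free gradient of the Wigner integral of order `n` with kernel `f`: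
`∇ₜ Iₙ(f) = ∑_{k=1}^{n} I_{k-1} ⊗ I_{n-k} (f_t^{(k)})`, where `f_t^{(k)}` is `f` with its `k`-th variable
fixed to be `t`. Below, the index `k` starts from `0`. -/
def gradient (B : FreeBrownianMotion W) :
    (n : ℕ) → ((Fin n → ℝ) → ℂ) → ℝ → W.L2Tensor
  | 0, _, _ => 0
  | n + 1, f, t => ∑ k : Fin (n + 1),
      B.biIntegral n k (fun x => f (Fin.insertNth (α := fun _ => ℝ) k t x))

end TracialWStarSpace.FreeBrownianMotion

/-- The kernel of `N₀⁻¹ Iₙ(f) = n⁻¹ Iₙ(f) = Iₙ(n⁻¹ f)`, for `n ≥ 1`. -/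
def numberInvKernel (n : ℕ) (f : (Fin n → ℝ) → ℂ) : (Fin n → ℝ) → ℂ := fun x => (n : ℂ)⁻¹ * f x

/-! ### The constant -/

/-- The polynomial `Pₙ(u) = (1/3) u² (n-u+1) (2(n-u)² + 4(n-u) + 3)`. -/
def constP (n : ℕ) (u : ℝ) : ℝ :=
  1 / 3 * u ^ 2 * (n - u + 1) * (2 * (n - u) ^ 2 + 4 * (n - u) + 3)

/-- The number `r(n)`, a cube root. -/
def constR (n : ℕ) : ℝ :=
  (4 * (n : ℝ) ^ 3 + 12 * (n : ℝ) ^ 2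
    + 5 * √2 * √(4 * (n : ℝ) ^ 4 + 16 * (n : ℝ) ^ 3 + 20 * (n : ℝ) ^ 2 + 8 * n + 5)
    + 22 * n + 14) ^ (1 / 3 : ℝ)

/-- The number `u₀`. -/
def constU (n : ℕ) : ℝ :=
  1 / 5 * (4 * ((n : ℝ) + 1) - constR n / (4 : ℝ) ^ (1 / 3 : ℝ)
    - (2 * (n : ℝ) ^ 2 + 4 * n - 3) / ((2 : ℝ) ^ (1 / 3 : ℝ) * constR n))

/-- `Cₙ = n⁻² max (Pₙ(⌊u₀⌋), Pₙ(⌈u₀⌉))`. -/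
def constC (n : ℕ) : ℝ :=
  1 / (n : ℝ) ^ 2 * max (constP n ⌊constU n⌋) (constP n ⌈constU n⌉)

end

/-!
The proof is a computation in the free chaos for simple kernels, followed by a passage to the
limit.

Fix a grid `t₀ < t₁ < ⋯` and let `xᵢ` be the increment of the free Brownian motion over the `i`-th
cell, normalized to variance one. To a word `w` in the letters `i` belongs the Wick word
`wick x w`, a product of Chebyshev polynomials, one for each run of equal letters. Freeness and the
orthogonality of the Chebyshev polynomials for the semicircle law say that nonempty Wick words are
centred (`FreeBrownianMotion.isWickFamily`), and this is all that is used of freeness. By the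
product formula (`wick_snoc_mul_cons`, `wordSum_wick_mul_wick`), Wick words are then orthonormal,
and they are the Wigner integrals of the tensor products of the normalized indicator functions of
the cells. A kernel on the grid is thus a function `c` on words of length `n`, and its Wigner
integral is `F = ∑ c w • wick x w` (`wickSum`).

Let `c` be real and symmetric, and let `K q` be the squared norm of the contraction of `q`
variables of `c` with `c` (`contrNormSq`). The product formula decomposes `F²` into orthogonal
components, so that `φ (F⁴) = ∑_{0 ≤ q ≤ n} K q` (`φ_wickSum_pow_four`); the terms `q = 0` and
`q = n` are both `‖c‖⁴`. Applied in both tensor factors, the same formula expresses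
`∫ ∇ₛ (N₀⁻¹ F) ♯ (∇ₛ F)* ds` by contractions of `q ≥ 1` variables embedded in the bi-chaoses of
order `(a, 2 (n - q) - a)` (`sharpGradient_eq`). Each of the `(n - q + 1)²` ways to put the free
variables into the tensor factors occurs with weight `q / n`. The term `q = n` is `‖c‖² 1 ⊗ 1`,
which is what the statement subtracts. The bi-chaoses are orthogonal, `1, 2, …, n - q + 1, …, 2, 1`
of the contractions lie in those of the same `q`, and all of them have squared norm `K q` by
symmetry. So the remaining squared norm is at most `∑_{1 ≤ q < n} n⁻² Pₙ(q) K q`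
(`norm_sq_sharpGradient_sub_le`).

Up to the factor `u / 3`, the derivative of `Pₙ` is a cubic with a single real root, which is `u₀`
by Cardano's formula (`critCubic_constU`): `Pₙ` increases before `u₀` and decreases after it, hence
`n⁻² Pₙ(q) ≤ Cₙ` at integers (`constP_le_constC`). This proves the inequality for grid kernels, in
the form `‖∫ ⋯ - ‖f‖² 1 ⊗ 1‖² ≤ Cₙ (φ (F⁴) - 2 ‖f‖⁴)`.

For general `f`, Haagerup's inequality `‖F‖ ≤ (n + 1) ‖f‖` (`norm_wickSum_le`) makes the Wigner
integral a bounded operator from `L²(ℝ₊ⁿ)` to the algebra with its operator norm (`wignerOp`). So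
`F` is an element of the algebra and `φ (F⁴)` depends continuously on `f`. The free gradient is a
bounded operator to square integrable biprocesses (`gradientOp`), so that the pairings of the
integral with elementary tensors are continuous too (`continuous_sharpPairing`). Since the
diagonals are null sets, `f` is a limit of grid kernels that vanish on them, and these can be taken
symmetric by orthogonal projection (`FreeBrownianMotion.exists_symmetric_grid_approx`). The bound
for them yields a weak limit in `L²(𝒜 ⊗ 𝒜)` of the integrals, which is the integral for `f` and
inherits the bound (`exists_weak_limit`).
-/

noncomputable section

universe u

/-! ### Sums over words of a given length -/

section WordSum

variable {ι : Type*} [Fintype ι] {E : Type*} [AddCommMonoid E]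

/-- The sum `∑ F w` over all words `w` of length `n` in the alphabet `ι`. Words are lists, so that
splitting and reversing them needs no casts between index types. -/
def wordSum : ℕ → (List ι → E) → E
  | 0, F => F []
  | n + 1, F => ∑ i, wordSum n fun w => F (i :: w)

@[simp] theorem wordSum_zero (F : List ι → E) : wordSum 0 F = F [] := rfl

theorem wordSum_succ (n : ℕ) (F : List ι → E) :
    wordSum (n + 1) F = ∑ i, wordSum n fun w => F (i :: w) := rfl

theorem wordSum_congr {n : ℕ} {F G : List ι → E} (h : ∀ w, w.length = n → F w = G w) :
    wordSum n F = wordSum n G := by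
  induction n generalizing F G with
  | zero => exact h [] rfl
  | succ n ih =>
    exact Finset.sum_congr rfl fun i _ => ih fun w hw => h (i :: w) (by simp [hw])

theorem map_wordSum {E' : Type*} [AddCommMonoid E'] {T : Type*} [FunLike T E E']
    [AddMonoidHomClass T E E'] (f : T) (n : ℕ) (F : List ι → E) :
    f (wordSum n F) = wordSum n fun w => f (F w) := by
  induction n generalizing F with
  | zero => rfl
  | succ n ih => simp only [wordSum_succ, map_sum, ih]

theorem wordSum_add (n : ℕ) (F G : List ι → E) :
    wordSum n (fun w => F w + G w) = wordSum n F + wordSum n G := by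
  induction n generalizing F G with
  | zero => rfl
  | succ n ih => simp only [wordSum_succ, ih, Finset.sum_add_distrib]

@[simp] theorem wordSum_const_zero (n : ℕ) : wordSum n (fun _ : List ι => (0 : E)) = 0 := by
  induction n with
  | zero => rfl
  | succ n ih => simp only [wordSum_succ, ih, Finset.sum_const_zero]

theorem wordSum_finsetSum {κ : Type*} (s : Finset κ) (n : ℕ) (F : κ → List ι → E) :
    wordSum n (fun w => ∑ k ∈ s, F k w) = ∑ k ∈ s, wordSum n (F k) := by
  induction n generalizing F with
  | zero => rfl
  | succ n ih => simp only [wordSum_succ, ih]; exact Finset.sum_comm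

theorem wordSum_comm {κ : Type*} [Fintype κ] (n m : ℕ) (F : List ι → List κ → E) :
    wordSum n (fun u => wordSum m (F u)) = wordSum m fun v => wordSum n fun u => F u v := by
  induction n generalizing F with
  | zero => rfl
  | succ n ih => simp only [wordSum_succ, ih, wordSum_finsetSum]

theorem wordSum_append (a b : ℕ) (F : List ι → E) :
    wordSum (a + b) F = wordSum a fun u => wordSum b fun v => F (u ++ v) := by
  induction a generalizing F with
  | zero => simp
  | succ a ih => rw [Nat.succ_add, wordSum_succ, wordSum_succ]; simp only [ih, List.cons_append]

theorem wordSum_snoc (n : ℕ) (F : List ι → E) :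
    wordSum (n + 1) F = wordSum n fun u => ∑ i, F (u ++ [i]) := by
  rw [wordSum_append]; rfl

theorem wordSum_reverse (n : ℕ) (F : List ι → E) :
    wordSum n (fun w => F w.reverse) = wordSum n F := by
  induction n generalizing F with
  | zero => rfl
  | succ n ih =>
    rw [wordSum_snoc n F, wordSum_finsetSum, wordSum_succ]
    refine Finset.sum_congr rfl fun i _ => ?_
    rw [← ih]
    simp

theorem wordSum_eq_sum_ofFn (n : ℕ) (F : List ι → E) :
    wordSum n F = ∑ u : Fin n → ι, F (List.ofFn u) := by
  induction n generalizing F with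
  | zero => simp
  | succ n ih =>
    simp only [wordSum_succ, ih, ← (Fin.consEquiv fun _ : Fin (n + 1) => ι).sum_comp,
      Fintype.sum_prod_type, Fin.consEquiv_apply, List.ofFn_succ, Fin.cons_zero, Fin.cons_succ]

theorem wordSum_ite_eq [DecidableEq ι] (n : ℕ) (v : List ι) (F : List ι → E) :
    wordSum n (fun w => if w = v then F w else 0) = if v.length = n then F v else 0 := by
  induction n generalizing F v with
  | zero => cases v <;> simp
  | succ n ih =>
    cases v with
    | nil => simp [wordSum_succ]
    | cons j v =>
      rw [wordSum_succ, Finset.sum_eq_single j]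
      · simp [ih v fun w => F (j :: w)]
      · intro i _ hi; simp [hi]
      · simp

end WordSum

section WordSumReal

variable {ι : Type*} [Fintype ι]

theorem wordSum_le_wordSum {n : ℕ} {F G : List ι → ℝ} (h : ∀ w, w.length = n → F w ≤ G w) :
    wordSum n F ≤ wordSum n G := by
  induction n generalizing F G with
  | zero => exact h [] rfl
  | succ n ih =>
    exact Finset.sum_le_sum fun i _ => ih fun w hw => h (i :: w) (by simp [hw])

theorem wordSum_nonneg {n : ℕ} {F : List ι → ℝ} (h : ∀ w, 0 ≤ F w) : 0 ≤ wordSum n F := by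
  simpa using wordSum_le_wordSum (n := n) (F := fun _ => 0) (G := F) fun w _ => h w

theorem wordSum_const_mul {R : Type*} [NonUnitalNonAssocSemiring R] (n : ℕ) (c : R)
    (F : List ι → R) : wordSum n (fun w => c * F w) = c * wordSum n F :=
  (map_wordSum (AddMonoidHom.mulLeft c) n F).symm

theorem wordSum_mul_const {R : Type*} [NonUnitalNonAssocSemiring R] (n : ℕ) (c : R)
    (F : List ι → R) : wordSum n (fun w => F w * c) = wordSum n F * c :=
  (map_wordSum (AddMonoidHom.mulRight c) n F).symm

/-- The Cauchy–Schwarz inequality for sums over words. -/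
theorem norm_wordSum_mul_sq_le (n : ℕ) (F G : List ι → ℂ) :
    ‖wordSum n fun w => F w * G w‖ ^ 2 ≤
      (wordSum n fun w => ‖F w‖ ^ 2) * wordSum n fun w => ‖G w‖ ^ 2 := by
  simp only [wordSum_eq_sum_ofFn]
  refine le_trans ?_ (Finset.sum_mul_sq_le_sq_mul_sq _ _ _)
  gcongr
  refine (norm_sum_le _ _).trans_eq ?_
  simp

end WordSumReal

/-! ### Wick words -/

section Wick

variable {ι : Type*} [DecidableEq ι] {A : Type*} [Ring A]

/-- The Wick word in the elements `x i`: on a run of equal letters it is a Chebyshev polynomial of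
the second kind (normalized for variance one), and it is multiplicative across distinct neighbours.
If the `x i` are free standard semicircular elements, it is `Iₙ (e_{i₁} ⊗ ⋯ ⊗ e_{iₙ})` for an
orthonormal system `e`. -/
def wick (x : ι → A) : List ι → A
  | [] => 1
  | [i] => x i
  | i :: j :: w => x i * wick x (j :: w) - if i = j then wick x w else 0

variable (x : ι → A)

@[simp] theorem wick_nil : wick x [] = 1 := rfl

@[simp] theorem wick_singleton (i : ι) : wick x [i] = x i := rfl

theorem wick_cons_cons (i j : ι) (w : List ι) :
    wick x (i :: j :: w) = x i * wick x (j :: w) - if i = j then wick x w else 0 := rfl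

/-- The product formula for Wick words, one letter at a time. -/
theorem wick_snoc_mul_cons (u v : List ι) (i j : ι) :
    wick x (u ++ [i]) * wick x (j :: v) =
      wick x (u ++ i :: j :: v) + if i = j then wick x u * wick x v else 0 := by
  induction u using List.twoStepInduction with
  | nil => simp [wick_cons_cons]
  | singleton k =>
    simp only [List.cons_append, List.nil_append, wick_cons_cons, wick_singleton, wick_nil]
    split_ifs <;> noncomm_ring
  | cons_cons k l u ih₁ ih₂ =>
    simp only [List.cons_append, wick_cons_cons] at ih₁ ih₂ ⊢
    have h2 := ih₂ l
    rw [sub_mul, mul_assoc, h2, ite_mul, zero_mul, ih₁]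
    split_ifs <;> noncomm_ring

theorem wick_append {u v : List ι} (h : ∀ i ∈ u.getLast?, ∀ j ∈ v.head?, i ≠ j) :
    wick x (u ++ v) = wick x u * wick x v := by
  rcases List.eq_nil_or_concat u with rfl | ⟨u, i, rfl⟩
  · simp
  cases v with
  | nil => simp
  | cons j v =>
    have hij : i ≠ j := h i (by simp) j (by simp)
    have := wick_snoc_mul_cons x u v i j
    simp only [List.concat_eq_append, List.append_assoc, List.cons_append, List.nil_append] at *
    rw [this, if_neg hij, add_zero]

theorem wick_snoc_snoc (u : List ι) (i j : ι) :
    wick x (u ++ [i, j]) = wick x (u ++ [i]) * x j - if i = j then wick x u else 0 := by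
  have := wick_snoc_mul_cons x u [] i j
  simp only [wick_singleton, wick_nil, mul_one] at this
  rw [this]; simp

theorem star_wick [StarRing A] (hx : ∀ i, star (x i) = x i) (w : List ι) :
    star (wick x w) = wick x w.reverse := by
  induction w using List.twoStepInduction with
  | nil => simp
  | singleton k => simp [hx]
  | cons_cons i j w ih₁ ih₂ =>
    have h2 := ih₂ j
    have := wick_snoc_snoc x w.reverse j i
    simp only [List.reverse_cons, List.append_assoc, List.cons_append, List.nil_append] at *
    rw [this, wick_cons_cons, star_sub, star_mul, h2, hx]
    by_cases h : i = j
    · simp [h, ih₁]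
    · simp [h, Ne.symm h]

theorem wick_eq_prod_of_isChain {w : List ι} (h : w.IsChain (· ≠ ·)) :
    wick x w = (w.map x).prod := by
  induction w using List.twoStepInduction with
  | nil => simp
  | singleton k => simp
  | cons_cons i j w ih₁ ih₂ =>
    rw [List.isChain_cons_cons] at h
    rw [wick_cons_cons, if_neg h.1, ih₂ j h.2]; simp

variable [Fintype ι] [Algebra ℂ A] {E : Type*} [AddCommGroup E] [Module ℂ E]

/-- The product formula for Wick words, summed against arbitrary coefficients: the term of index `p`
collects the contractions of the last `p` letters of `u` with the first `p` letters of `v`. -/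
theorem wordSum_wick_mul_wick (n m : ℕ) (K : List ι → List ι → A →ₗ[ℂ] E) :
    (wordSum n fun u => wordSum m fun v => K u v (wick x u * wick x v)) =
      ∑ p ∈ Finset.range (min n m + 1), wordSum (n - p) fun u => wordSum (m - p) fun v =>
        (wordSum p fun z => K (u ++ z) (z.reverse ++ v)) (wick x (u ++ v)) := by
  induction n generalizing m K with
  | zero => simp
  | succ n ih =>
    cases m with
    | zero => simp
    | succ m =>
      have key : (wordSum (n + 1) fun u => wordSum (m + 1) fun v => K u v (wick x u * wick x v)) =
          (wordSum (n + 1) fun u => wordSum (m + 1) fun v => K u v (wick x (u ++ v))) +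
          wordSum n fun u => wordSum m fun v =>
            (∑ i, K (u ++ [i]) (i :: v)) (wick x u * wick x v) := by
        rw [wordSum_snoc, wordSum_snoc, ← wordSum_add]
        refine congrArg _ (funext fun u => ?_)
        simp only [wordSum_succ, wick_snoc_mul_cons, map_add, wordSum_add, Finset.sum_add_distrib]
        congr 1
        · simp
        · simp only [LinearMap.sum_apply, wordSum_finsetSum]
          refine Finset.sum_congr rfl fun i _ => ?_
          rw [Finset.sum_eq_single i]
          · simp
          · intro j _ hj; simp [Ne.symm hj]
          · simp
      rw [key, ih, Nat.succ_min_succ, Finset.sum_range_succ' _ (min n m + 1), add_comm]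
      refine congrArg₂ _ (Finset.sum_congr rfl fun p _ => ?_) ?_
      · simp only [Nat.add_sub_add_right, wordSum_snoc p, List.append_assoc, List.reverse_append,
          List.reverse_singleton, List.cons_append, List.nil_append]
      · simp only [Nat.sub_zero, wordSum_zero, List.append_nil, List.reverse_nil, List.nil_append]

end Wick

/-! ### The trace and the operator norm -/

theorem VonNeumannAlgebra.isClosed_coe {H : Type*} [NormedAddCommGroup H] [InnerProductSpace ℂ H]
    [CompleteSpace H] (N : VonNeumannAlgebra H) :
    IsClosed (N.toStarSubalgebra : Set (H →L[ℂ] H)) := by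
  rw [N.coe_toStarSubalgebra, ← N.centralizer_centralizer]
  exact Set.isClosed_centralizer _

/-- `‖a‖² - a* a` is positive, so that it has the form `b* b`. -/
theorem CStarAlgebra.exists_star_mul_self_add {A : Type*} [CStarAlgebra A] (a : A) :
    ∃ b : A, star a * a + star b * b = ((‖a‖ ^ 2 : ℝ) : ℂ) • (1 : A) := by
  let _ := CStarAlgebra.spectralOrder A
  have _ := CStarAlgebra.spectralOrderedRing A
  have h := sub_nonneg.mpr (CStarAlgebra.star_mul_le_algebraMap_norm_sq (a := a))
  obtain ⟨b, hb⟩ := CStarAlgebra.nonneg_iff_eq_star_mul_self.mp h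
  refine ⟨b, ?_⟩
  rw [← hb, add_sub_cancel, Algebra.algebraMap_eq_smul_one]
  exact (Complex.coe_smul _ _).symm

/-- For a faithful positive functional, the operator norm is controlled by the growth of the
moments. -/
theorem CStarAlgebra.norm_le_of_moments {A : Type*} [CStarAlgebra A] (τ : A →ₗ[ℂ] ℂ)
    (τ_one : τ 1 = 1) (τ_nonneg : ∀ a, 0 ≤ τ (star a * a))
    (τ_faithful : ∀ a, τ (a * star a) = 0 → a = 0) (a : A) {C : ℝ} (hC : 0 ≤ C)
    (h : ∀ k : ℕ, (τ ((star a * a) ^ k)).re ≤ (C ^ 2) ^ k) : ‖a‖ ≤ C := by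
  by_contra! hlt
  let _ := CStarAlgebra.spectralOrder A
  have _ := CStarAlgebra.spectralOrderedRing A
  set T : A := star a * a with hT
  set s := ‖a‖ ^ 2 with hs
  have hTn : ‖T‖ = s := by rw [hT, CStarRing.norm_star_mul_self, hs, sq]
  have hT0 : 0 ≤ T := star_mul_self_nonneg a
  have hTsa : IsSelfAdjoint T := .of_nonneg hT0
  obtain ⟨r, hr1, hr2⟩ : ∃ r, C ^ 2 < r ∧ r < s :=
    exists_between (by rw [hs]; exact pow_lt_pow_left₀ hlt hC two_ne_zero)
  have hr0 : 0 < r := (sq_nonneg C).trans_lt hr1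
  have mono : ∀ {x y : A}, x ≤ y → (τ x).re ≤ (τ y).re := by
    intro x y hxy
    obtain ⟨b, hb⟩ := CStarAlgebra.nonneg_iff_eq_star_mul_self.mp (sub_nonneg.mpr hxy)
    have := (Complex.nonneg_iff.mp (τ_nonneg b)).1
    rw [← hb, map_sub, Complex.sub_re] at this
    linarith
  -- a bump function that vanishes on `[0, r]` but not at the top `s` of the spectrum
  set g : ℝ → ℝ := fun t => max 0 (t - r) with hg
  have hgc : Continuous g := by fun_prop
  have hnt : Nontrivial A := by
    refine ⟨1, 0, fun h10 => ?_⟩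
    have := τ_one
    rw [h10, map_zero] at this
    exact zero_ne_one this
  have hsT : s ∈ spectrum ℝ T := hTn ▸ CStarAlgebra.norm_mem_spectrum_of_nonneg (a := T) hT0
  have hspec : ∀ t ∈ spectrum ℝ T, 0 ≤ t ∧ t ≤ s := fun t ht =>
    ⟨spectrum_nonneg_of_nonneg hT0 ht, by
      rw [← hTn]; exact (le_abs_self t).trans (spectrum.norm_le_norm_of_mem ht)⟩
  have hP0 : 0 ≤ cfc g T := cfc_nonneg fun t _ => le_max_left _ _
  have hPk : ∀ k : ℕ, (τ (cfc g T)).re ≤ s * (C ^ 2 / r) ^ k := by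
    intro k
    have h1 : cfc (fun t => r ^ k * g t) T ≤ cfc (fun t => s * t ^ k) T := by
      refine cfc_mono (fun t ht => ?_)
      obtain ⟨ht0, hts⟩ := hspec t ht
      rcases le_total t r with htr | htr
      · have : g t = 0 := max_eq_left (by linarith)
        rw [this, mul_zero]; positivity
      · rw [mul_comm]
        have : g t ≤ s := max_le (hr0.trans hr2).le (by linarith)
        gcongr
    rw [cfc_const_mul _ _ T, cfc_const_mul _ _ T, cfc_pow_id T k] at h1
    have h2 := mono h1
    rw [← Complex.coe_smul (r ^ k), ← Complex.coe_smul s, map_smul, map_smul, smul_eq_mul,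
      smul_eq_mul, Complex.re_ofReal_mul, Complex.re_ofReal_mul] at h2
    have h3 := mul_le_mul_of_nonneg_left (h k) (hr0.trans hr2).le
    rw [div_pow, ← mul_div_assoc, le_div_iff₀ (by positivity), mul_comm]
    exact h2.trans h3
  have hlim : Filter.Tendsto (fun k : ℕ => s * (C ^ 2 / r) ^ k) Filter.atTop (nhds (s * 0)) :=
    (tendsto_pow_atTop_nhds_zero_of_lt_one (by positivity) ((div_lt_one hr0).2 hr1)).const_mul _
  have hle : (τ (cfc g T)).re ≤ 0 := by
    simpa using ge_of_tendsto' hlim hPk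
  obtain ⟨b, hb⟩ := CStarAlgebra.nonneg_iff_eq_star_mul_self.mp hP0
  have hb0 : star b = 0 := by
    refine τ_faithful _ ?_
    rw [star_star, ← hb]
    have h0 := Complex.nonneg_iff.mp (τ_nonneg b)
    rw [← hb] at h0
    exact Complex.ext (le_antisymm hle h0.1) h0.2.symm
  have hP : cfc g T = 0 := by rw [hb, hb0, zero_mul]
  have hgs : g s ∈ spectrum ℝ (cfc g T) := by
    rw [cfc_map_spectrum g T]; exact ⟨s, hsT, rfl⟩
  rw [hP, spectrum.zero_eq, Set.mem_singleton_iff] at hgs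
  have : s - r ≤ g s := le_max_right _ _
  linarith

namespace TracialWStarSpace

variable {H : Type u} [NormedAddCommGroup H] [InnerProductSpace ℂ H] [CompleteSpace H]
  (W : TracialWStarSpace H)

instance : IsClosed (W.vN.toStarSubalgebra : Set (H →L[ℂ] H)) := W.vN.isClosed_coe

theorem inner_toPre (a b : W.Alg) : ⟪W.toPre a, W.toPre b⟫_ℂ = W.φ (star a * b) := rfl

theorem inner_toL2 (a b : W.Alg) : ⟪W.toL2 a, W.toL2 b⟫_ℂ = W.φ (star a * b) := by
  rw [toL2, toL2, UniformSpace.Completion.inner_coe, inner_toPre]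

theorem norm_toL2_sq (a : W.Alg) : ‖W.toL2 a‖ ^ 2 = (W.φ (star a * a)).re := by
  rw [← W.inner_toL2, ← inner_self_eq_norm_sq (𝕜 := ℂ)]; rfl

theorem exists_mul_star_self_add (a : W.Alg) :
    ∃ b : W.Alg, a * star a + b * star b = ((‖a‖ ^ 2 : ℝ) : ℂ) • (1 : W.Alg) := by
  obtain ⟨b, hb⟩ := CStarAlgebra.exists_star_mul_self_add (star a)
  refine ⟨star b, ?_⟩
  rw [star_star, norm_star] at hb
  rwa [star_star]

theorem φ_re_nonneg (a : W.Alg) : 0 ≤ (W.φ (star a * a)).re :=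
  (Complex.nonneg_iff.mp (W.φ_nonneg a)).1

theorem norm_toL2_le (a : W.Alg) : ‖W.toL2 a‖ ≤ ‖a‖ := by
  refine le_of_sq_le_sq ?_ (norm_nonneg _)
  obtain ⟨b, hb⟩ := CStarAlgebra.exists_star_mul_self_add a
  have h := congrArg (fun c => (W.φ c).re) hb
  simp only [map_add, map_smul, W.φ_one, smul_eq_mul, mul_one, Complex.add_re,
    Complex.ofReal_re] at h
  rw [norm_toL2_sq]
  linarith [W.φ_re_nonneg b]

/-- The inclusion of `𝒜` in `L²(𝒜, φ)`, as a continuous linear map. -/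
def toL2L : W.Alg →L[ℂ] W.L2 :=
  LinearMap.mkContinuous
    { toFun := W.toL2
      map_add' := fun a b => by simp [toL2, UniformSpace.Completion.coe_add]
      map_smul' := fun c a => by simp [toL2, UniformSpace.Completion.coe_smul] } 1
    fun a => by rw [one_mul]; exact W.norm_toL2_le a

@[simp] theorem toL2L_apply (a : W.Alg) : W.toL2L a = W.toL2 a := rfl

theorem continuous_φ : Continuous W.φ := by
  have : (W.φ : W.Alg → ℂ) = fun a => ⟪W.toL2 1, W.toL2L a⟫_ℂ := by
    ext a; simp [inner_toL2]
  rw [this]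
  exact continuous_const.inner W.toL2L.continuous

theorem norm_le_of_moments (a : W.Alg) {C : ℝ} (hC : 0 ≤ C)
    (h : ∀ k : ℕ, (W.φ ((star a * a) ^ k)).re ≤ (C ^ 2) ^ k) : ‖a‖ ≤ C :=
  CStarAlgebra.norm_le_of_moments W.φ W.φ_one W.φ_nonneg W.φ_faithful a hC h

/-! ### Boundedness of the action `♯` -/

@[simp] theorem sharpAlg_tmul (a b c d : W.Alg) :
    W.sharpAlg a b (W.toPre c ⊗ₜ W.toPre d) = W.toPre (a * c) ⊗ₜ W.toPre (d * b) := rfl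

theorem preTensor_induction {P : W.PreL2 ⊗[ℂ] W.PreL2 → Prop} (X : W.PreL2 ⊗[ℂ] W.PreL2)
    (h0 : P 0) (ht : ∀ a b : W.Alg, P (W.toPre a ⊗ₜ W.toPre b))
    (ha : ∀ x y, P x → P y → P (x + y)) : P X :=
  TensorProduct.induction_on X h0 (fun x y => ht (W.toPre.symm x) (W.toPre.symm y)) ha

theorem inner_preTensor (a b c d : W.Alg) :
    ⟪W.toPre a ⊗ₜ[ℂ] W.toPre b, W.toPre c ⊗ₜ[ℂ] W.toPre d⟫_ℂ =
      W.φ (star a * c) * W.φ (star b * d) := by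
  rw [TensorProduct.inner_tmul, inner_toPre, inner_toPre]

theorem inner_tmul (a b c d : W.Alg) :
    ⟪W.tmul a b, W.tmul c d⟫_ℂ = W.φ (star a * c) * W.φ (star b * d) := by
  rw [tmul, tmul, UniformSpace.Completion.inner_coe, inner_preTensor]

theorem inner_sharpAlg_sharpAlg (a b c d : W.Alg) (X Y : W.PreL2 ⊗[ℂ] W.PreL2) :
    ⟪W.sharpAlg a b X, W.sharpAlg c d Y⟫_ℂ = ⟪X, W.sharpAlg (star a * c) (d * star b) Y⟫_ℂ := by
  induction X using W.preTensor_induction with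
  | h0 => simp
  | ha x y hx hy => rw [map_add, inner_add_left, inner_add_left, hx, hy]
  | ht x x' =>
    induction Y using W.preTensor_induction with
    | h0 => simp
    | ha u v hu hv => rw [map_add, map_add, inner_add_right, inner_add_right, hu, hv]
    | ht y y' =>
      simp only [sharpAlg_tmul, inner_preTensor, star_mul, mul_assoc]
      rw [W.φ_trace (star b)]
      simp only [mul_assoc]

theorem sharpAlg_add_left (a a' b : W.Alg) (X : W.PreL2 ⊗[ℂ] W.PreL2) :
    W.sharpAlg (a + a') b X = W.sharpAlg a b X + W.sharpAlg a' b X := by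
  induction X using W.preTensor_induction with
  | h0 => simp
  | ha x y hx hy => simp only [map_add, hx, hy]; abel
  | ht x x' => simp only [sharpAlg_tmul, add_mul, map_add, TensorProduct.add_tmul]

theorem sharpAlg_add_right (a b b' : W.Alg) (X : W.PreL2 ⊗[ℂ] W.PreL2) :
    W.sharpAlg a (b + b') X = W.sharpAlg a b X + W.sharpAlg a b' X := by
  induction X using W.preTensor_induction with
  | h0 => simp
  | ha x y hx hy => simp only [map_add, hx, hy]; abel
  | ht x x' => simp only [sharpAlg_tmul, mul_add, map_add, TensorProduct.tmul_add]

theorem sharpAlg_smul_one_one (c : ℂ) (X : W.PreL2 ⊗[ℂ] W.PreL2) :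
    W.sharpAlg (c • 1) 1 X = c • X := by
  induction X using W.preTensor_induction with
  | h0 => simp
  | ha x y hx hy => rw [map_add, smul_add, hx, hy]
  | ht x x' =>
    rw [sharpAlg_tmul, smul_mul_assoc, one_mul, mul_one, map_smul, TensorProduct.smul_tmul']

theorem sharpAlg_one_smul_one (c : ℂ) (X : W.PreL2 ⊗[ℂ] W.PreL2) :
    W.sharpAlg 1 (c • 1) X = c • X := by
  induction X using W.preTensor_induction with
  | h0 => simp
  | ha x y hx hy => rw [map_add, smul_add, hx, hy]
  | ht x x' =>
    rw [sharpAlg_tmul, mul_smul_comm, one_mul, mul_one, map_smul, TensorProduct.tmul_smul]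

theorem inner_preTensor_self (X : W.PreL2 ⊗[ℂ] W.PreL2) : ⟪X, X⟫_ℂ = ((‖X‖ ^ 2 : ℝ) : ℂ) :=
  (inner_self_eq_norm_sq_to_K X).trans (by norm_cast)

theorem norm_sharpAlg_left_le (a : W.Alg) (X : W.PreL2 ⊗[ℂ] W.PreL2) :
    ‖W.sharpAlg a 1 X‖ ≤ ‖a‖ * ‖X‖ := by
  obtain ⟨b, hb⟩ := CStarAlgebra.exists_star_mul_self_add a
  have h : ⟪W.sharpAlg a 1 X, W.sharpAlg a 1 X⟫_ℂ + ⟪W.sharpAlg b 1 X, W.sharpAlg b 1 X⟫_ℂ =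
      ((‖a‖ ^ 2 : ℝ) : ℂ) * ⟪X, X⟫_ℂ := by
    rw [inner_sharpAlg_sharpAlg, inner_sharpAlg_sharpAlg, star_one, mul_one]
    refine (inner_add_right X _ _).symm.trans ?_
    rw [← sharpAlg_add_left, hb, sharpAlg_smul_one_one]
    exact inner_smul_right X X _
  simp only [W.inner_preTensor_self] at h
  norm_cast at h
  refine le_of_sq_le_sq ?_ (by positivity)
  rw [mul_pow]
  nlinarith [sq_nonneg ‖W.sharpAlg b 1 X‖]

theorem norm_sharpAlg_right_le (a : W.Alg) (X : W.PreL2 ⊗[ℂ] W.PreL2) :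
    ‖W.sharpAlg 1 a X‖ ≤ ‖a‖ * ‖X‖ := by
  obtain ⟨b, hb⟩ := W.exists_mul_star_self_add a
  have h : ⟪W.sharpAlg 1 a X, W.sharpAlg 1 a X⟫_ℂ + ⟪W.sharpAlg 1 b X, W.sharpAlg 1 b X⟫_ℂ =
      ((‖a‖ ^ 2 : ℝ) : ℂ) * ⟪X, X⟫_ℂ := by
    rw [inner_sharpAlg_sharpAlg, inner_sharpAlg_sharpAlg, star_one, mul_one]
    refine (inner_add_right X _ _).symm.trans ?_
    rw [← sharpAlg_add_right, hb, sharpAlg_one_smul_one]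
    exact inner_smul_right X X _
  simp only [W.inner_preTensor_self] at h
  norm_cast at h
  refine le_of_sq_le_sq ?_ (by positivity)
  rw [mul_pow]
  nlinarith [sq_nonneg ‖W.sharpAlg 1 b X‖]

theorem norm_sharpAlg_le (a b : W.Alg) (X : W.PreL2 ⊗[ℂ] W.PreL2) :
    ‖W.sharpAlg a b X‖ ≤ ‖a‖ * ‖b‖ * ‖X‖ := by
  have : W.sharpAlg a b X = W.sharpAlg a 1 (W.sharpAlg 1 b X) := by
    induction X using W.preTensor_induction with
    | h0 => simp
    | ha x y hx hy => rw [map_add, map_add, map_add, hx, hy]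
    | ht x x' => simp
  rw [this, mul_assoc]
  exact (W.norm_sharpAlg_left_le _ _).trans
    (mul_le_mul_of_nonneg_left (W.norm_sharpAlg_right_le _ _) (norm_nonneg _))

/-- The action `♯` of `a ⊗ b` on the algebraic tensor product, as a bounded operator. -/
def sharpAlgL (a b : W.Alg) : W.PreL2 ⊗[ℂ] W.PreL2 →L[ℂ] W.PreL2 ⊗[ℂ] W.PreL2 :=
  (W.sharpAlg a b).mkContinuous (‖a‖ * ‖b‖) (W.norm_sharpAlg_le a b)

theorem sharp_coe (a b : W.Alg) (X : W.PreL2 ⊗[ℂ] W.PreL2) :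
    W.sharp a b (X : W.L2Tensor) = (W.sharpAlg a b X : W.L2Tensor) :=
  UniformSpace.Completion.map_coe (W.sharpAlgL a b).uniformContinuous X

@[simp] theorem sharp_tmul (a b c d : W.Alg) :
    W.sharp a b (W.tmul c d) = W.tmul (a * c) (d * b) := by
  rw [tmul, sharp_coe, sharpAlg_tmul, tmul]

theorem continuous_sharp (a b : W.Alg) : Continuous (W.sharp a b) :=
  UniformSpace.Completion.continuous_map

/-- The action `♯` of `a ⊗ b` as a bounded operator on `L²(𝒜 ⊗ 𝒜, φ ⊗ φ)`. -/
def sharpL (a b : W.Alg) : W.L2Tensor →L[ℂ] W.L2Tensor where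
  toFun := W.sharp a b
  map_add' x y := by
    have hc := W.continuous_sharp a b
    induction x, y using UniformSpace.Completion.induction_on₂ with
    | hp =>
      exact isClosed_eq (hc.comp continuous_add)
        ((hc.comp continuous_fst).add (hc.comp continuous_snd))
    | ih x y =>
      rw [← UniformSpace.Completion.coe_add, sharp_coe, sharp_coe, sharp_coe, map_add,
        UniformSpace.Completion.coe_add]
  map_smul' c x := by
    have hc := W.continuous_sharp a b
    induction x using UniformSpace.Completion.induction_on with
    | hp => exact isClosed_eq (hc.comp (continuous_const_smul c)) (hc.const_smul c)
    | ih x =>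
      rw [← UniformSpace.Completion.coe_smul, sharp_coe, sharp_coe, map_smul,
        UniformSpace.Completion.coe_smul, RingHom.id_apply]
  cont := W.continuous_sharp a b

@[simp] theorem sharpL_apply (a b : W.Alg) (X : W.L2Tensor) : W.sharpL a b X = W.sharp a b X := rfl

end TracialWStarSpace

/-! ### Orthonormal families indexed by words -/

section Orthonormal

variable {ι : Type*} [Fintype ι] {E : Type*} [NormedAddCommGroup E] [InnerProductSpace ℂ E]

theorem inner_wordSum_right (n : ℕ) (y : E) (F : List ι → E) :
    ⟪y, wordSum n F⟫_ℂ = wordSum n fun w => ⟪y, F w⟫_ℂ := by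
  induction n generalizing F with
  | zero => rfl
  | succ n ih => simp only [wordSum_succ, inner_sum, ih]

theorem inner_wordSum_left (n : ℕ) (F : List ι → E) (y : E) :
    ⟪wordSum n F, y⟫_ℂ = wordSum n fun w => ⟪F w, y⟫_ℂ := by
  induction n generalizing F with
  | zero => rfl
  | succ n ih => simp only [wordSum_succ, sum_inner, ih]

theorem ofReal_wordSum (n : ℕ) (F : List ι → ℝ) :
    ((wordSum n F : ℝ) : ℂ) = wordSum n fun w => (F w : ℂ) :=
  map_wordSum Complex.ofRealHom n F

theorem inner_self_eq_ofReal_norm_sq (y : E) : ⟪y, y⟫_ℂ = ((‖y‖ ^ 2 : ℝ) : ℂ) :=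
  (inner_self_eq_norm_sq_to_K y).trans (by push_cast; rfl)

variable [DecidableEq ι]

theorem norm_sq_wordSum_smul {e : List ι → E}
    (he : ∀ u v, ⟪e u, e v⟫_ℂ = if u = v then 1 else 0) (n : ℕ) (c : List ι → ℂ) :
    ‖wordSum n fun w => c w • e w‖ ^ 2 = wordSum n fun w => ‖c w‖ ^ 2 := by
  have h : ⟪wordSum n fun w => c w • e w, wordSum n fun w => c w • e w⟫_ℂ =
      ((wordSum n fun w => ‖c w‖ ^ 2 : ℝ) : ℂ) := by
    rw [inner_wordSum_left, ofReal_wordSum]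
    refine wordSum_congr fun u hu => ?_
    rw [inner_wordSum_right]
    simp only [inner_smul_left, inner_smul_right, he, mul_ite, mul_one, mul_zero]
    simp only [eq_comm (a := u), wordSum_ite_eq, hu, if_true]
    rw [Complex.mul_conj, Complex.normSq_eq_norm_sq]
  rw [inner_self_eq_ofReal_norm_sq] at h
  exact Complex.ofReal_injective h

theorem norm_sq_wordSum_wordSum_smul {e : List ι → List ι → E}
    (he : ∀ u v u' v', ⟪e u v, e u' v'⟫_ℂ = (if u = u' then 1 else 0) * if v = v' then 1 else 0)
    (n m : ℕ) (c : List ι → List ι → ℂ) :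
    ‖wordSum n fun u => wordSum m fun v => c u v • e u v‖ ^ 2 =
      wordSum n fun u => wordSum m fun v => ‖c u v‖ ^ 2 := by
  have h : ⟪wordSum n fun u => wordSum m fun v => c u v • e u v,
      wordSum n fun u => wordSum m fun v => c u v • e u v⟫_ℂ =
      ((wordSum n fun u => wordSum m fun v => ‖c u v‖ ^ 2 : ℝ) : ℂ) := by
    simp only [inner_wordSum_left, ofReal_wordSum]
    refine wordSum_congr fun u hu => wordSum_congr fun v hv => ?_
    simp only [inner_wordSum_right, inner_smul_left, inner_smul_right, he, mul_ite, mul_one,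
      mul_zero]
    simp only [eq_comm (a := u), eq_comm (a := v), wordSum_ite_eq, hv, if_true, hu]
    rw [mul_comm, Complex.mul_conj, Complex.normSq_eq_norm_sq]
  rw [inner_self_eq_ofReal_norm_sq] at h
  exact Complex.ofReal_injective h

theorem norm_sq_sum_of_orthogonal {κ : Type*} (s : Finset κ) (v : κ → E)
    (h : ∀ i ∈ s, ∀ j ∈ s, i ≠ j → ⟪v i, v j⟫_ℂ = 0) :
    ‖∑ i ∈ s, v i‖ ^ 2 = ∑ i ∈ s, ‖v i‖ ^ 2 := by
  have h' : ⟪∑ i ∈ s, v i, ∑ i ∈ s, v i⟫_ℂ = ((∑ i ∈ s, ‖v i‖ ^ 2 : ℝ) : ℂ) := by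
    rw [sum_inner, Complex.ofReal_sum]
    refine Finset.sum_congr rfl fun i hi => ?_
    rw [inner_sum, Finset.sum_eq_single i (fun j hj hji => h i hi j hj hji.symm)
      (fun hi' => absurd hi hi'), inner_self_eq_ofReal_norm_sq]
  rw [inner_self_eq_ofReal_norm_sq] at h'
  exact Complex.ofReal_injective h'

end Orthonormal

namespace TracialWStarSpace

variable {H : Type u} [NormedAddCommGroup H] [InnerProductSpace ℂ H] [CompleteSpace H]
  {W : TracialWStarSpace H} {ι : Type*} [Fintype ι] [DecidableEq ι]

/-- A family of self-adjoint elements, all of whose nonempty Wick words are centred. This is all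
that the combinatorics of Wigner integrals needs to know about free standard semicircular families.
-/
structure IsWickFamily (W : TracialWStarSpace H) (x : ι → W.Alg) : Prop where
  star_eq : ∀ i, star (x i) = x i
  φ_wick : ∀ w, w ≠ [] → W.φ (wick x w) = 0

variable {x : ι → W.Alg} (hx : W.IsWickFamily x)

namespace IsWickFamily
include hx

omit [Fintype ι] in
/-- Wick words are orthonormal. -/
theorem φ_star_wick_mul_wick (u v : List ι) :
    W.φ (star (wick x u) * wick x v) = if u = v then 1 else 0 := by
  rw [star_wick x hx.star_eq]
  induction u generalizing v with
  | nil =>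
    cases v with
    | nil => simp [W.φ_one]
    | cons j v => simp [hx.φ_wick]
  | cons i u ih =>
    cases v with
    | nil => simp [hx.φ_wick]
    | cons j v =>
      rw [List.reverse_cons, wick_snoc_mul_cons, map_add, hx.φ_wick _ (by simp), zero_add]
      by_cases h : i = j <;> simp [h, ih]

omit [Fintype ι] in
theorem inner_wick (u v : List ι) :
    ⟪W.toL2 (wick x u), W.toL2 (wick x v)⟫_ℂ = if u = v then 1 else 0 := by
  rw [inner_toL2, hx.φ_star_wick_mul_wick]

omit [Fintype ι] in
theorem inner_tmul_wick (u v u' v' : List ι) :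
    ⟪W.tmul (wick x u) (wick x v), W.tmul (wick x u') (wick x v')⟫_ℂ =
      (if u = u' then 1 else 0) * if v = v' then 1 else 0 := by
  rw [inner_tmul, hx.φ_star_wick_mul_wick, hx.φ_star_wick_mul_wick]

end IsWickFamily

/-- The element of the `n`-th Wigner chaos with the coefficients `c`. -/
def wickSum (x : ι → W.Alg) (n : ℕ) (c : List ι → ℂ) : W.Alg :=
  wordSum n fun w => c w • wick x w

/-- The squared `ℓ²` norm of the coefficients on words of length `n`. -/
def coeffNormSq (n : ℕ) (c : List ι → ℂ) : ℝ := wordSum n fun w => ‖c w‖ ^ 2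

omit [DecidableEq ι] in
theorem coeffNormSq_nonneg (n : ℕ) (c : List ι → ℂ) : 0 ≤ coeffNormSq n c :=
  wordSum_nonneg fun _ => by positivity

theorem toL2_wickSum (n : ℕ) (c : List ι → ℂ) :
    W.toL2 (wickSum x n c) = wordSum n fun w => c w • W.toL2 (wick x w) := by
  rw [wickSum, ← toL2L_apply, map_wordSum]
  simp

theorem star_wickSum (hx : W.IsWickFamily x) (n : ℕ) (c : List ι → ℂ) :
    star (wickSum x n c) = wickSum x n fun w => (starRingEnd ℂ) (c w.reverse) := by
  rw [wickSum, wickSum, ← wordSum_reverse n fun w => (starRingEnd ℂ) (c w.reverse) • wick x w,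
    ← starAddEquiv_apply, map_wordSum]
  simp only [starAddEquiv_apply, star_smul, star_wick x hx.star_eq, List.reverse_reverse]
  rfl

theorem norm_sq_toL2_wickSum (hx : W.IsWickFamily x) (n : ℕ) (c : List ι → ℂ) :
    ‖W.toL2 (wickSum x n c)‖ ^ 2 = coeffNormSq n c := by
  rw [toL2_wickSum, norm_sq_wordSum_smul hx.inner_wick, coeffNormSq]

theorem inner_toL2_wickSum_eq_zero (hx : W.IsWickFamily x) {n m : ℕ} (hnm : n ≠ m)
    (c d : List ι → ℂ) : ⟪W.toL2 (wickSum x n c), W.toL2 (wickSum x m d)⟫_ℂ = 0 := by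
  rw [toL2_wickSum, toL2_wickSum, inner_wordSum_left]
  refine (wordSum_congr fun u hu => ?_).trans (wordSum_const_zero n)
  rw [inner_wordSum_right]
  refine (wordSum_congr fun v hv => ?_).trans (wordSum_const_zero m)
  rw [inner_smul_left, inner_smul_right, hx.inner_wick, if_neg, mul_zero, mul_zero]
  rintro rfl
  exact hnm (hu.symm.trans hv)

/-! ### The product formula and Haagerup's inequality -/

/-- The coefficients of the `p`-th contraction `f ⌢ₚ g` of two kernels, where `f` has `n`
variables. -/
def contr (n p : ℕ) (c d : List ι → ℂ) (w : List ι) : ℂ :=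
  wordSum p fun z => c (w.take (n - p) ++ z) * d (z.reverse ++ w.drop (n - p))

theorem wickSum_contr (n m p : ℕ) (c d : List ι → ℂ) :
    wickSum x (n - p + (m - p)) (contr n p c d) =
      wordSum (n - p) fun u => wordSum (m - p) fun v =>
        (wordSum p fun z => c (u ++ z) * d (z.reverse ++ v)) • wick x (u ++ v) := by
  rw [wickSum, wordSum_append]
  refine wordSum_congr fun u hu => wordSum_congr fun v _ => ?_
  rw [contr, List.take_left' hu, List.drop_left' hu]

omit [DecidableEq ι] in
theorem coeffNormSq_contr (n m p : ℕ) (c d : List ι → ℂ) :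
    coeffNormSq (n - p + (m - p)) (contr n p c d) =
      wordSum (n - p) fun u => wordSum (m - p) fun v =>
        ‖wordSum p fun z => c (u ++ z) * d (z.reverse ++ v)‖ ^ 2 := by
  rw [coeffNormSq, wordSum_append]
  refine wordSum_congr fun u hu => wordSum_congr fun v _ => ?_
  rw [contr, List.take_left' hu, List.drop_left' hu]

/-- The product formula for Wigner integrals: the product of two chaos elements is the sum of the
integrals of the contractions of their kernels. -/
theorem wickSum_mul_wickSum (n m : ℕ) (c d : List ι → ℂ) :
    wickSum x n c * wickSum x m d =
      ∑ p ∈ Finset.range (min n m + 1), wickSum x (n - p + (m - p)) (contr n p c d) := by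
  have h := wordSum_wick_mul_wick x n m
    (fun u v => (c u * d v) • (LinearMap.id : W.Alg →ₗ[ℂ] W.Alg))
  have hL : wickSum x n c * wickSum x m d =
      wordSum n fun u => wordSum m fun v => (c u * d v) • (wick x u * wick x v) := by
    rw [wickSum, wickSum, ← wordSum_mul_const]
    refine wordSum_congr fun u _ => ?_
    rw [← wordSum_const_mul]
    refine wordSum_congr fun v _ => ?_
    rw [smul_mul_smul_comm]
  rw [hL]
  refine h.trans (Finset.sum_congr rfl fun p _ => ?_)
  rw [wickSum_contr]
  refine wordSum_congr fun u _ => wordSum_congr fun v _ => ?_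
  have : ∀ F : List ι → ℂ, (wordSum p fun z => F z • (LinearMap.id : W.Alg →ₗ[ℂ] W.Alg)) =
      (wordSum p F) • (LinearMap.id : W.Alg →ₗ[ℂ] W.Alg) := fun F =>
    (map_wordSum (LinearMap.toSpanSingleton ℂ _ (LinearMap.id : W.Alg →ₗ[ℂ] W.Alg)) p F).symm
  rw [this]
  rfl

omit [DecidableEq ι] in
theorem coeffNormSq_contr_le {n m p : ℕ} (hn : p ≤ n) (hm : p ≤ m) (c d : List ι → ℂ) :
    coeffNormSq (n - p + (m - p)) (contr n p c d) ≤ coeffNormSq n c * coeffNormSq m d := by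
  classical
  rw [coeffNormSq_contr]
  calc _ ≤ wordSum (n - p) fun u => wordSum (m - p) fun v =>
        (wordSum p fun z => ‖c (u ++ z)‖ ^ 2) * wordSum p fun z => ‖d (z.reverse ++ v)‖ ^ 2 :=
        wordSum_le_wordSum fun u _ => wordSum_le_wordSum fun v _ => norm_wordSum_mul_sq_le _ _ _
    _ = (wordSum (n - p) fun u => wordSum p fun z => ‖c (u ++ z)‖ ^ 2) *
        wordSum (m - p) fun v => wordSum p fun z => ‖d (z ++ v)‖ ^ 2 := by
        rw [← wordSum_mul_const]
        refine wordSum_congr fun u _ => ?_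
        rw [← wordSum_const_mul]
        refine wordSum_congr fun v _ => ?_
        rw [wordSum_reverse p fun z => ‖d (z ++ v)‖ ^ 2]
    _ = _ := by
        rw [wordSum_comm (m - p) p, ← wordSum_append _ _ fun w => ‖c w‖ ^ 2,
          ← wordSum_append _ _ fun w => ‖d w‖ ^ 2,
          Nat.sub_add_cancel hn, Nat.add_sub_cancel' hm]
        rfl

/-- Left multiplication by an element of the `n`-th chaos, on the linear span of the Wick words,
has norm at most `n + 1` for `‖·‖₂`. -/
theorem norm_toL2_wickSum_mul_sum_le (hx : W.IsWickFamily x) (n M : ℕ) (c d : List ι → ℂ) :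
    ‖W.toL2 (wickSum x n c * ∑ m ∈ Finset.range M, wickSum x m d)‖ ≤
      (n + 1) * √(coeffNormSq n c) * ‖W.toL2 (∑ m ∈ Finset.range M, wickSum x m d)‖ := by
  have hy : ‖W.toL2 (∑ m ∈ Finset.range M, wickSum x m d)‖ ^ 2 =
      ∑ m ∈ Finset.range M, coeffNormSq m d := by
    rw [← toL2L_apply, map_sum, norm_sq_sum_of_orthogonal]
    · exact Finset.sum_congr rfl fun m _ => norm_sq_toL2_wickSum hx m d
    · intro i _ j _ hij
      exact inner_toL2_wickSum_eq_zero hx hij d d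
  set y := ∑ m ∈ Finset.range M, wickSum x m d with hydef
  set T : ℕ → W.Alg := fun p => ∑ m ∈ (Finset.range M).filter (p ≤ ·),
    wickSum x (n - p + (m - p)) (contr n p c d) with hT
  have hprod : wickSum x n c * y = ∑ p ∈ Finset.range (n + 1), T p := by
    rw [hydef, Finset.mul_sum]
    simp only [wickSum_mul_wickSum, hT, Finset.sum_filter]
    rw [Finset.sum_comm]
    refine Finset.sum_congr rfl fun m _ => ?_
    rw [← Finset.sum_filter]
    refine Finset.sum_congr ?_ fun _ _ => rfl
    ext p; simp only [Finset.mem_range, Finset.mem_filter]; omega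
  have hTn : ∀ p ∈ Finset.range (n + 1), ‖W.toL2L (T p)‖ ≤ √(coeffNormSq n c) * ‖W.toL2 y‖ := by
    intro p hp
    have hpn : p ≤ n := Nat.lt_succ_iff.mp (Finset.mem_range.mp hp)
    refine le_of_sq_le_sq ?_ (by positivity)
    rw [mul_pow, Real.sq_sqrt (coeffNormSq_nonneg _ _), hy, hT, map_sum, norm_sq_sum_of_orthogonal,
      Finset.mul_sum]
    · refine (Finset.sum_le_sum fun m hm => ?_).trans
        (Finset.sum_le_sum_of_subset_of_nonneg (Finset.filter_subset (p ≤ ·) _)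
          fun m _ _ => mul_nonneg (coeffNormSq_nonneg _ _) (coeffNormSq_nonneg _ _))
      rw [toL2L_apply, norm_sq_toL2_wickSum hx]
      exact coeffNormSq_contr_le hpn (Finset.mem_filter.mp hm).2 c d
    · intro i hi j hj hij
      refine inner_toL2_wickSum_eq_zero hx ?_ _ _
      have := (Finset.mem_filter.mp hi).2
      have := (Finset.mem_filter.mp hj).2
      omega
  rw [hprod, ← toL2L_apply, map_sum]
  refine (norm_sum_le_of_le _ hTn).trans_eq ?_
  rw [Finset.sum_const, Finset.card_range, nsmul_eq_mul]
  push_cast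
  ring

omit [Fintype ι] in
theorem wick_mul_wick_mem_span (u v : List ι) :
    wick x u * wick x v ∈ Submodule.span ℂ (Set.range (wick x)) := by
  have hmem : ∀ w, wick x w ∈ Submodule.span ℂ (Set.range (wick x)) :=
    fun w => Submodule.subset_span ⟨w, rfl⟩
  induction u using List.reverseRecOn generalizing v with
  | nil => simpa using hmem v
  | append_singleton u i ih =>
    cases v with
    | nil => simpa using hmem _
    | cons j v =>
      rw [wick_snoc_mul_cons]
      refine Submodule.add_mem _ (hmem _) ?_
      split_ifs
      exacts [ih v, Submodule.zero_mem _]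

theorem exists_eq_sum_wickSum {y : W.Alg} (hy : y ∈ Submodule.span ℂ (Set.range (wick x))) :
    ∃ (M : ℕ) (d : List ι → ℂ), y = ∑ m ∈ Finset.range M, wickSum x m d := by
  obtain ⟨c, rfl⟩ := Finsupp.mem_span_range_iff_exists_finsupp.mp hy
  refine ⟨c.support.sup List.length + 1, c, ?_⟩
  have h : ∀ v, c v • wick x v =
      ∑ w ∈ c.support, if v = w then c v • wick x v else 0 := by
    intro v
    rw [Finset.sum_ite_eq]
    split_ifs with hv
    · rfl
    · rw [Finsupp.notMem_support_iff.mp hv, zero_smul]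
  simp only [wickSum]
  rw [Finset.sum_congr rfl fun m _ => congrArg (wordSum m) (funext h)]
  simp only [wordSum_finsetSum, wordSum_ite_eq]
  rw [Finset.sum_comm, Finsupp.sum]
  refine Finset.sum_congr rfl fun w hw => ?_
  have : w.length < c.support.sup List.length + 1 :=
    Nat.lt_succ_iff.mpr (Finset.le_sup (f := List.length) hw)
  simp [this]

/-- **Haagerup's inequality** in the free chaos: the operator norm of an element of the `n`-th chaos
is at most `n + 1` times its `L²` norm. -/
theorem norm_wickSum_le (hx : W.IsWickFamily x) (n : ℕ) (c : List ι → ℂ) :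
    ‖wickSum x n c‖ ≤ (n + 1) * √(coeffNormSq n c) := by
  set C : ℝ := (n + 1) * √(coeffNormSq n c) with hC
  have hC0 : 0 ≤ C := by positivity
  set 𝒟 := Submodule.span ℂ (Set.range (wick x)) with h𝒟
  have hmul : ∀ a ∈ 𝒟, ∀ y ∈ 𝒟, a * y ∈ 𝒟 := by
    intro a ha y hy
    induction ha using Submodule.span_induction with
    | zero => simp
    | add a b _ _ ha hb => rw [add_mul]; exact 𝒟.add_mem ha hb
    | smul c a _ ha => rw [smul_mul_assoc]; exact 𝒟.smul_mem c ha
    | mem a ha =>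
      obtain ⟨u, rfl⟩ := ha
      induction hy using Submodule.span_induction with
      | zero => simp
      | add a b _ _ ha hb => rw [mul_add]; exact 𝒟.add_mem ha hb
      | smul c a _ ha => rw [mul_smul_comm]; exact 𝒟.smul_mem c ha
      | mem b hb => obtain ⟨v, rfl⟩ := hb; exact wick_mul_wick_mem_span u v
  have hwick : ∀ w, wick x w ∈ 𝒟 := fun w => Submodule.subset_span ⟨w, rfl⟩
  have hsum : ∀ d : List ι → ℂ, wickSum x n d ∈ 𝒟 := by
    intro d
    rw [wickSum, wordSum_eq_sum_ofFn]
    exact 𝒟.sum_mem fun u _ => 𝒟.smul_mem _ (hwick _)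
  have hbound : ∀ d : List ι → ℂ, coeffNormSq n d = coeffNormSq n c → ∀ y ∈ 𝒟,
      ‖W.toL2 (wickSum x n d * y)‖ ≤ C * ‖W.toL2 y‖ := by
    intro d hd y hy
    obtain ⟨M, e, rfl⟩ := exists_eq_sum_wickSum hy
    rw [hC, ← hd]
    exact norm_toL2_wickSum_mul_sum_le hx n M d e
  set a := wickSum x n c with ha
  set c' : List ι → ℂ := fun w => (starRingEnd ℂ) (c w.reverse) with hc'
  have hstar : star a = wickSum x n c' := star_wickSum hx n c
  have hc'n : coeffNormSq n c' = coeffNormSq n c := by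
    rw [coeffNormSq, coeffNormSq, ← wordSum_reverse n fun w => ‖c w‖ ^ 2]
    simp [hc']
  have hpow : ∀ k : ℕ, (star a * a) ^ k ∈ 𝒟 ∧ ‖W.toL2 ((star a * a) ^ k)‖ ≤ (C ^ 2) ^ k := by
    intro k
    induction k with
    | zero =>
      refine ⟨by simpa using hwick [], ?_⟩
      have h1 : ‖W.toL2 1‖ ^ 2 = 1 := by rw [norm_toL2_sq]; simp [W.φ_one]
      have h2 : ‖W.toL2 1‖ = 1 := by
        nlinarith [norm_nonneg (W.toL2 1), sq_nonneg (‖W.toL2 1‖ - 1)]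
      simp [h2]
    | succ k ih =>
      have hay : a * (star a * a) ^ k ∈ 𝒟 := hmul _ (hsum c) _ ih.1
      rw [pow_succ', mul_assoc]
      refine ⟨hmul _ (hstar ▸ hsum c') _ hay, ?_⟩
      calc _ ≤ C * ‖W.toL2 (a * (star a * a) ^ k)‖ := by
            rw [hstar]; exact hbound c' hc'n _ (hstar ▸ hay)
        _ ≤ C * (C * ‖W.toL2 ((star a * a) ^ k)‖) := by
            gcongr; exact hbound c rfl _ ih.1
        _ ≤ C * (C * (C ^ 2) ^ k) := by gcongr; exact ih.2
        _ = (C ^ 2) ^ (k + 1) := by ring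
  refine W.norm_le_of_moments a hC0 fun k => ?_
  have h1 : W.φ ((star a * a) ^ k) = ⟪W.toL2 1, W.toL2 ((star a * a) ^ k)⟫_ℂ := by
    rw [inner_toL2, star_one, one_mul]
  have h2 : ‖W.toL2 (1 : W.Alg)‖ ≤ 1 := by
    simpa using (hpow 0).2
  calc _ ≤ ‖W.φ ((star a * a) ^ k)‖ := Complex.re_le_norm _
    _ ≤ ‖W.toL2 1‖ * ‖W.toL2 ((star a * a) ^ k)‖ := by rw [h1]; exact norm_inner_le_norm _ _
    _ ≤ 1 * (C ^ 2) ^ k := by gcongr; exact (hpow k).2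
    _ = _ := one_mul _

end TracialWStarSpace

/-! ### The free gradient of an element of a chaos -/

section Counting

theorem card_filter_add_eq (m a : ℕ) :
    (((Finset.range (m + 1) ×ˢ Finset.range (m + 1)).filter fun p => p.1 + p.2 = a).card : ℕ) =
      min a m + 1 - (a - m) := by
  rw [← Nat.card_Icc]
  refine Finset.card_nbij' (fun p => p.1) (fun i => (i, a - i)) ?_ ?_ ?_ ?_
  · intro p hp; simp at hp ⊢; omega
  · intro i hi; simp at hi ⊢; omega
  · intro p hp; ext <;> simp at hp ⊢; omega
  · intro i _; rfl

theorem sum_range_succ_sq (m : ℕ) :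
    ∑ a ∈ Finset.range m, ((a : ℝ) + 1) ^ 2 = (m : ℝ) * (m + 1) * (2 * m + 1) / 6 := by
  induction m with
  | zero => simp
  | succ m ih => rw [Finset.sum_range_succ, ih]; push_cast; ring

/-- The sum of the squares `1², 2², …, (m+1)², …, 2², 1²`. -/
theorem sum_card_filter_sq (m : ℕ) :
    ∑ a ∈ Finset.range (2 * m + 1),
      ((((Finset.range (m + 1) ×ˢ Finset.range (m + 1)).filter fun p => p.1 + p.2 = a).card : ℕ) : ℝ)
        ^ 2 = 1 / 3 * ((m + 1) * (2 * m ^ 2 + 4 * m + 3)) := by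
  simp only [card_filter_add_eq]
  rw [show 2 * m + 1 = (m + 1) + m by ring, Finset.sum_range_add]
  have h1 : ∑ a ∈ Finset.range (m + 1), (((min a m + 1 - (a - m) : ℕ) : ℝ)) ^ 2 =
      ∑ a ∈ Finset.range (m + 1), ((a : ℝ) + 1) ^ 2 := by
    refine Finset.sum_congr rfl fun a ha => ?_
    have : min a m + 1 - (a - m) = a + 1 := by simp at ha; omega
    rw [this]; push_cast; ring
  have h2 : ∑ b ∈ Finset.range m, (((min (m + 1 + b) m + 1 - (m + 1 + b - m) : ℕ) : ℝ)) ^ 2 =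
      ∑ b ∈ Finset.range m, ((b : ℝ) + 1) ^ 2 := by
    rw [← Finset.sum_range_reflect]
    refine Finset.sum_congr rfl fun b hb => ?_
    have : min (m + 1 + (m - 1 - b)) m + 1 - (m + 1 + (m - 1 - b) - m) = b + 1 := by
      simp at hb; omega
    rw [this]; push_cast; ring
  rw [h1, h2, sum_range_succ_sq, sum_range_succ_sq]
  push_cast
  ring

/-- In the product of two gradients, the contractions to the left and to the right of the gradient
variable only matter through their total number `q + 1`; each value occurs `q + 1` times. -/
theorem sum_contractions {E : Type*} [AddCommMonoid E] (N : ℕ) (F : ℕ → ℕ → ℕ → E) :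
    ∑ k ∈ Finset.range (N + 1), ∑ l ∈ Finset.range (N + 1),
      ∑ p ∈ Finset.range (min k l + 1), ∑ r ∈ Finset.range (min (N - l) (N - k) + 1),
        F (p + 1 + r) (k - p) (l - p) =
    ∑ q ∈ Finset.range (N + 1), (q + 1) •
      ∑ i ∈ Finset.range (N - q + 1), ∑ j ∈ Finset.range (N - q + 1), F (q + 1) i j := by
  have h : ∀ q, (q + 1) • ∑ i ∈ Finset.range (N - q + 1), ∑ j ∈ Finset.range (N - q + 1),
      F (q + 1) i j = ∑ _s ∈ Finset.range (q + 1), ∑ i ∈ Finset.range (N - q + 1),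
        ∑ j ∈ Finset.range (N - q + 1), F (q + 1) i j := by
    intro q; rw [Finset.sum_const, Finset.card_range]
  rw [Finset.sum_congr rfl fun q _ => h q]
  simp only [Finset.sum_sigma']
  refine Finset.sum_bij'
    (fun t _ => ⟨t.2.2.1 + t.2.2.2, t.2.2.1, t.1 - t.2.2.1, t.2.1 - t.2.2.1⟩)
    (fun t _ => ⟨t.2.2.1 + t.2.1, t.2.2.2 + t.2.1, t.2.1, t.1 - t.2.1⟩) ?_ ?_ ?_ ?_ ?_
  · rintro ⟨k, l, p, r⟩ ht
    simp only [Finset.mem_sigma, Finset.mem_range] at ht ⊢; omega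
  · rintro ⟨q, s, i, j⟩ ht
    simp only [Finset.mem_sigma, Finset.mem_range] at ht ⊢; omega
  · rintro ⟨k, l, p, r⟩ ht
    simp only [Finset.mem_sigma, Finset.mem_range] at ht
    have h1 : k - p + p = k := by omega
    have h2 : l - p + p = l := by omega
    have h3 : p + r - p = r := by omega
    simp only [h1, h2, h3]
  · rintro ⟨q, s, i, j⟩ ht
    simp only [Finset.mem_sigma, Finset.mem_range] at ht
    have h1 : i + s - s = i := by omega
    have h2 : j + s - s = j := by omega
    have h3 : s + (q - s) = q := by omega
    simp only [h1, h2, h3]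
  · rintro ⟨k, l, p, r⟩ ht
    have h1 : p + 1 + r = p + r + 1 := by omega
    simp only [h1]

end Counting

section WordSumLinear

variable {ι : Type*} [Fintype ι] {A E : Type*} [AddCommGroup A] [Module ℂ A] [AddCommGroup E]
  [Module ℂ E]

theorem wordSum_apply (n : ℕ) (F : List ι → A →ₗ[ℂ] E) (a : A) :
    wordSum n F a = wordSum n fun w => F w a :=
  map_wordSum (LinearMap.applyₗ a) n F

theorem wordSum_smul_const (n : ℕ) (c : List ι → ℂ) (y : E) :
    (wordSum n fun w => c w • y) = wordSum n c • y :=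
  (map_wordSum (LinearMap.toSpanSingleton ℂ E y) n c).symm

theorem wordSum_mem {n : ℕ} {F : List ι → E} (S : Submodule ℂ E)
    (h : ∀ w, w.length = n → F w ∈ S) : wordSum n F ∈ S := by
  induction n generalizing F with
  | zero => exact h [] rfl
  | succ n ih =>
    exact S.sum_mem fun i _ => ih fun w hw => h (i :: w) (by simp [hw])

end WordSumLinear

namespace TracialWStarSpace

variable {H : Type u} [NormedAddCommGroup H] [InnerProductSpace ℂ H] [CompleteSpace H]
  (W : TracialWStarSpace H)

/-- `tmul` as a bilinear map. -/
def tmulₗ : W.Alg →ₗ[ℂ] W.Alg →ₗ[ℂ] W.L2Tensor :=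
  LinearMap.mk₂ ℂ W.tmul
    (fun a a' b => by
      simp only [tmul, map_add, TensorProduct.add_tmul, UniformSpace.Completion.coe_add])
    (fun c a b => by
      simp only [tmul, map_smul, ← TensorProduct.smul_tmul', UniformSpace.Completion.coe_smul])
    (fun a b b' => by
      simp only [tmul, map_add, TensorProduct.tmul_add, UniformSpace.Completion.coe_add])
    (fun c a b => by
      simp only [tmul, map_smul, TensorProduct.tmul_smul, UniformSpace.Completion.coe_smul])

@[simp] theorem tmulₗ_apply (a b : W.Alg) : W.tmulₗ a b = W.tmul a b := rfl

variable {W} {ι : Type*} [Fintype ι] [DecidableEq ι] {x : ι → W.Alg}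

/-- The product `c (u ζ v) conj (c (u'ʳ ζ v'ʳ))`, where `ʳ` is the reversal of words. -/
def contrCoeff (c : List ι → ℂ) (u u' v' v ζ : List ι) : ℂ :=
  c (u ++ ζ ++ v) * (starRingEnd ℂ) (c (u'.reverse ++ ζ ++ v'.reverse))

/-- The contraction of `q` variables of `f` with those of its adjoint, embedded in the bi-chaos so
that `i` of the free variables of `f` and `j` of those of its adjoint belong to the left tensor
factor. -/
def biContr (x : ι → W.Alg) (c : List ι → ℂ) (n q i j : ℕ) : W.L2Tensor :=
  wordSum i fun u => wordSum j fun u' => wordSum (n - q - j) fun v' => wordSum (n - q - i) fun v =>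
    wordSum q (contrCoeff c u u' v' v) • W.tmul (wick x (u ++ u')) (wick x (v' ++ v))

/-- The product formula applied in both tensor factors. -/
theorem sum_tmul_wick_mul_star (hx : W.IsWickFamily x) (c : List ι → ℂ) {N k l : ℕ} (hk : k ≤ N)
    (hl : l ≤ N) :
    (wordSum k fun u => wordSum l fun u' => wordSum (N - l) fun v' => wordSum (N - k) fun v =>
      ∑ i, (c (u ++ i :: v) * (starRingEnd ℂ) (c (u' ++ i :: v'))) •
        W.tmul (wick x u * star (wick x u')) (star (wick x v') * wick x v)) =
    ∑ p ∈ Finset.range (min k l + 1), ∑ r ∈ Finset.range (min (N - l) (N - k) + 1),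
      biContr x c (N + 1) (p + 1 + r) (k - p) (l - p) := by
  -- the product formula in the left factor
  have left : (wordSum k fun u => wordSum l fun u' => wordSum (N - l) fun v' =>
        wordSum (N - k) fun v => ∑ i, (c (u ++ i :: v) * (starRingEnd ℂ) (c (u' ++ i :: v'))) •
          W.tmul (wick x u * star (wick x u')) (star (wick x v') * wick x v)) =
      ∑ p ∈ Finset.range (min k l + 1), wordSum (k - p) fun u => wordSum (l - p) fun u' =>
        wordSum (N - l) fun v' => wordSum (N - k) fun v =>
          wordSum (p + 1) (contrCoeff c u u' v' v) •
            W.tmul (wick x (u ++ u')) (wick x v' * wick x v) := by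
    have h := wordSum_wick_mul_wick x k l (fun u u' =>
      wordSum (N - l) fun v' => wordSum (N - k) fun v =>
        ∑ i, contrCoeff c u u' v' v [i] • W.tmulₗ.flip (wick x v' * wick x v))
    simp only [wordSum_apply, LinearMap.sum_apply, LinearMap.smul_apply, LinearMap.flip_apply,
      tmulₗ_apply] at h
    refine Eq.trans ?_ (h.trans ?_)
    · refine wordSum_congr fun u _ => ?_
      rw [← wordSum_reverse l]
      refine wordSum_congr fun u' _ => ?_
      rw [← wordSum_reverse (N - l)]
      simp only [star_wick x hx.star_eq, List.reverse_reverse, contrCoeff, List.append_assoc,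
        List.cons_append, List.nil_append]
    · refine Finset.sum_congr rfl fun p _ => wordSum_congr fun u _ => wordSum_congr fun u' _ => ?_
      rw [wordSum_comm]
      refine wordSum_congr fun v' _ => ?_
      rw [wordSum_comm]
      refine wordSum_congr fun v _ => ?_
      rw [← wordSum_smul_const, wordSum_snoc]
      simp only [contrCoeff, List.append_assoc, List.reverse_append, List.reverse_reverse]
  rw [left]
  refine Finset.sum_congr rfl fun p hp => ?_
  -- the product formula in the right factor
  have right : ∀ u u', (wordSum (N - l) fun v' => wordSum (N - k) fun v =>
        wordSum (p + 1) (contrCoeff c u u' v' v) •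
          W.tmul (wick x (u ++ u')) (wick x v' * wick x v)) =
      ∑ r ∈ Finset.range (min (N - l) (N - k) + 1), wordSum (N - l - r) fun v' =>
        wordSum (N - k - r) fun v => wordSum (p + 1 + r) (contrCoeff c u u' v' v) •
            W.tmul (wick x (u ++ u')) (wick x (v' ++ v)) := by
    intro u u'
    have h := wordSum_wick_mul_wick x (N - l) (N - k) (fun v' v =>
      wordSum (p + 1) (contrCoeff c u u' v' v) • W.tmulₗ (wick x (u ++ u')))
    simp only [wordSum_apply, LinearMap.smul_apply, tmulₗ_apply] at h
    refine h.trans (Finset.sum_congr rfl fun r _ => wordSum_congr fun v' _ =>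
      wordSum_congr fun v _ => ?_)
    rw [wordSum_smul_const, wordSum_append]
    refine congrArg (· • _) ?_
    rw [wordSum_comm]
    refine wordSum_congr fun ζ _ => ?_
    rw [← wordSum_reverse r]
    simp only [contrCoeff, List.append_assoc, List.reverse_append, List.reverse_reverse]
  simp only [right, wordSum_finsetSum]
  refine Finset.sum_congr rfl fun r hr => ?_
  simp only [Finset.mem_range] at hp hr
  rw [biContr, show N + 1 - (p + 1 + r) - (l - p) = N - l - r by omega,
    show N + 1 - (p + 1 + r) - (k - p) = N - k - r by omega]

/-- The squared norm of the contraction of `q` variables of a symmetric kernel with those of its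
adjoint, `m` variables being left free in each. -/
def contrNormSq (q m : ℕ) (c : List ι → ℂ) : ℝ :=
  wordSum m fun μ => wordSum m fun ν =>
    ‖wordSum q fun ζ => c (ζ ++ μ) * (starRingEnd ℂ) (c (ζ ++ ν))‖ ^ 2

omit [DecidableEq ι] in
theorem contrNormSq_nonneg (q m : ℕ) (c : List ι → ℂ) : 0 ≤ contrNormSq q m c :=
  wordSum_nonneg fun _ => wordSum_nonneg fun _ => by positivity

/-- For a symmetric kernel the norm of a contraction does not depend on how the free variables are
distributed over the two tensor factors. -/
theorem norm_sq_biContr (hx : W.IsWickFamily x) {c : List ι → ℂ}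
    (hc : ∀ u v : List ι, u.Perm v → c u = c v) {n q i j : ℕ} (hi : i ≤ n - q) (hj : j ≤ n - q) :
    ‖biContr x c n q i j‖ ^ 2 = contrNormSq q (n - q) c := by
  set m := n - q with hm
  set D : List ι → List ι → ℂ := fun w₁ w₂ =>
    wordSum q (contrCoeff c (w₁.take i) (w₁.drop i) (w₂.take (m - j)) (w₂.drop (m - j))) with hD
  have h1 : biContr x c n q i j = wordSum (i + j) fun w₁ => wordSum (m - j + (m - i)) fun w₂ =>
      D w₁ w₂ • W.tmul (wick x w₁) (wick x w₂) := by
    rw [biContr, wordSum_append]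
    refine wordSum_congr fun u hu => wordSum_congr fun u' _ => ?_
    rw [wordSum_append]
    refine wordSum_congr fun v' hv' => wordSum_congr fun v _ => ?_
    have hv' : v'.length = m - j := hv'
    simp only [hD, List.take_left' hu, List.drop_left' hu, List.take_left' hv',
      List.drop_left' hv']
  rw [h1, norm_sq_wordSum_wordSum_smul hx.inner_tmul_wick, wordSum_append]
  have h2 : ∀ u u' v' v, contrCoeff c u u' v' v =
      fun ζ => c (ζ ++ (u ++ v)) * (starRingEnd ℂ) (c (ζ ++ (u' ++ v'))) := by
    intro u u' v' v
    funext ζ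
    rw [contrCoeff, hc (u ++ ζ ++ v) (ζ ++ (u ++ v)), hc (u'.reverse ++ ζ ++ v'.reverse)
      (ζ ++ (u' ++ v'))]
    · refine ((List.reverse_perm u').append_right ζ |>.append (List.reverse_perm v')).trans ?_
      rw [← List.append_assoc]
      exact List.perm_append_comm.append_right v'
    · rw [← List.append_assoc]
      exact List.perm_append_comm.append_right v
  have h3 : contrNormSq q m c = wordSum i fun u => wordSum (m - i) fun v => wordSum j fun u' =>
      wordSum (m - j) fun v' => ‖wordSum q (contrCoeff c u u' v' v)‖ ^ 2 := by
    conv_lhs => rw [contrNormSq, ← Nat.add_sub_cancel' hi, wordSum_append]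
    refine wordSum_congr fun u _ => wordSum_congr fun v _ => ?_
    rw [Nat.add_sub_cancel' hi]
    conv_lhs => rw [← Nat.add_sub_cancel' hj, wordSum_append]
    simp only [h2]
  rw [h3]
  refine wordSum_congr fun u hu => ?_
  rw [wordSum_comm (m - i) j]
  refine wordSum_congr fun u' _ => ?_
  rw [wordSum_append, wordSum_comm (m - i) (m - j)]
  refine wordSum_congr fun v' hv' => wordSum_congr fun v _ => ?_
  simp only [hD, List.take_left' hu, List.drop_left' hu, List.take_left' hv',
      List.drop_left' hv']

/-- The linear span of the `wick u ⊗ wick v` with `u`, `v` of lengths `a`, `b`. -/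
def biChaos (x : ι → W.Alg) (ab : ℕ × ℕ) : Submodule ℂ W.L2Tensor :=
  Submodule.span ℂ {X | ∃ u v : List ι, u.length = ab.1 ∧ v.length = ab.2 ∧
    X = W.tmul (wick x u) (wick x v)}

omit [Fintype ι] in
theorem inner_biChaos_eq_zero (hx : W.IsWickFamily x) {ab ab' : ℕ × ℕ} (h : ab ≠ ab')
    {X Y : W.L2Tensor} (hX : X ∈ biChaos x ab) (hY : Y ∈ biChaos x ab') : ⟪X, Y⟫_ℂ = 0 := by
  have : (biChaos x ab) ⟂ (biChaos x ab') := by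
    rw [biChaos, biChaos, Submodule.isOrtho_span]
    rintro _ ⟨u, v, hu, hv, rfl⟩ _ ⟨u', v', hu', hv', rfl⟩
    rw [hx.inner_tmul_wick]
    by_contra hne
    have h1 : u = u' := by by_contra h1; simp [h1] at hne
    have h2 : v = v' := by by_contra h2; simp [h2] at hne
    exact h (Prod.ext (by rw [← hu, ← hu', h1]) (by rw [← hv, ← hv', h2]))
  exact Submodule.isOrtho_iff_inner_eq.mp this X hX Y hY

theorem biContr_mem_biChaos (c : List ι → ℂ) (n q : ℕ) {i j : ℕ} (hi : i ≤ n - q)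
    (hj : j ≤ n - q) : biContr x c n q i j ∈ biChaos x (i + j, 2 * (n - q) - (i + j)) := by
  refine wordSum_mem _ fun u hu => wordSum_mem _ fun u' hu' => wordSum_mem _ fun v' hv' =>
    wordSum_mem _ fun v hv => Submodule.smul_mem _ _ (Submodule.subset_span
      ⟨_, _, ?_, ?_, rfl⟩)
  · simp [hu, hu']
  · simp only [List.length_append, hv, hv']; omega

/-- The integral `∫ ∇ₛ (N₀⁻¹ F) ♯ (∇ₛ F)* ds` for `F = wickSum x n c`. -/
def sharpGradient (x : ι → W.Alg) (n : ℕ) (c : List ι → ℂ) : W.L2Tensor :=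
  (n : ℂ)⁻¹ • ∑ k ∈ Finset.range n, ∑ l ∈ Finset.range n,
    wordSum k fun u => wordSum l fun u' =>
      wordSum (n - 1 - l) fun v' => wordSum (n - 1 - k) fun v =>
        ∑ i, (c (u ++ i :: v) * (starRingEnd ℂ) (c (u' ++ i :: v'))) •
          W.tmul (wick x u * star (wick x u')) (star (wick x v') * wick x v)

/-- The chaos decomposition of `∫ ∇ₛ (N₀⁻¹ F) ♯ (∇ₛ F)* ds`. -/
theorem sharpGradient_eq (hx : W.IsWickFamily x) (N : ℕ) (c : List ι → ℂ) :
    sharpGradient x (N + 1) c = ((N + 1 : ℕ) : ℂ)⁻¹ • ∑ q ∈ Finset.range (N + 1), (q + 1) •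
      ∑ i ∈ Finset.range (N - q + 1), ∑ j ∈ Finset.range (N - q + 1),
        biContr x c (N + 1) (q + 1) i j := by
  rw [sharpGradient, ← sum_contractions N (biContr x c (N + 1))]
  congr 1
  refine Finset.sum_congr rfl fun k hk => Finset.sum_congr rfl fun l hl => ?_
  exact sum_tmul_wick_mul_star hx c (Nat.lt_succ_iff.mp (Finset.mem_range.mp hk))
    (Nat.lt_succ_iff.mp (Finset.mem_range.mp hl))

/-- The full contraction, of all variables, is a multiple of `1 ⊗ 1`. -/
theorem biContr_full (c : List ι → ℂ) (n : ℕ) :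
    biContr x c n n 0 0 = ((coeffNormSq n c : ℝ) : ℂ) • W.tmul 1 1 := by
  simp only [biContr, wordSum_zero, Nat.sub_self, List.append_nil, wick_nil]
  congr 1
  rw [coeffNormSq, ofReal_wordSum]
  refine wordSum_congr fun w _ => ?_
  simp only [contrCoeff, List.nil_append, List.append_nil, List.reverse_nil]
  rw [Complex.mul_conj, Complex.normSq_eq_norm_sq]

/-- After subtraction of the full contraction, the contractions of `q + 1` variables that belong to
the same bi-chaos are added with the triangle inequality, and different bi-chaoses are orthogonal.
The squares of the numbers of terms in each bi-chaos add up to the factor `Pₙ (q + 1)`. -/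
theorem norm_sq_sharpGradient_sub_le (hx : W.IsWickFamily x) {c : List ι → ℂ}
    (hc : ∀ u v : List ι, u.Perm v → c u = c v) (N : ℕ) :
    ‖sharpGradient x (N + 1) c - ((coeffNormSq (N + 1) c : ℝ) : ℂ) • W.tmul 1 1‖ ^ 2 ≤
      ∑ q ∈ Finset.range N, (1 / ((N + 1 : ℕ) : ℝ) ^ 2 * constP (N + 1) ((q + 1 : ℕ) : ℝ)) *
        contrNormSq (q + 1) (N - q) c := by
  set n := N + 1 with hn
  have hn0 : (n : ℂ) ≠ 0 := Nat.cast_ne_zero.mpr (Nat.succ_ne_zero N)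
  -- the component in the bi-chaos of order `(a, 2 (n - q - 1) - a)`
  set Y : ℕ → ℕ → W.L2Tensor := fun q a =>
    ∑ p ∈ (Finset.range (N - q + 1) ×ˢ Finset.range (N - q + 1)).filter fun p => p.1 + p.2 = a,
      biContr x c n (q + 1) p.1 p.2 with hY
  have hYmem : ∀ q a, Y q a ∈ biChaos x (a, 2 * (N - q) - a) := by
    intro q a
    refine Submodule.sum_mem _ fun p hp => ?_
    simp only [Finset.mem_filter, Finset.mem_product, Finset.mem_range] at hp
    have := biContr_mem_biChaos (x := x) c n (q + 1) (i := p.1) (j := p.2) (by omega) (by omega)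
    rwa [hp.2, show n - (q + 1) = N - q by omega] at this
  have hYnorm : ∀ q a, ‖Y q a‖ ^ 2 ≤
      ((((Finset.range (N - q + 1) ×ˢ Finset.range (N - q + 1)).filter
        fun p => p.1 + p.2 = a).card : ℕ) : ℝ) ^ 2 * contrNormSq (q + 1) (N - q) c := by
    intro q a
    rw [← Real.sq_sqrt (contrNormSq_nonneg (q + 1) (N - q) c), ← mul_pow]
    gcongr
    refine (norm_sum_le_of_le _ (f := fun p : ℕ × ℕ => biContr x c n (q + 1) p.1 p.2)
      (n := fun _ => √(contrNormSq (q + 1) (N - q) c)) fun p hp => ?_).trans_eq (by simp)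
    simp only [Finset.mem_filter, Finset.mem_product, Finset.mem_range] at hp
    refine Real.le_sqrt_of_sq_le (le_of_eq ?_)
    rw [norm_sq_biContr hx hc (by omega) (by omega), show n - (q + 1) = N - q by omega]
  have hsum : ∀ q, ∑ i ∈ Finset.range (N - q + 1), ∑ j ∈ Finset.range (N - q + 1),
      biContr x c n (q + 1) i j = ∑ a ∈ Finset.range (2 * (N - q) + 1), Y q a := by
    intro q
    rw [← Finset.sum_product', hY]
    refine (Finset.sum_fiberwise_of_maps_to (g := fun p : ℕ × ℕ => p.1 + p.2) ?_ _).symm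
    intro p hp
    simp only [Finset.mem_product, Finset.mem_range] at hp ⊢
    omega
  have hG : sharpGradient x n c - ((coeffNormSq n c : ℝ) : ℂ) • W.tmul 1 1 =
      ∑ t ∈ (Finset.range N).sigma fun q => Finset.range (2 * (N - q) + 1),
        (((t.1 + 1 : ℕ) : ℂ) / n) • Y t.1 t.2 := by
    rw [sharpGradient_eq hx, Finset.sum_range_succ, Nat.sub_self, zero_add, Finset.sum_range_one,
      Finset.sum_range_one, ← hn, biContr_full, smul_add, ← Nat.cast_smul_eq_nsmul ℂ,
      inv_smul_smul₀ hn0, add_sub_cancel_right, Finset.smul_sum, Finset.sum_sigma]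
    refine Finset.sum_congr rfl fun q _ => ?_
    rw [hsum, ← Nat.cast_smul_eq_nsmul ℂ, smul_smul, Finset.smul_sum]
    refine Finset.sum_congr rfl fun a _ => ?_
    rw [mul_comm, div_eq_mul_inv]
  rw [hG, norm_sq_sum_of_orthogonal, Finset.sum_sigma]
  · refine Finset.sum_le_sum fun q hq => ?_
    have hq' : q < N := Finset.mem_range.mp hq
    calc ∑ a ∈ Finset.range (2 * (N - q) + 1), ‖(((q + 1 : ℕ) : ℂ) / n) • Y q a‖ ^ 2
        = ∑ a ∈ Finset.range (2 * (N - q) + 1), (((q + 1 : ℕ) : ℝ) / n) ^ 2 * ‖Y q a‖ ^ 2 := by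
          refine Finset.sum_congr rfl fun a _ => ?_
          rw [norm_smul, mul_pow, norm_div, Complex.norm_natCast, Complex.norm_natCast]
      _ ≤ ∑ a ∈ Finset.range (2 * (N - q) + 1), (((q + 1 : ℕ) : ℝ) / n) ^ 2 *
          (((((Finset.range (N - q + 1) ×ˢ Finset.range (N - q + 1)).filter
            fun p => p.1 + p.2 = a).card : ℕ) : ℝ) ^ 2 * contrNormSq (q + 1) (N - q) c) := by
          gcongr with a _
          exact hYnorm q a
      _ = _ := by
          rw [← Finset.mul_sum, ← Finset.sum_mul, sum_card_filter_sq, constP,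
            Nat.cast_sub hq'.le]
          have : (n : ℝ) ≠ 0 := Nat.cast_ne_zero.mpr (Nat.succ_ne_zero N)
          push_cast [hn]
          field_simp
          ring
  · rintro ⟨q, a⟩ h ⟨q', a'⟩ h' hne
    simp only [Finset.mem_sigma, Finset.mem_range] at h h'
    refine inner_biChaos_eq_zero hx (ab := (a, 2 * (N - q) - a)) (ab' := (a', 2 * (N - q') - a'))
      ?_ (Submodule.smul_mem _ _ (hYmem _ _)) (Submodule.smul_mem _ _ (hYmem _ _))
    intro heq
    simp only [Prod.mk.injEq] at heq
    apply hne
    have h1 : a = a' := heq.1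
    have h2 : q = q' := by omega
    rw [h1, h2]

/-! ### The fourth moment -/

theorem star_wickSum_of_symm (hx : W.IsWickFamily x) {c : List ι → ℂ}
    (hc : ∀ u v : List ι, u.Perm v → c u = c v) (hreal : ∀ w, (starRingEnd ℂ) (c w) = c w) (n : ℕ) :
    star (wickSum x n c) = wickSum x n c := by
  rw [star_wickSum hx]
  congr 1
  funext w
  rw [hreal, hc _ _ (List.reverse_perm w)]

/-- The fourth moment is the squared norm of `F²`, whose components in the different chaoses are the
contractions of the kernel with itself. -/
theorem φ_wickSum_pow_four (hx : W.IsWickFamily x) {c : List ι → ℂ}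
    (hc : ∀ u v : List ι, u.Perm v → c u = c v) (hreal : ∀ w, (starRingEnd ℂ) (c w) = c w) (n : ℕ) :
    (W.φ (wickSum x n c ^ 4)).re = ∑ p ∈ Finset.range (n + 1), contrNormSq p (n - p) c := by
  have hstar := star_wickSum_of_symm hx hc hreal n
  have h1 : wickSum x n c ^ 4 = star (wickSum x n c * wickSum x n c) *
      (wickSum x n c * wickSum x n c) := by
    rw [star_mul, hstar]; noncomm_ring
  rw [h1, ← norm_toL2_sq, wickSum_mul_wickSum, min_self, ← toL2L_apply, map_sum,
    norm_sq_sum_of_orthogonal]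
  · refine Finset.sum_congr rfl fun p _ => ?_
    rw [toL2L_apply, norm_sq_toL2_wickSum hx, coeffNormSq_contr, contrNormSq]
    refine wordSum_congr fun u _ => wordSum_congr fun v _ => ?_
    congr 2
    refine wordSum_congr fun z _ => ?_
    rw [hreal, hc (u ++ z) (z ++ u) List.perm_append_comm,
      hc (z.reverse ++ v) (z ++ v) ((List.reverse_perm z).append_right v)]
  · intro p hp p' hp' hne
    simp only [Finset.mem_range] at hp hp'
    exact inner_toL2_wickSum_eq_zero hx (by omega) _ _

omit [DecidableEq ι] in
theorem contrNormSq_zero_left (n : ℕ) (c : List ι → ℂ) :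
    contrNormSq 0 n c = coeffNormSq n c ^ 2 := by
  simp only [contrNormSq, wordSum_zero, List.nil_append, norm_mul, mul_pow, RCLike.norm_conj,
    wordSum_const_mul, wordSum_mul_const]
  rw [sq (coeffNormSq n c)]; rfl

omit [DecidableEq ι] in
theorem contrNormSq_zero_right (n : ℕ) (c : List ι → ℂ) :
    contrNormSq n 0 c = coeffNormSq n c ^ 2 := by
  simp only [contrNormSq, wordSum_zero, List.append_nil]
  congr 1
  have : (wordSum n fun ζ => c ζ * (starRingEnd ℂ) (c ζ)) = ((coeffNormSq n c : ℝ) : ℂ) := by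
    rw [coeffNormSq, ofReal_wordSum]
    refine wordSum_congr fun w _ => ?_
    rw [Complex.mul_conj, Complex.normSq_eq_norm_sq]
  rw [this, Complex.norm_real, Real.norm_of_nonneg (coeffNormSq_nonneg _ _)]

/-- The quantitative fourth moment bound, for kernels that are simple functions. -/
theorem norm_sq_sharpGradient_sub_le_fourth_moment (hx : W.IsWickFamily x) {c : List ι → ℂ}
    (hc : ∀ u v : List ι, u.Perm v → c u = c v) (hreal : ∀ w, (starRingEnd ℂ) (c w) = c w) {n : ℕ}
    (hn : 1 ≤ n) {C : ℝ} (hC : ∀ q : ℕ, 1 ≤ q → q ≤ n - 1 → 1 / (n : ℝ) ^ 2 * constP n q ≤ C) :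
    ‖sharpGradient x n c - ((coeffNormSq n c : ℝ) : ℂ) • W.tmul 1 1‖ ^ 2 ≤
      C * ((W.φ (wickSum x n c ^ 4)).re - 2 * coeffNormSq n c ^ 2) := by
  obtain ⟨N, rfl⟩ := Nat.exists_eq_add_of_le' hn
  have h4 : (W.φ (wickSum x (N + 1) c ^ 4)).re - 2 * coeffNormSq (N + 1) c ^ 2 =
      ∑ q ∈ Finset.range N, contrNormSq (q + 1) (N - q) c := by
    rw [φ_wickSum_pow_four hx hc hreal, Finset.sum_range_succ, Finset.sum_range_succ', Nat.sub_self,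
      Nat.sub_zero, contrNormSq_zero_left, contrNormSq_zero_right]
    simp only [Nat.add_sub_add_right]
    ring
  rw [h4, Finset.mul_sum]
  refine (norm_sq_sharpGradient_sub_le hx hc N).trans (Finset.sum_le_sum fun q hq => ?_)
  have := Finset.mem_range.mp hq
  exact mul_le_mul_of_nonneg_right (hC (q + 1) (by omega) (by omega)) (contrNormSq_nonneg _ _ _)

end TracialWStarSpace

/-! ### The constant `Cₙ` -/

section Constants

/-- In the variable `w = N - u`, where `N = n + 1`, the derivative of `Pₙ` has the sign of this
cubic polynomial. -/
def critCubic (N w : ℝ) : ℝ := 10 * w ^ 3 - 6 * N * w ^ 2 + 3 * w - N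

/-- Cardano's formula. -/
theorem critCubic_constU (n : ℕ) : critCubic (n + 1) (n + 1 - constU n) = 0 := by
  set N : ℝ := (n : ℝ) + 1 with hN
  have hN1 : 1 ≤ N := by rw [hN]; linarith [(Nat.cast_nonneg n : (0 : ℝ) ≤ n)]
  have hn : (n : ℝ) = N - 1 := by rw [hN]; ring
  set D : ℝ := 4 * N ^ 4 - 4 * N ^ 2 + 5 with hD
  have hD0 : 0 ≤ D := by nlinarith [sq_nonneg (2 * N ^ 2 - 1)]
  set s : ℝ := 5 * √2 * √D with hs
  have hs2 : s ^ 2 = 50 * D := by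
    rw [hs, mul_pow, mul_pow, Real.sq_sqrt (by norm_num), Real.sq_sqrt hD0]; ring
  have hX : 0 < 4 * N ^ 3 + 10 * N + s := by positivity
  have hRarg : constR n = (4 * N ^ 3 + 10 * N + s) ^ (1 / 3 : ℝ) := by
    rw [constR, hs, hD, hn]; ring_nf
  have cube : ∀ {y : ℝ}, 0 ≤ y → (y ^ (1 / 3 : ℝ)) ^ 3 = y := by
    intro y hy
    rw [← Real.rpow_natCast, ← Real.rpow_mul hy]; norm_num
  set r := constR n with hr
  have hr0 : 0 < r := by rw [hRarg]; positivity
  have hr3 : r ^ 3 = 4 * N ^ 3 + 10 * N + s := by rw [hRarg]; exact cube hX.le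
  set t : ℝ := (2 : ℝ) ^ (1 / 3 : ℝ) with ht
  have ht0 : 0 < t := by positivity
  have ht3 : t ^ 3 = 2 := cube (by norm_num)
  have h4 : (4 : ℝ) ^ (1 / 3 : ℝ) = t ^ 2 := by
    rw [ht, ← Real.rpow_natCast, ← Real.rpow_mul (by norm_num), mul_comm,
      Real.rpow_mul (by norm_num)]
    norm_num
  set a := r / t ^ 2 with ha
  set b := (2 * N ^ 2 - 5) / (t * r) with hb
  have hab : a * b = (2 * N ^ 2 - 5) / 2 := by
    rw [ha, hb, ← ht3]; field_simp
  have ha3 : a ^ 3 = (4 * N ^ 3 + 10 * N + s) / 4 := by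
    rw [ha, div_pow, hr3, show (t ^ 2) ^ 3 = (t ^ 3) ^ 2 by ring, ht3]; norm_num
  have hb3 : b ^ 3 = (4 * N ^ 3 + 10 * N - s) / 4 := by
    have h1 : (4 * N ^ 3 + 10 * N + s) * b ^ 3 = (2 * N ^ 2 - 5) ^ 3 / 2 := by
      rw [hb, div_pow, mul_pow, hr3, ht3]
      generalize 4 * N ^ 3 + 10 * N + s = Z at hX
      field_simp
    have h2 : (4 * N ^ 3 + 10 * N + s) * ((4 * N ^ 3 + 10 * N - s) / 4) =
        (2 * N ^ 2 - 5) ^ 3 / 2 := by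
      rw [hD] at hs2
      linear_combination (-1 / 4 : ℝ) * hs2
    exact mul_left_cancel₀ hX.ne' (h1.trans h2.symm)
  have hu : constU n = N - (N + (a + b)) / 5 := by
    rw [constU, ← hr, h4, ha, hb, hn]; ring
  rw [hu, critCubic]
  linear_combination (2 / 25 : ℝ) * (ha3 + hb3 + 3 * (a + b) * hab)

/-- To the left of a point where it is not positive, the cubic is negative; so it has a single real
root. -/
theorem critCubic_strictMono {N w w' : ℝ} (hww : w < w') (h : critCubic N w' ≤ 0) :
    critCubic N w < 0 := by
  unfold critCubic at *
  -- `critCubic N w < 0` means that `w (10 w² + 3) / (6 w² + 1) < N`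
  have h1 : w' * (10 * w' ^ 2 + 3) ≤ N * (6 * w' ^ 2 + 1) := by nlinarith
  have h2 : w * (10 * w ^ 2 + 3) * (6 * w' ^ 2 + 1) < w' * (10 * w' ^ 2 + 3) * (6 * w ^ 2 + 1) := by
    have : w' * (10 * w' ^ 2 + 3) * (6 * w ^ 2 + 1) - w * (10 * w ^ 2 + 3) * (6 * w' ^ 2 + 1) =
        (w' - w) * (60 * w ^ 2 * w' ^ 2 + 10 * (w' ^ 2 + w * w' + w ^ 2) - 18 * (w * w') + 3) := by
      ring
    have h3 : 0 < 60 * w ^ 2 * w' ^ 2 + 10 * (w' ^ 2 + w * w' + w ^ 2) - 18 * (w * w') + 3 := by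
      nlinarith [sq_nonneg (w - w'), sq_nonneg (w * w')]
    nlinarith [mul_pos (sub_pos.mpr hww) h3]
  have h3 : 0 < 6 * w' ^ 2 + 1 := by positivity
  have h4 : w * (10 * w ^ 2 + 3) * (6 * w' ^ 2 + 1) < N * (6 * w ^ 2 + 1) * (6 * w' ^ 2 + 1) := by
    have : w' * (10 * w' ^ 2 + 3) * (6 * w ^ 2 + 1) ≤ N * (6 * w' ^ 2 + 1) * (6 * w ^ 2 + 1) :=
      mul_le_mul_of_nonneg_right h1 (by positivity)
    linarith
  have h5 := lt_of_mul_lt_mul_right h4 h3.le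
  linarith

theorem hasDerivAt_constP (n : ℕ) (u : ℝ) :
    HasDerivAt (constP n) (u / 3 * critCubic (n + 1) (n + 1 - u)) u := by
  have h : constP n = fun u : ℝ => 1 / 3 * (u ^ 2 * (2 * ((n + 1 : ℝ) - u) ^ 3 + ((n + 1 : ℝ) - u)))
      := by
    funext u; rw [constP]; ring
  have h0 : HasDerivAt (fun u : ℝ => (n + 1 : ℝ) - u) (-1) u := by
    simpa using (hasDerivAt_id u).const_sub (n + 1 : ℝ)
  rw [h]
  refine (((hasDerivAt_pow 2 u).mul (((h0.pow 3).const_mul 2).add h0)).const_mul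
    (1 / 3 : ℝ)).congr_deriv ?_
  simp only [critCubic, Pi.add_apply, Pi.pow_apply]
  push_cast
  ring

theorem constU_pos (n : ℕ) : 0 < constU n := by
  by_contra! h
  have hN : (0 : ℝ) < n + 1 := by positivity
  have h0 : critCubic (n + 1) (n + 1) < 0 ∨ (n + 1 : ℝ) = n + 1 - constU n := by
    rcases h.lt_or_eq with h | h
    · exact .inl (critCubic_strictMono (by linarith) (critCubic_constU n).le)
    · exact .inr (by linarith)
  have h1 : 0 < critCubic (n + 1) (n + 1) := by
    unfold critCubic
    nlinarith [pow_pos hN 3]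
  rcases h0 with h0 | h0
  · linarith
  · have := critCubic_constU n
    rw [← h0] at this
    linarith

theorem monotoneOn_constP (n : ℕ) : MonotoneOn (constP n) (Set.Icc 0 (constU n)) := by
  refine monotoneOn_of_deriv_nonneg (convex_Icc _ _)
    (fun u _ => (hasDerivAt_constP n u).continuousAt.continuousWithinAt)
    (fun u _ => (hasDerivAt_constP n u).differentiableAt.differentiableWithinAt) fun u hu => ?_
  rw [interior_Icc] at hu
  rw [(hasDerivAt_constP n u).deriv]
  refine mul_nonneg (by linarith [hu.1]) ?_
  by_contra! h
  have := critCubic_strictMono (w := n + 1 - constU n) (w' := n + 1 - u)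
    (by linarith [hu.2]) h.le
  linarith [critCubic_constU n]

theorem antitoneOn_constP (n : ℕ) : AntitoneOn (constP n) (Set.Icc (constU n) (n + 1)) := by
  refine antitoneOn_of_deriv_nonpos (convex_Icc _ _)
    (fun u _ => (hasDerivAt_constP n u).continuousAt.continuousWithinAt)
    (fun u _ => (hasDerivAt_constP n u).differentiableAt.differentiableWithinAt) fun u hu => ?_
  rw [interior_Icc] at hu
  rw [(hasDerivAt_constP n u).deriv]
  refine mul_nonpos_of_nonneg_of_nonpos (by linarith [hu.1, constU_pos n]) ?_
  exact (critCubic_strictMono (by linarith [hu.1])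
    (critCubic_constU n).le).le

/-- `Pₙ` increases up to `u₀` and decreases afterwards, so that `Cₙ` bounds its values at all
integers between `0` and `n`. -/
theorem constP_le_constC {n q : ℕ} (hq : q ≤ n) : 1 / (n : ℝ) ^ 2 * constP n q ≤ constC n := by
  rw [constC]
  refine mul_le_mul_of_nonneg_left ?_ (by positivity)
  have hqn : (q : ℝ) ≤ n := by exact_mod_cast hq
  rcases le_total (q : ℝ) (constU n) with h | h
  · refine le_max_of_le_left (monotoneOn_constP n ⟨Nat.cast_nonneg q, h⟩ ⟨?_, Int.floor_le _⟩ ?_)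
    · exact_mod_cast Int.floor_nonneg.mpr (constU_pos n).le
    · exact_mod_cast Int.le_floor.mpr (show ((q : ℤ) : ℝ) ≤ constU n by exact_mod_cast h)
  · have hle : (⌈constU n⌉ : ℝ) ≤ q := by
      exact_mod_cast Int.ceil_le.mpr (show constU n ≤ ((q : ℤ) : ℝ) by exact_mod_cast h)
    exact le_max_of_le_right (antitoneOn_constP n ⟨Int.le_ceil _, by linarith⟩
      ⟨h, by linarith⟩ hle)

end Constants

/-! ### Free increments form a Wick family -/

section WickBlocks

variable {ι : Type*} [DecidableEq ι] {A : Type*} [Ring A] (x : ι → A)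

/-- Runs of a single letter give Chebyshev polynomials. -/
theorem wick_replicate [Algebra ℂ A] (i : ι) (k : ℕ) :
    wick x (List.replicate k i) = Polynomial.aeval (x i) (Polynomial.Chebyshev.S ℂ k) := by
  induction k using Nat.twoStepInduction with
  | zero => simp
  | one => simp
  | more k ih₁ ih₂ =>
    rw [List.replicate_succ, List.replicate_succ, wick_cons_cons, if_pos rfl, ih₁,
      ← List.replicate_succ, ih₂]
    push_cast
    rw [Polynomial.Chebyshev.S_add_two, map_sub, map_mul, Polynomial.aeval_X]

omit [DecidableEq ι] in
/-- A word is a concatenation of blocks with alternating colours. -/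
theorem exists_alternating_blocks (color : ι → Bool) {w : List ι} (hw : w ≠ []) :
    ∃ L : List (Bool × List ι), L ≠ [] ∧ L.IsChain (fun p q => p.1 ≠ q.1) ∧
      (∀ p ∈ L, p.2 ≠ [] ∧ ∀ i ∈ p.2, color i = p.1) ∧ (L.map Prod.snd).flatten = w := by
  induction w with
  | nil => exact absurd rfl hw
  | cons i w ih =>
    rcases eq_or_ne w [] with rfl | hw'
    · exact ⟨[(color i, [i])], by simp, by simp, by simp, by simp⟩
    obtain ⟨L, hL, hc, hp, hf⟩ := ih hw'
    cases L with
    | nil => exact absurd rfl hL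
    | cons q L =>
      by_cases hiq : color i = q.1
      · refine ⟨(q.1, i :: q.2) :: L, by simp, ?_, ?_, ?_⟩
        · cases L with
          | nil => simp
          | cons q' L =>
            rw [List.isChain_cons_cons] at hc ⊢
            exact hc
        · intro p hpm
          rcases List.mem_cons.mp hpm with rfl | hpm
          · refine ⟨by simp, fun j hj => ?_⟩
            rcases List.mem_cons.mp hj with rfl | hj
            · exact hiq
            · exact (hp q (by simp)).2 j hj
          · exact hp p (List.mem_cons_of_mem _ hpm)
        · rw [← hf]; simp
      · refine ⟨(color i, [i]) :: q :: L, by simp, List.isChain_cons_cons.mpr ⟨hiq, hc⟩, ?_, ?_⟩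
        · intro p hpm
          rcases List.mem_cons.mp hpm with rfl | hpm
          · simp
          · exact hp p hpm
        · rw [← hf]; simp

/-- Wick words are multiplicative over blocks of alternating colours, because the letters next to a
common end of two blocks are different. -/
theorem wick_flatten_blocks (color : ι → Bool) (L : List (Bool × List ι))
    (hc : L.IsChain fun p q => p.1 ≠ q.1)
    (hp : ∀ p ∈ L, p.2 ≠ [] ∧ ∀ i ∈ p.2, color i = p.1) :
    wick x (L.map Prod.snd).flatten = (L.map fun p => wick x p.2).prod := by
  induction L with
  | nil => simp
  | cons p L ih =>
    rw [List.map_cons, List.flatten_cons, List.map_cons, List.prod_cons, wick_append,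
      ih hc.tail fun q hq => hp q (List.mem_cons_of_mem _ hq)]
    intro i hi j hj
    cases L with
    | nil => simp at hj
    | cons q L =>
      rw [List.map_cons, List.flatten_cons, List.head?_append_of_ne_nil _ (hp q (by simp)).1] at hj
      have h1 := (hp p (by simp)).2 i (List.mem_of_getLast? hi)
      have h2 := (hp q (by simp)).2 j (List.mem_of_head? hj)
      rintro rfl
      exact (List.isChain_cons_cons.mp hc).1 (h1.symm.trans h2)

end WickBlocks

theorem integral_cos_nat_mul_pi {m : ℕ} (hm : m ≠ 0) :
    ∫ θ in Real.pi..0, Real.cos (m * θ) = 0 := by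
  have hm' : (m : ℝ) ≠ 0 := Nat.cast_ne_zero.mpr hm
  rw [intervalIntegral.integral_comp_mul_left (fun y => Real.cos y) hm', integral_cos]
  simp [Real.sin_nat_mul_pi]

/-- Chebyshev polynomials of the second kind of positive degree integrate to zero against the
semicircle density. -/
theorem integral_chebyshev_semicircle {t : ℝ} (ht : 0 < t) {k : ℕ} (hk : k ≠ 0) :
    ∫ y in (-(2 * √t))..(2 * √t), (Polynomial.Chebyshev.S ℝ k).eval ((√t)⁻¹ * y) *
      ((2 * Real.pi * t)⁻¹ * √(4 * t - y ^ 2)) = 0 := by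
  set s := √t with hs
  have hs0 : 0 < s := Real.sqrt_pos.mpr ht
  have hst : t = s ^ 2 := (Real.sq_sqrt ht.le).symm
  set g : ℝ → ℝ := fun y => (Polynomial.Chebyshev.S ℝ k).eval (s⁻¹ * y) *
      ((2 * Real.pi * t)⁻¹ * √(4 * t - y ^ 2)) with hg
  have hgc : Continuous g := by
    rw [hg]
    exact ((Polynomial.continuous _).comp (by fun_prop)).mul (by fun_prop)
  have hsub := intervalIntegral.integral_comp_mul_deriv' (a := Real.pi) (b := 0)
    (f := fun θ => 2 * s * Real.cos θ) (f' := fun θ => 2 * s * -Real.sin θ) (g := g)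
    (fun θ _ => (Real.hasDerivAt_cos θ).const_mul (2 * s)) (by fun_prop) hgc.continuousOn
  simp only [Real.cos_pi, Real.cos_zero, mul_one, mul_neg] at hsub
  rw [← hsub]
  have hpt : ∀ θ ∈ Set.uIcc Real.pi 0, -((g ∘ fun θ => 2 * s * Real.cos θ) θ * (2 * s * Real.sin θ)) =
      -(Real.pi)⁻¹ * (Real.cos (k * θ) - Real.cos ((k + 2 : ℕ) * θ)) := by
    intro θ hθ
    rw [Set.uIcc_of_ge Real.pi_pos.le] at hθ
    have hsin := Real.sin_nonneg_of_mem_Icc hθ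
    have h1 : √(4 * t - (2 * s * Real.cos θ) ^ 2) = 2 * s * Real.sin θ := by
      rw [← Real.sqrt_sq (by positivity : 0 ≤ 2 * s * Real.sin θ), hst]
      congr 1
      linear_combination (-4) * s ^ 2 * Real.sin_sq_add_cos_sq θ
    have h2 := Polynomial.Chebyshev.S_two_mul_real_cos θ k
    have h3 : Real.cos (k * θ) - Real.cos ((k + 2 : ℕ) * θ) =
        2 * (Real.sin ((k + 1) * θ) * Real.sin θ) := by
      have e1 : (k : ℝ) * θ = (k + 1) * θ - θ := by ring
      have e2 : ((k + 2 : ℕ) : ℝ) * θ = (k + 1) * θ + θ := by push_cast; ring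
      rw [e1, e2, Real.cos_sub, Real.cos_add]; ring
    simp only [hg, Function.comp_apply]
    rw [h1, h3, show s⁻¹ * (2 * s * Real.cos θ) = 2 * Real.cos θ by field_simp]
    push_cast at h2
    rw [← h2, hst]
    have := Real.pi_pos.ne'
    field_simp
  rw [intervalIntegral.integral_congr hpt, intervalIntegral.integral_const_mul,
    intervalIntegral.integral_sub (Continuous.intervalIntegrable (by fun_prop) _ _)
      (Continuous.intervalIntegrable (by fun_prop) _ _), integral_cos_nat_mul_pi hk,
    integral_cos_nat_mul_pi (by omega)]
  simp

namespace TracialWStarSpace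

variable {H : Type u} [NormedAddCommGroup H] [InnerProductSpace ℂ H] [CompleteSpace H]
  {W : TracialWStarSpace H}

theorem IsSemicircular.φ_aeval {X : W.Alg} {t : ℝ} (h : W.IsSemicircular X t)
    (P : Polynomial ℝ) :
    W.φ (Polynomial.aeval X (P.map (algebraMap ℝ ℂ))) =
      ((∫ y in (-(2 * √t))..(2 * √t), P.eval y * ((2 * Real.pi * t)⁻¹ * √(4 * t - y ^ 2)) : ℝ) :
        ℂ) := by
  have hc : ∀ k : ℕ, IntervalIntegrable
      (fun y : ℝ => y ^ k * ((2 * Real.pi * t)⁻¹ * √(4 * t - y ^ 2))) volume (-(2 * √t)) (2 * √t) :=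
    fun k => Continuous.intervalIntegrable (by fun_prop) _ _
  induction P using Polynomial.induction_on' with
  | add p q hp hq =>
    have hcp : ∀ p : Polynomial ℝ, IntervalIntegrable
        (fun y : ℝ => p.eval y * ((2 * Real.pi * t)⁻¹ * √(4 * t - y ^ 2))) volume
        (-(2 * √t)) (2 * √t) :=
      fun p => Continuous.intervalIntegrable (p.continuous.mul (by fun_prop)) _ _
    rw [Polynomial.map_add, map_add, map_add, hp, hq, ← Complex.ofReal_add,
      ← intervalIntegral.integral_add (hcp p) (hcp q)]
    simp only [Polynomial.eval_add, add_mul]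
  | monomial k a =>
    rw [Polynomial.map_monomial, Polynomial.aeval_monomial, ← Algebra.smul_def, map_smul, h.2]
    simp only [Polynomial.eval_monomial, mul_assoc, intervalIntegral.integral_const_mul]
    push_cast
    rfl

/-- Chebyshev polynomials of positive degree of a normalized semicircular element are centred. -/
theorem IsSemicircular.φ_chebyshev {X : W.Alg} {t : ℝ} (ht : 0 < t) (h : W.IsSemicircular X t)
    {k : ℕ} (hk : k ≠ 0) :
    W.φ (Polynomial.aeval ((((√t)⁻¹ : ℝ) : ℂ) • X) (Polynomial.Chebyshev.S ℂ k)) = 0 := by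
  have h1 : Polynomial.aeval ((((√t)⁻¹ : ℝ) : ℂ) • X) (Polynomial.Chebyshev.S ℂ k) =
      Polynomial.aeval X (((Polynomial.Chebyshev.S ℝ k).comp
        (Polynomial.C (√t)⁻¹ * Polynomial.X)).map (algebraMap ℝ ℂ)) := by
    rw [Polynomial.map_comp, Polynomial.Chebyshev.map_S, Polynomial.aeval_comp]
    congr 1
    simp [Algebra.smul_def]
  rw [h1, h.φ_aeval]
  simp only [Polynomial.eval_comp, Polynomial.eval_mul, Polynomial.eval_C, Polynomial.eval_X]
  rw [integral_chebyshev_semicircle ht hk, Complex.ofReal_zero]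

theorem wick_mem_vN {ι : Type*} [DecidableEq ι] {x : ι → W.Alg} (N : VonNeumannAlgebra H)
    {w : List ι} (h : ∀ i ∈ w, (x i : H →L[ℂ] H) ∈ N) : ((wick x w : W.Alg) : H →L[ℂ] H) ∈ N := by
  induction w using List.twoStepInduction with
  | nil => simp
  | singleton i => exact h i (by simp)
  | cons_cons i j w ih₁ ih₂ =>
    rw [wick_cons_cons]
    have h1 := ih₂ j fun k hk => h k (List.mem_cons_of_mem _ hk)
    have h2 := ih₁ fun k hk => h k (List.mem_cons_of_mem _ (List.mem_cons_of_mem _ hk))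
    have h3 := mul_mem (h i (by simp)) h1
    split_ifs
    · exact sub_mem h3 h2
    · exact sub_mem h3 (zero_mem N)

/-- The increments of a free Brownian motion over successive intervals, normalized to variance one,
form a Wick family. -/
theorem FreeBrownianMotion.isWickFamily (B : FreeBrownianMotion W) {ι : Type*} [Fintype ι]
    [LinearOrder ι] (lo hi : ι → ℝ≥0) (hlt : ∀ i, lo i < hi i)
    (hle : ∀ i j, i < j → hi i ≤ lo j) :
    W.IsWickFamily fun i => (((√((hi i : ℝ) - lo i))⁻¹ : ℝ) : ℂ) • (B.S (hi i) - B.S (lo i)) := by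
  set x : ι → W.Alg := fun i => (((√((hi i : ℝ) - lo i))⁻¹ : ℝ) : ℂ) • (B.S (hi i) - B.S (lo i))
    with hx
  have hpos : ∀ i, 0 < (hi i : ℝ) - lo i := fun i => sub_pos.mpr (by exact_mod_cast hlt i)
  refine ⟨fun i => ?_, fun w => ?_⟩
  · have := (B.semicircular_increment _ _ (hlt i)).1
    rw [star_smul, this.star_eq, Complex.star_def, Complex.conj_ofReal]
  -- induction on the number of letters: the blocks of the largest letter alternate with blocks
  -- of earlier letters, which belong to the filtration
  induction hn : w.toFinset.card using Nat.strong_induction_on generalizing w with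
  | _ n ih =>
  intro hw
  obtain ⟨m, hmw, hmax⟩ := w.toFinset.exists_max_image id (by simpa using hw)
  rw [List.mem_toFinset] at hmw
  obtain ⟨L, hL, hLc, hLp, hLf⟩ := exists_alternating_blocks (fun i => decide (i = m)) hw
  have hsub : ∀ p ∈ L, ∀ i ∈ p.2, i ∈ w := by
    intro p hp i hi
    rw [← hLf, List.mem_flatten]
    exact ⟨p.2, List.mem_map_of_mem hp, hi⟩
  have key := B.free_increment (lo m) (hi m) (hlt m) (L.map fun p => (p.1, wick x p.2))
    (by simpa using hL) ((List.isChain_map _).mpr hLc) ?_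
  · rw [← hLf, wick_flatten_blocks x _ L hLc hLp]
    simpa [List.map_map, Function.comp_def] using key
  · intro q hq
    obtain ⟨p, hp, rfl⟩ := List.mem_map.mp hq
    obtain ⟨hne, hcol⟩ := hLp p hp
    rcases hb : p.1 with _ | _
    · have hlt' : ∀ i ∈ p.2, i < m := by
        intro i hi
        have h1 : i ≠ m := by have := hcol i hi; rw [hb] at this; simpa using this
        exact lt_of_le_of_ne (hmax i (List.mem_toFinset.mpr (hsub p hp i hi))) h1
      refine ⟨?_, by simp, fun _ => ?_⟩
      · refine ih _ ?_ p.2 rfl hne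
        rw [← hn]
        refine Finset.card_lt_card ⟨fun i hi => ?_, fun h => ?_⟩
        · rw [List.mem_toFinset] at hi ⊢
          exact hsub p hp i hi
        · exact lt_irrefl m (hlt' m (List.mem_toFinset.mp (h (List.mem_toFinset.mpr hmw))))
      · refine wick_mem_vN _ fun i hi => ?_
        have hle' := hle i m (hlt' i hi)
        refine (B.filtration (lo m)).toStarSubalgebra.smul_mem (sub_mem ?_ ?_) _
        · exact B.filtration_mono hle' (B.adapted _)
        · exact B.filtration_mono ((hlt i).le.trans hle') (B.adapted _)
    · have hrep : p.2 = List.replicate p.2.length m := by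
        refine List.eq_replicate_of_mem fun i hi => ?_
        have := hcol i hi
        rw [hb] at this
        simpa using this
      have hk : p.2.length ≠ 0 := by simpa using hne
      have hwick : wick x p.2 = Polynomial.aeval (x m) (Polynomial.Chebyshev.S ℂ p.2.length) := by
        conv_lhs => rw [hrep]
        exact wick_replicate x m _
      refine ⟨?_, fun _ => ?_, by simp⟩
      · rw [hwick]
        exact (B.semicircular_increment _ _ (hlt m)).φ_chebyshev (hpos m) hk
      · refine ⟨(Polynomial.Chebyshev.S ℂ p.2.length).comp
          (Polynomial.C (((√((hi m : ℝ) - lo m))⁻¹ : ℝ) : ℂ) * Polynomial.X), ?_⟩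
        rw [hwick, Polynomial.aeval_comp]
        simp [hx, Algebra.smul_def]

end TracialWStarSpace

/-! ### Boxes with disjoint sides -/

section Boxes

variable {n : ℕ}

/-- The sides of the box `∏ (aᵢ, bᵢ]` are pairwise disjoint. -/
def DisjointSides (a b : Fin n → ℝ≥0) : Prop :=
  ∀ i j, i ≠ j → Disjoint (Set.Ioc (a i) (b i)) (Set.Ioc (a j) (b j))

theorem DisjointSides.mono {a b a' b' : Fin n → ℝ≥0} (h : DisjointSides a b)
    (hsub : ∀ i, Set.Ioc (a' i) (b' i) ⊆ Set.Ioc (a i) (b i)) : DisjointSides a' b' :=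
  fun i j hij => (h i j hij).mono (hsub i) (hsub j)

theorem mem_box {a b : Fin n → ℝ≥0} {y : Fin n → ℝ} :
    y ∈ box a b ↔ ∀ i, (a i : ℝ) < y i ∧ y i ≤ b i := by
  simp [box]

theorem lebPos_eq_restrict (n : ℕ) :
    lebPos n = volume.restrict (Set.univ.pi fun _ : Fin n => Set.Ici (0 : ℝ)) := by
  rw [lebPos, ← Measure.restrict_pi_pi]; rfl

/-- Almost every point of `ℝ₊ⁿ` has positive and pairwise distinct coordinates. -/
theorem ae_lebPos_pos_injective (n : ℕ) :
    ∀ᵐ y ∂lebPos n, (∀ i, 0 < y i) ∧ Function.Injective y := by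
  have hpos : ∀ᵐ y ∂lebPos n, ∀ i, 0 ≤ y i := by
    rw [lebPos_eq_restrict]
    refine (ae_restrict_mem (MeasurableSet.univ_pi fun _ => measurableSet_Ici)).mono ?_
    intro y hy i
    exact hy i trivial
  have hac : lebPos n ≪ volume := by
    rw [lebPos_eq_restrict]; exact Measure.absolutelyContinuous_of_le Measure.restrict_le_self
  have hnull : ∀ g : (Fin n → ℝ) →ₗ[ℝ] ℝ, g ≠ 0 → ∀ᵐ y ∂lebPos n, g y ≠ 0 := by
    intro g hg
    have h : ∀ᵐ y ∂(volume : Measure (Fin n → ℝ)), g y ≠ 0 := by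
      have := Measure.addHaar_submodule volume (LinearMap.ker g) (mt LinearMap.ker_eq_top.mp hg)
      rw [ae_iff]
      have hset : {y : Fin n → ℝ | ¬ g y ≠ 0} = (LinearMap.ker g : Set (Fin n → ℝ)) := by
        ext y; simp
      rw [hset]
      exact this
    exact hac.ae_le h
  have h1 : ∀ i : Fin n, ∀ᵐ y ∂lebPos n, y i ≠ 0 := fun i =>
    hnull (LinearMap.proj i) fun h => by
      have := congrArg (fun g => g (Pi.single i 1)) h
      simp at this
  have h2 : ∀ i j : Fin n, ∀ᵐ y ∂lebPos n, i ≠ j → y i ≠ y j := by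
    intro i j
    by_cases hij : i = j
    · simp [hij]
    have := hnull ((LinearMap.proj i : (Fin n → ℝ) →ₗ[ℝ] ℝ) - LinearMap.proj j) fun h => by
      have hy : ∀ y : Fin n → ℝ, y i - y j = 0 := fun y => LinearMap.congr_fun h y
      have := hy (Pi.single i 1)
      rw [Pi.single_eq_same, Pi.single_eq_of_ne (Ne.symm hij)] at this
      simp at this
    filter_upwards [this] with y hy _ h
    exact hy (by simp [h])
  filter_upwards [hpos, ae_all_iff.mpr h1, ae_all_iff.mpr fun i => ae_all_iff.mpr (h2 i)]
    with y hy h1 h2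
  refine ⟨fun i => lt_of_le_of_ne (hy i) (h1 i).symm, fun i j hij => ?_⟩
  by_contra hne
  exact h2 i j hne hij

/-- A point with distinct positive coordinates lies in a rational box with disjoint sides. -/
theorem exists_rat_box {y : Fin n → ℝ} (hpos : ∀ i, 0 < y i) (hinj : Function.Injective y) :
    ∃ a b : Fin n → ℚ≥0, DisjointSides (fun i => (a i : ℝ≥0)) (fun i => (b i : ℝ≥0)) ∧
      (∀ i, (a i : ℝ≥0) ≤ b i) ∧ y ∈ box (fun i => (a i : ℝ≥0)) fun i => (b i : ℝ≥0) := by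
  obtain ⟨δ, hδ, hδ0⟩ : ∃ δ : ℝ, (∀ i j, i ≠ j → δ < |y i - y j| / 2) ∧ 0 < δ := by
    have h : ∀ᶠ δ in nhdsWithin (0 : ℝ) (Set.Ioi 0), ∀ i j, i ≠ j → δ < |y i - y j| / 2 := by
      refine Filter.eventually_all.mpr fun i => Filter.eventually_all.mpr fun j => ?_
      by_cases hij : i = j
      · simp [hij]
      have : 0 < |y i - y j| / 2 := by
        have := abs_pos.mpr (sub_ne_zero.mpr (hinj.ne hij)); linarith
      filter_upwards [nhdsWithin_le_nhds (Iio_mem_nhds this)] with δ hδ _ using hδ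
    obtain ⟨δ, h1, h2⟩ := (h.and self_mem_nhdsWithin).exists
    exact ⟨δ, h1, h2⟩
  have hrat : ∀ l u : ℝ, l < u → 0 < u → ∃ q : ℚ≥0, l < (q : ℝ) ∧ (q : ℝ) < u := by
    intro l u hlu hu
    obtain ⟨q, hq1, hq2⟩ := exists_rat_btwn (max_lt hlu hu)
    have hq0 : 0 ≤ q := by exact_mod_cast (le_max_right l 0).trans hq1.le
    exact ⟨⟨q, hq0⟩, (le_max_left l 0).trans_lt hq1, hq2⟩
  choose a ha1 ha2 using fun i => hrat (y i - δ) (y i) (by linarith) (hpos i)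
  choose b hb1 hb2 using fun i => hrat (y i) (y i + δ) (by linarith) (by linarith [hpos i])
  refine ⟨a, b, fun i j hij => ?_, fun i => ?_, mem_box.mpr fun i => ⟨?_, ?_⟩⟩
  · rw [Set.disjoint_left]
    rintro z ⟨h1, h2⟩ ⟨h3, h4⟩
    have h1' : (a i : ℝ) < z := by exact_mod_cast h1
    have h2' : (z : ℝ) ≤ b i := by exact_mod_cast h2
    have h3' : (a j : ℝ) < z := by exact_mod_cast h3
    have h4' : (z : ℝ) ≤ b j := by exact_mod_cast h4
    have h5 : |y i - y j| ≤ 2 * δ := by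
      rw [abs_le]
      constructor <;> linarith [ha1 i, ha1 j, hb2 i, hb2 j]
    linarith [hδ i j hij]
  · exact_mod_cast (ha2 i).le.trans (hb1 i).le
  · exact_mod_cast ha2 i
  · exact_mod_cast (hb1 i).le

/-- The intersection of a half-open box with a box of `ℝ₊ⁿ` is a box of `ℝ₊ⁿ` with smaller sides. -/
theorem inter_box_eq (a b : Fin n → ℝ≥0) (l u : Fin n → ℝ) :
    ∃ a' b' : Fin n → ℝ≥0, a' ≤ b' ∧ (∀ i, Set.Ioc (a' i) (b' i) ⊆ Set.Ioc (a i) (b i)) ∧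
      (Set.univ.pi fun i => Set.Ioc (l i) (u i)) ∩ box a b = box a' b' := by
  refine ⟨fun i => max (a i) (l i).toNNReal, fun i =>
    max (max (a i) (l i).toNNReal) (min (b i) (u i).toNNReal), fun i => le_max_left _ _,
    fun i z hz => ?_, ?_⟩
  · obtain ⟨h1, h2⟩ := hz
    refine ⟨(le_max_left _ _).trans_lt h1, ?_⟩
    rcases le_max_iff.mp h2 with h2 | h2
    · exact absurd h1 (not_lt.mpr h2)
    · exact h2.trans (min_le_left _ _)
  · ext y
    simp only [Set.mem_inter_iff, mem_box, Set.mem_univ_pi, Set.mem_Ioc, ← forall_and]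
    refine forall_congr' fun i => ?_
    have ha := (a i).2
    simp only [NNReal.coe_max, NNReal.coe_min, Real.coe_toNNReal', max_lt_iff, le_max_iff,
      le_min_iff]
    constructor
    · rintro ⟨⟨h1, h2⟩, h3, h4⟩
      exact ⟨⟨h3, h1, lt_of_le_of_lt ha h3⟩, .inr ⟨h4, .inl h2⟩⟩
    · rintro ⟨⟨h1, h2, h3⟩, h | ⟨h4, h5⟩⟩
      · rcases h with h | h | h <;> linarith
      · refine ⟨⟨h2, ?_⟩, h1, h4⟩
        rcases h5 with h5 | h5 <;> linarith

/-- The half-open boxes of `ℝⁿ`. -/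
def iocBoxes (n : ℕ) : Set (Set (Fin n → ℝ)) :=
  Set.univ.pi '' Set.univ.pi fun _ => {S | ∃ l u : ℝ, l < u ∧ Set.Ioc l u = S}

theorem measurableSpace_eq_generateFrom_iocBoxes (n : ℕ) :
    (MeasurableSpace.pi : MeasurableSpace (Fin n → ℝ)) =
      MeasurableSpace.generateFrom (iocBoxes n) := by
  have h := generateFrom_pi_eq (ι := Fin n) (α := fun _ => ℝ)
    (C := fun _ => {S | ∃ l u : ℝ, l < u ∧ Set.Ioc l u = S}) fun _ => by
      refine ⟨fun k : ℕ => Set.Ioc (-(k + 1 : ℝ)) (k + 1), fun k =>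
        ⟨_, _, by linarith [(Nat.cast_nonneg k : (0 : ℝ) ≤ k)], rfl⟩, ?_⟩
      refine Set.eq_univ_of_forall fun z => Set.mem_iUnion.mpr ?_
      obtain ⟨k, hk⟩ := exists_nat_gt |z|
      have := abs_lt.mp hk
      exact ⟨k, by linarith, by linarith⟩
  rw [iocBoxes, ← h]
  congr 1
  funext _
  rw [← borel_eq_generateFrom_Ioc, BorelSpace.measurable_eq (α := ℝ)]

theorem isPiSystem_iocBoxes (n : ℕ) : IsPiSystem (iocBoxes n) :=
  IsPiSystem.pi fun _ => isPiSystem_Ioc id id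

/-- The indicator functions of the boxes with disjoint sides are total in `L²(ℝ₊ⁿ)`, because the
diagonals are null sets. -/
theorem topologicalClosure_span_boxIndicator (n : ℕ) :
    (Submodule.span ℂ {g : Lp ℂ 2 (lebPos n) | ∃ a b : Fin n → ℝ≥0, a ≤ b ∧ DisjointSides a b ∧
      g = boxIndicator a b}).topologicalClosure = ⊤ := by
  rw [Submodule.topologicalClosure_eq_top_iff, Submodule.eq_bot_iff]
  intro f hf
  have hbox : ∀ a b : Fin n → ℝ≥0, a ≤ b → DisjointSides a b →
      ∫ y in box a b, f y ∂lebPos n = 0 := by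
    intro a b hab hd
    rw [← L2.inner_indicatorConstLp_one (𝕜 := ℂ) (measurableSet_box a b) (lebPos_box_ne_top a b) f]
    exact (Submodule.mem_orthogonal _ _).mp hf _ (Submodule.subset_span ⟨a, b, hab, hd, rfl⟩)
  have hzero : ∀ a b : Fin n → ℝ≥0, a ≤ b → DisjointSides a b →
      f =ᵐ[(lebPos n).restrict (box a b)] 0 := by
    intro a b hab hd
    have hint : Integrable f ((lebPos n).restrict (box a b)) := by
      have : IsFiniteMeasure ((lebPos n).restrict (box a b)) :=
        ⟨by rw [Measure.restrict_apply_univ]; exact (lebPos_box_ne_top a b).lt_top⟩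
      exact ((Lp.memLp f).restrict _).integrable (by norm_num)
    refine hint.ae_eq_zero_of_forall_setIntegral_eq_zero fun s hs hfin => ?_
    clear hfin
    induction s, hs using MeasurableSpace.induction_on_inter
      (measurableSpace_eq_generateFrom_iocBoxes n) (isPiSystem_iocBoxes n) with
    | empty => simp
    | basic t ht =>
      obtain ⟨C, hC, rfl⟩ := ht
      choose l u hlu hC' using fun i => hC i trivial
      obtain ⟨a', b', hab', hsub, hinter⟩ := inter_box_eq a b l u
      have : (Set.univ.pi C) = Set.univ.pi fun i => Set.Ioc (l i) (u i) := by
        congr 1; funext i; exact (hC' i).symm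
      rw [this, Measure.restrict_restrict (MeasurableSet.univ_pi fun _ => measurableSet_Ioc), hinter]
      exact hbox a' b' hab' (hd.mono hsub)
    | compl t htm ih =>
      have := integral_add_compl htm hint
      rw [ih, zero_add] at this
      rw [this]
      exact hbox a b hab hd
    | iUnion g hgd hgm ih =>
      rw [integral_iUnion hgm hgd hint.integrableOn]
      simp [ih]
  have hall : ∀ᵐ y ∂lebPos n, ∀ ab : (Fin n → ℚ≥0) × (Fin n → ℚ≥0),
      (fun i => (ab.1 i : ℝ≥0)) ≤ (fun i => (ab.2 i : ℝ≥0)) →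
      DisjointSides (fun i => (ab.1 i : ℝ≥0)) (fun i => (ab.2 i : ℝ≥0)) →
      y ∈ box (fun i => (ab.1 i : ℝ≥0)) (fun i => (ab.2 i : ℝ≥0)) → f y = 0 := by
    refine ae_all_iff.mpr fun ab => ?_
    by_cases h1 : (fun i => (ab.1 i : ℝ≥0)) ≤ (fun i => (ab.2 i : ℝ≥0))
    · by_cases h2 : DisjointSides (fun i => (ab.1 i : ℝ≥0)) (fun i => (ab.2 i : ℝ≥0))
      · filter_upwards [(ae_restrict_iff' (measurableSet_box _ _)).mp (hzero _ _ h1 h2)]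
          with y hy _ _ using hy
      · exact .of_forall fun y _ h => absurd h h2
    · exact .of_forall fun y h => absurd h h1
  rw [Lp.eq_zero_iff_ae_eq_zero]
  filter_upwards [hall, ae_lebPos_pos_injective n] with y hy ⟨hpos, hinj⟩
  obtain ⟨a, b, hd, hab, hmem⟩ := exists_rat_box hpos hinj
  exact hy (a, b) hab hd hmem

end Boxes

/-! ### Products of linear combinations as sums over words -/

section TensorCoeff

variable {ι : Type*}

/-- The coefficient of the word `w` in the tensor product of the linear combinations `ds` of
letters. -/
def tensorCoeff : List (ι → ℂ) → List ι → ℂ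
  | [], [] => 1
  | d :: ds, i :: w => d i * tensorCoeff ds w
  | _, _ => 0

@[simp] theorem tensorCoeff_nil : tensorCoeff ([] : List (ι → ℂ)) [] = 1 := rfl

@[simp] theorem tensorCoeff_cons (d : ι → ℂ) (ds : List (ι → ℂ)) (i : ι) (w : List ι) :
    tensorCoeff (d :: ds) (i :: w) = d i * tensorCoeff ds w := rfl

theorem tensorCoeff_append {ds : List (ι → ℂ)} {w : List ι} (h : w.length = ds.length)
    (ds' : List (ι → ℂ)) (w' : List ι) :
    tensorCoeff (ds ++ ds') (w ++ w') = tensorCoeff ds w * tensorCoeff ds' w' := by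
  induction ds generalizing w with
  | nil => rw [List.length_eq_zero_iff.mp h]; simp
  | cons d ds ih =>
    cases w with
    | nil => simp at h
    | cons i w =>
      have := ih (w := w) (by simpa using h)
      simp [this, mul_assoc]

theorem tensorCoeff_ofFn {n : ℕ} (d : Fin n → ι → ℂ) (u : Fin n → ι) :
    tensorCoeff (List.ofFn d) (List.ofFn u) = ∏ k, d k (u k) := by
  induction n with
  | zero => simp
  | succ n ih => simp [List.ofFn_succ, Fin.prod_univ_succ, ih]

theorem nodup_of_tensorCoeff_ne_zero {ds : List (ι → ℂ)}
    (hds : ds.Pairwise fun d d' => ∀ i, d i = 0 ∨ d' i = 0) {w : List ι}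
    (hw : tensorCoeff ds w ≠ 0) : w.Nodup := by
  have hmem : ∀ (ds : List (ι → ℂ)) (w : List ι), tensorCoeff ds w ≠ 0 →
      ∀ i ∈ w, ∃ d ∈ ds, d i ≠ 0 := by
    intro ds
    induction ds with
    | nil => rintro (_ | ⟨i, w⟩) h <;> simp_all [tensorCoeff]
    | cons d ds ih =>
      rintro (_ | ⟨j, w⟩) h i hi
      · simp at hi
      · rw [tensorCoeff_cons] at h
        rcases List.mem_cons.mp hi with rfl | hi
        · exact ⟨d, by simp, left_ne_zero_of_mul h⟩
        · obtain ⟨d', hd', h'⟩ := ih w (right_ne_zero_of_mul h) i hi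
          exact ⟨d', by simp [hd'], h'⟩
  induction ds generalizing w with
  | nil => cases w <;> simp_all [tensorCoeff]
  | cons d ds ih =>
    cases w with
    | nil => exact List.nodup_nil
    | cons i w =>
      rw [tensorCoeff_cons] at hw
      rw [List.pairwise_cons] at hds
      refine List.nodup_cons.mpr ⟨fun hi => ?_, ih hds.2 (right_ne_zero_of_mul hw)⟩
      obtain ⟨d', hd', h'⟩ := hmem ds w (right_ne_zero_of_mul hw) i hi
      exact (hds.1 d' hd' i).elim (left_ne_zero_of_mul hw) h'

variable [Fintype ι] {A : Type*} [Ring A] [Algebra ℂ A]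

theorem prod_map_sum_smul (x : ι → A) (ds : List (ι → ℂ)) :
    (ds.map fun d => ∑ i, d i • x i).prod =
      wordSum ds.length fun w => tensorCoeff ds w • (w.map x).prod := by
  induction ds with
  | nil => simp
  | cons d ds ih =>
    rw [List.map_cons, List.prod_cons, ih, List.length_cons, wordSum_succ, Finset.sum_mul]
    refine Finset.sum_congr rfl fun i _ => ?_
    rw [← wordSum_const_mul]
    refine wordSum_congr fun w _ => ?_
    rw [tensorCoeff_cons, List.map_cons, List.prod_cons, smul_mul_smul_comm]

/-- A product of linear combinations of letters with disjoint supports is a sum of Wick words. -/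
theorem prod_map_sum_smul_eq_wick [DecidableEq ι] (x : ι → A) {ds : List (ι → ℂ)}
    (hds : ds.Pairwise fun d d' => ∀ i, d i = 0 ∨ d' i = 0) :
    (ds.map fun d => ∑ i, d i • x i).prod =
      wordSum ds.length fun w => tensorCoeff ds w • wick x w := by
  rw [prod_map_sum_smul]
  refine wordSum_congr fun w _ => ?_
  by_cases h : tensorCoeff ds w = 0
  · rw [h, zero_smul, zero_smul]
  · rw [wick_eq_prod_of_isChain x (List.Pairwise.isChain (nodup_of_tensorCoeff_ne_zero hds h))]

end TensorCoeff

/-! ### Grids -/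

section Grid

/-- The length of the `i`-th cell `(tᵢ, tᵢ₊₁]` of a grid `t`. -/
def cellWidth (t : ℕ → ℝ≥0) (i : ℕ) : ℝ := (t (i + 1) : ℝ) - t i

/-- The normalised indicator function of the `i`-th cell of a grid. -/
def cellFun (t : ℕ → ℝ≥0) (i : ℕ) : ℝ → ℂ :=
  (Set.Ioc (t i : ℝ) (t (i + 1))).indicator fun _ => (((√(cellWidth t i))⁻¹ : ℝ) : ℂ)

/-- The coordinates of the indicator function of `(tⱼ, tₖ]` in the functions `cellFun t i`. -/
def intervalCoeff (t : ℕ → ℝ≥0) {m : ℕ} (j k : ℕ) (i : Fin m) : ℂ :=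
  if j ≤ i ∧ (i : ℕ) < k then ((√(cellWidth t i) : ℝ) : ℂ) else 0

theorem sum_ite_sub {M : Type*} [AddCommGroup M] (g : ℕ → M) {j k m : ℕ} (hjk : j ≤ k)
    (hkm : k ≤ m) :
    ∑ i : Fin m, (if j ≤ (i : ℕ) ∧ (i : ℕ) < k then g (i + 1) - g i else 0) = g k - g j := by
  rw [Fin.sum_univ_eq_sum_range fun i => if j ≤ i ∧ i < k then g (i + 1) - g i else 0,
    ← Finset.sum_filter, ← Finset.sum_Ico_sub g hjk]
  refine Finset.sum_congr ?_ fun _ _ => rfl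
  ext i; simp only [Finset.mem_filter, Finset.mem_range, Finset.mem_Ico]; omega

variable {t : ℕ → ℝ≥0} (ht : StrictMono t)
include ht

theorem cellWidth_pos (i : ℕ) : 0 < cellWidth t i :=
  sub_pos.mpr (NNReal.coe_lt_coe.mpr (ht (Nat.lt_succ_self i)))

theorem sqrt_cellWidth_ne_zero (i : ℕ) : ((√(cellWidth t i) : ℝ) : ℂ) ≠ 0 :=
  Complex.ofReal_ne_zero.mpr (Real.sqrt_pos.mpr (cellWidth_pos ht i)).ne'

theorem sum_intervalCoeff_smul {M : Type*} [AddCommGroup M] [Module ℂ M] (g : ℕ → M) {j k m : ℕ}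
    (hjk : j ≤ k) (hkm : k ≤ m) :
    ∑ i : Fin m, intervalCoeff t j k i •
      ((((√(cellWidth t i))⁻¹ : ℝ) : ℂ) • (g (i + 1) - g i)) = g k - g j := by
  rw [← sum_ite_sub g hjk hkm]
  refine Finset.sum_congr rfl fun i _ => ?_
  rw [intervalCoeff]
  split_ifs
  · rw [Complex.ofReal_inv, smul_inv_smul₀ (sqrt_cellWidth_ne_zero ht i)]
  · rw [zero_smul]

omit ht in
theorem cellFun_eq_sub (ht : Monotone t) (i : ℕ) (y : ℝ) :
    cellFun t i y = (((√(cellWidth t i))⁻¹ : ℝ) : ℂ) •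
      ((if y ≤ t (i + 1) then 1 else 0) - (if y ≤ t i then 1 else 0) : ℂ) := by
  have : (t i : ℝ) ≤ t (i + 1) := NNReal.coe_le_coe.mpr (ht (Nat.le_succ i))
  rw [cellFun, Set.indicator_apply]
  by_cases h1 : y ≤ t i
  · have h2 : y ≤ t (i + 1) := h1.trans this
    simp [h1, h2]
  · by_cases h2 : y ≤ t (i + 1) <;> simp [h1, h2, not_le.mp h1]

theorem sum_intervalCoeff_mul_cellFun {j k m : ℕ} (hjk : j ≤ k) (hkm : k ≤ m) (y : ℝ) :
    ∑ i : Fin m, intervalCoeff t j k i * cellFun t i y =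
      (Set.Ioc (t j : ℝ) (t k)).indicator 1 y := by
  have h := sum_intervalCoeff_smul ht (fun i => if y ≤ t i then (1 : ℂ) else 0) hjk hkm
  simp only [← cellFun_eq_sub ht.monotone, smul_eq_mul] at h
  rw [h]
  have : (t j : ℝ) ≤ t k := NNReal.coe_le_coe.mpr (ht.monotone hjk)
  rw [Set.indicator_apply]
  by_cases h1 : y ≤ t j
  · have h2 : y ≤ t k := h1.trans this
    simp [h1, h2]
  · by_cases h2 : y ≤ t k <;> simp [h1, h2, not_le.mp h1]

omit ht in
theorem disjoint_Ioc_succ {i j : ℕ} (hij : i ≠ j) {X : Type*} [Preorder X] {f : ℕ → X}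
    (hf : Monotone f) : Disjoint (Set.Ioc (f i) (f (i + 1))) (Set.Ioc (f j) (f (j + 1))) := by
  rw [Set.disjoint_left]
  rintro z ⟨h1, h2⟩ ⟨h3, h4⟩
  rcases Nat.lt_or_gt_of_ne hij with h | h
  · exact lt_irrefl _ ((h3.trans_le h2).trans_le (hf h))
  · exact lt_irrefl _ ((h1.trans_le h4).trans_le (hf h))

theorem intervalCoeff_mul_eq_zero {m j k j' k' : ℕ}
    (hd : Disjoint (Set.Ioc (t j) (t k)) (Set.Ioc (t j') (t k'))) (i : Fin m) :
    intervalCoeff t j k i = 0 ∨ intervalCoeff t j' k' i = 0 := by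
  by_contra! h
  simp only [intervalCoeff, ne_eq, ite_eq_right_iff, not_forall] at h
  obtain ⟨⟨⟨h1, h2⟩, -⟩, ⟨h3, h4⟩, -⟩ := h
  refine Set.disjoint_left.mp hd (show t (i + 1) ∈ Set.Ioc (t j) (t k) from ⟨ht ?_, ht.monotone ?_⟩)
    ⟨ht ?_, ht.monotone ?_⟩
  all_goals omega

theorem integral_cellFun (i j : ℕ) :
    ∫ y in Set.Ici 0, (starRingEnd ℂ) (cellFun t i y) * cellFun t j y = if i = j then 1 else 0 := by
  split_ifs with hij
  · subst hij
    have h : (fun y => (starRingEnd ℂ) (cellFun t i y) * cellFun t i y) =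
        (Set.Ioc (t i : ℝ) (t (i + 1))).indicator fun _ => (((cellWidth t i)⁻¹ : ℝ) : ℂ) := by
      funext y
      rw [cellFun]
      by_cases hy : y ∈ Set.Ioc (t i : ℝ) (t (i + 1))
      · simp only [Set.indicator_of_mem hy, Complex.conj_ofReal, ← Complex.ofReal_mul]
        rw [← mul_inv, Real.mul_self_sqrt (cellWidth_pos ht i).le]
      · simp [Set.indicator_of_notMem hy]
    have hsub : Set.Ici (0 : ℝ) ∩ Set.Ioc (t i : ℝ) (t (i + 1)) = Set.Ioc (t i : ℝ) (t (i + 1)) :=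
      Set.inter_eq_right.mpr fun y hy => (t i).2.trans hy.1.le
    have hvol : volume.real (Set.Ioc (t i : ℝ) (t (i + 1))) = cellWidth t i := by
      rw [Measure.real, Real.volume_Ioc]
      exact ENNReal.toReal_ofReal (cellWidth_pos ht i).le
    rw [h, setIntegral_indicator measurableSet_Ioc, hsub, setIntegral_const, hvol]
    change (cellWidth t i) • (((cellWidth t i)⁻¹ : ℝ) : ℂ) = 1
    rw [Complex.real_smul, ← Complex.ofReal_mul, mul_inv_cancel₀ (cellWidth_pos ht i).ne',
      Complex.ofReal_one]
  · have h : (fun y => (starRingEnd ℂ) (cellFun t i y) * cellFun t j y) = 0 := by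
      funext y
      have := disjoint_Ioc_succ hij (f := fun i => (t i : ℝ))
        fun a b hab => NNReal.coe_le_coe.mpr (ht.monotone hab)
      by_cases hy : y ∈ Set.Ioc (t i : ℝ) (t (i + 1))
      · have hy' : y ∉ Set.Ioc (t j : ℝ) (t (j + 1)) := Set.disjoint_left.mp this hy
        simp [cellFun, Set.indicator_of_notMem hy']
      · simp [cellFun, Set.indicator_of_notMem hy]
    rw [h]; simp

end Grid

/-! ### Kernels on a grid -/

section GridKernel

variable (t : ℕ → ℝ≥0) {m n : ℕ}

/-- The product of normalised indicator functions of cells. -/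
def cellProd (u : Fin n → Fin m) (y : Fin n → ℝ) : ℂ := ∏ k, cellFun t (u k) (y k)

theorem cellProd_eq_indicator (u : Fin n → Fin m) :
    cellProd t u = (box (fun k => t (u k)) fun k => t (u k + 1)).indicator
      fun _ => ∏ k, (((√(cellWidth t (u k)))⁻¹ : ℝ) : ℂ) := by
  funext y
  by_cases hy : y ∈ box (fun k => t (u k)) fun k => t (u k + 1)
  · rw [Set.indicator_of_mem hy, cellProd]
    exact Finset.prod_congr rfl fun k _ => Set.indicator_of_mem (hy k trivial) _
  · rw [Set.indicator_of_notMem hy, cellProd]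
    have : ∃ k, y k ∉ Set.Ioc (t (u k) : ℝ) (t (u k + 1)) := by
      by_contra! h; exact hy fun k _ => h k
    obtain ⟨k, hk⟩ := this
    exact Finset.prod_eq_zero (Finset.mem_univ k) (Set.indicator_of_notMem hk _)

theorem memLp_cellProd (u : Fin n → Fin m) : MemLp (cellProd t u) 2 (lebPos n) := by
  rw [cellProd_eq_indicator]
  exact memLp_indicator_const _ (measurableSet_box _ _) _ (.inr (lebPos_box_ne_top _ _))

theorem toLp_cellProd (u : Fin n → Fin m) :
    (memLp_cellProd t u).toLp _ = (∏ k, (((√(cellWidth t (u k)))⁻¹ : ℝ) : ℂ)) •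
      boxIndicator (fun k => t (u k)) fun k => t (u k + 1) := by
  have h : MemLp ((box (fun k => t (u k)) fun k => t (u k + 1)).indicator fun _ => (1 : ℂ)) 2
      (lebPos n) :=
    memLp_indicator_const _ (measurableSet_box _ _) _ (.inr (lebPos_box_ne_top _ _))
  rw [boxIndicator, indicatorConstLp, ← MemLp.toLp_const_smul]
  congr 1
  rw [cellProd_eq_indicator]
  funext y
  by_cases hy : y ∈ box (fun k => t (u k)) fun k => t (u k + 1)
  · simp [Set.indicator_of_mem hy]
  · simp [Set.indicator_of_notMem hy]

theorem inner_toLp_cellProd {t : ℕ → ℝ≥0} (ht : StrictMono t) (u v : Fin n → Fin m) :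
    ⟪(memLp_cellProd t u).toLp _, (memLp_cellProd t v).toLp _⟫_ℂ = if u = v then 1 else 0 := by
  rw [L2.inner_def]
  have h : (fun y => ⟪(memLp_cellProd t u).toLp _ y, (memLp_cellProd t v).toLp _ y⟫_ℂ)
      =ᵐ[lebPos n] fun y => ∏ k, ((starRingEnd ℂ) (cellFun t (u k) (y k)) *
        cellFun t (v k) (y k)) := by
    filter_upwards [(memLp_cellProd t u).coeFn_toLp, (memLp_cellProd t v).coeFn_toLp] with y h1 h2
    rw [h1, h2, RCLike.inner_apply, cellProd, cellProd, map_prod, mul_comm,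
      ← Finset.prod_mul_distrib]
  rw [integral_congr_ae h, lebPos, integral_fintype_prod_eq_prod
    (fun k y => (starRingEnd ℂ) (cellFun t (u k) y) * cellFun t (v k) y)]
  simp only [integral_cellFun ht, Finset.prod_ite_zero, Finset.prod_const_one, Finset.mem_univ,
    true_imp_iff, Fin.val_inj, funext_iff]

/-- The kernel with coefficients `c` in the orthonormal system `cellProd t u`. -/
def gridKernel (m n : ℕ) (c : List (Fin m) → ℂ) (y : Fin n → ℝ) : ℂ :=
  ∑ u : Fin n → Fin m, c (List.ofFn u) * cellProd t u y

theorem memLp_gridKernel (m n : ℕ) (c : List (Fin m) → ℂ) :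
    MemLp (gridKernel t m n c) 2 (lebPos n) :=
  memLp_finsetSum _ fun u _ => (memLp_cellProd t u).const_mul _

/-- `gridKernel` as an element of `L²`. -/
def gridLp (m n : ℕ) (c : List (Fin m) → ℂ) : Lp ℂ 2 (lebPos n) :=
  (memLp_gridKernel t m n c).toLp _

theorem gridLp_eq_sum (m n : ℕ) (c : List (Fin m) → ℂ) :
    gridLp t m n c = ∑ u : Fin n → Fin m, c (List.ofFn u) • (memLp_cellProd t u).toLp _ := by
  refine Lp.ext ?_
  have h : ∀ u : Fin n → Fin m, ∀ᵐ y ∂lebPos n,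
      (c (List.ofFn u) • (memLp_cellProd t u).toLp _ : Lp ℂ 2 (lebPos n)) y =
        c (List.ofFn u) * cellProd t u y := by
    intro u
    filter_upwards [Lp.coeFn_smul (c (List.ofFn u)) ((memLp_cellProd t u).toLp _),
      (memLp_cellProd t u).coeFn_toLp] with y h1 h2
    rw [h1, Pi.smul_apply, h2, smul_eq_mul]
  filter_upwards [(memLp_gridKernel t m n c).coeFn_toLp, ae_all_iff.mpr h,
    Lp.coeFn_finsetSum Finset.univ fun u : Fin n → Fin m =>
      c (List.ofFn u) • (memLp_cellProd t u).toLp _] with y h1 h2 h3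
  rw [gridLp, h1, h3, gridKernel, Finset.sum_apply]
  exact Finset.sum_congr rfl fun u _ => (h2 u).symm

theorem norm_sq_gridLp {t : ℕ → ℝ≥0} (ht : StrictMono t) (m n : ℕ) (c : List (Fin m) → ℂ) :
    ‖gridLp t m n c‖ ^ 2 = TracialWStarSpace.coeffNormSq n c := by
  rw [gridLp_eq_sum, norm_sq_sum_of_orthogonal, TracialWStarSpace.coeffNormSq,
    wordSum_eq_sum_ofFn]
  · refine Finset.sum_congr rfl fun u _ => ?_
    have h := inner_self_eq_ofReal_norm_sq ((memLp_cellProd t u).toLp (cellProd t u))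
    rw [inner_toLp_cellProd ht, if_pos rfl] at h
    have h' : ‖(memLp_cellProd t u).toLp (cellProd t u)‖ ^ 2 = 1 := by exact_mod_cast h.symm
    rw [norm_smul, mul_pow, h', mul_one]
  · intro u _ v _ huv
    rw [inner_smul_left, inner_smul_right, inner_toLp_cellProd ht, if_neg huv, mul_zero, mul_zero]

theorem gridLp_add (m n : ℕ) (c d : List (Fin m) → ℂ) :
    gridLp t m n (fun w => c w + d w) = gridLp t m n c + gridLp t m n d := by
  simp only [gridLp_eq_sum, add_smul, Finset.sum_add_distrib]

theorem gridLp_smul (m n : ℕ) (z : ℂ) (c : List (Fin m) → ℂ) :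
    gridLp t m n (fun w => z * c w) = z • gridLp t m n c := by
  simp only [gridLp_eq_sum, mul_smul, Finset.smul_sum]

/-- The indicator function of a box with vertices on the grid is a grid kernel. -/
theorem boxIndicator_eq_gridLp {t : ℕ → ℝ≥0} (ht : StrictMono t) {m n : ℕ} {α β : Fin n → ℕ}
    (hαβ : α ≤ β) (hβ : ∀ k, β k ≤ m) :
    boxIndicator (fun k => t (α k)) (fun k => t (β k)) =
      gridLp t m n (tensorCoeff (List.ofFn fun k => intervalCoeff t (α k) (β k))) := by
  rw [boxIndicator, indicatorConstLp, gridLp]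
  congr 1
  funext y
  simp only [gridKernel, tensorCoeff_ofFn, cellProd, ← Finset.prod_mul_distrib]
  have h := Finset.prod_univ_sum (fun _ : Fin n => (Finset.univ : Finset (Fin m)))
    fun k i => intervalCoeff t (α k) (β k) i * cellFun t i (y k)
  rw [Fintype.piFinset_univ] at h
  rw [← h]
  simp only [sum_intervalCoeff_mul_cellFun ht (hαβ _) (hβ _)]
  by_cases hy : y ∈ box (fun k => t (α k)) fun k => t (β k)
  · rw [Set.indicator_of_mem hy]
    exact (Finset.prod_eq_one fun k _ => Set.indicator_of_mem (hy k trivial) _).symm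
  · rw [Set.indicator_of_notMem hy]
    have : ∃ k, y k ∉ Set.Ioc (t (α k) : ℝ) (t (β k)) := by
      by_contra! h; exact hy fun k _ => h k
    obtain ⟨k, hk⟩ := this
    exact (Finset.prod_eq_zero (Finset.mem_univ k) (Set.indicator_of_notMem hk _)).symm

end GridKernel

/-! ### Grids adapted to finitely many points -/

/-- A strictly increasing sequence of nonnegative numbers that runs first through `A`. -/
def gridOf (A : Finset ℝ≥0) (j : ℕ) : ℝ≥0 :=
  if h : j < A.card then A.orderEmbOfFin rfl ⟨j, h⟩ else A.sup id + (j + 1)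

theorem strictMono_gridOf (A : Finset ℝ≥0) : StrictMono (gridOf A) := by
  refine strictMono_nat_of_lt_succ fun j => ?_
  by_cases h1 : j + 1 < A.card
  · have h0 : j < A.card := (Nat.lt_succ_self j).trans h1
    rw [gridOf, gridOf, dif_pos h0, dif_pos h1]
    exact (A.orderEmbOfFin rfl).strictMono (Nat.lt_succ_self j)
  · rw [gridOf, gridOf, dif_neg h1]
    split_ifs with h0
    · refine (Finset.le_sup (f := id) (A.orderEmbOfFin_mem rfl ⟨j, h0⟩)).trans_lt ?_
      exact lt_add_of_pos_right _ (by positivity)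
    · push_cast
      gcongr
      exact lt_add_one _

theorem exists_gridOf_eq {A : Finset ℝ≥0} {a : ℝ≥0} (ha : a ∈ A) :
    ∃ j ≤ A.card, gridOf A j = a := by
  have : a ∈ Set.range (A.orderEmbOfFin rfl) := by rw [A.range_orderEmbOfFin]; exact ha
  obtain ⟨j, rfl⟩ := this
  exact ⟨j, j.2.le, by rw [gridOf, dif_pos j.2]⟩

/-! ### Bounded operators defined by the closure of a graph -/

section Graph

variable {E F : Type*} [NormedAddCommGroup E] [NormedSpace ℂ E] [NormedAddCommGroup F]
  [NormedSpace ℂ F]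

theorem Submodule.norm_snd_le_of_mem_topologicalClosure {S : Submodule ℂ (E × F)} {C : ℝ}
    (hS : ∀ p ∈ S, ‖p.2‖ ≤ C * ‖p.1‖) {p : E × F} (hp : p ∈ S.topologicalClosure) :
    ‖p.2‖ ≤ C * ‖p.1‖ := by
  have hcl : IsClosed {p : E × F | ‖p.2‖ ≤ C * ‖p.1‖} :=
    isClosed_le continuous_snd.norm (continuous_const.mul continuous_fst.norm)
  exact closure_minimal (s := (S : Set (E × F))) hS hcl hp

/-- If `‖p.2‖ ≤ C ‖p.1‖` on a submodule of `E × F` with dense first projection, then the closure of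
this submodule is the graph of a bounded operator. -/
theorem Submodule.exists_clm_of_norm_snd_le [CompleteSpace F] {S : Submodule ℂ (E × F)} {C : ℝ}
    (hC : 0 ≤ C) (hS : ∀ p ∈ S, ‖p.2‖ ≤ C * ‖p.1‖)
    (hd : (S.map (LinearMap.fst ℂ E F)).topologicalClosure = ⊤) :
    ∃ T : E →L[ℂ] F, (∀ p, p ∈ S.topologicalClosure ↔ p.2 = T p.1) ∧ ∀ y, ‖T y‖ ≤ C * ‖y‖ := by
  have hex : ∀ y : E, ∃ z : F, (y, z) ∈ S.topologicalClosure := by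
    intro y
    have hy : y ∈ closure ((S.map (LinearMap.fst ℂ E F) : Submodule ℂ E) : Set E) := by
      rw [← Submodule.topologicalClosure_coe, hd]; trivial
    obtain ⟨v, hv, hlim⟩ := mem_closure_iff_seq_limit.mp hy
    choose p hp hpv using hv
    have hcauchy : CauchySeq fun j => (p j).2 := by
      have h1 := hlim.cauchySeq
      rw [Metric.cauchySeq_iff] at h1 ⊢
      intro ε hε
      obtain ⟨N, hN⟩ := h1 (ε / (C + 1)) (by positivity)
      refine ⟨N, fun i hi j hj => ?_⟩
      have h2 := hN i hi j hj
      rw [dist_eq_norm, lt_div_iff₀ (by positivity)] at h2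
      have h3 := hS _ (S.sub_mem (hp i) (hp j))
      rw [Prod.fst_sub, Prod.snd_sub] at h3
      have h4 : (p i).1 - (p j).1 = v i - v j := by rw [← hpv i, ← hpv j]; rfl
      rw [h4] at h3
      rw [dist_eq_norm]
      nlinarith [norm_nonneg (v i - v j)]
    obtain ⟨z, hz⟩ := cauchySeq_tendsto_of_complete hcauchy
    refine ⟨z, mem_closure_of_tendsto (hlim.prodMk_nhds hz) (.of_forall fun j => ?_)⟩
    rw [← hpv j]
    exact hp j
  have huniq : ∀ {y : E} {z z' : F}, (y, z) ∈ S.topologicalClosure →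
      (y, z') ∈ S.topologicalClosure → z = z' := by
    intro y z z' h h'
    have := norm_snd_le_of_mem_topologicalClosure hS (S.topologicalClosure.sub_mem h h')
    simpa [sub_eq_zero] using this
  choose T hT using hex
  refine ⟨LinearMap.mkContinuous
    { toFun := T
      map_add' := fun y y' => huniq (hT _) (S.topologicalClosure.add_mem (hT y) (hT y'))
      map_smul' := fun c y => huniq (hT _) (S.topologicalClosure.smul_mem c (hT y)) } C
    fun y => norm_snd_le_of_mem_topologicalClosure hS (hT y), fun p => ⟨fun h => ?_, fun h => ?_⟩,
    fun y => norm_snd_le_of_mem_topologicalClosure hS (hT y)⟩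
  · exact huniq h (hT p.1)
  · have := hT p.1
    change p.2 = T p.1 at h
    rwa [← h] at this

/-- Finitely many generators, each of which belongs to `P A` for all large `A`, belong to a common
`P A`, and with them their linear combinations. -/
theorem mem_of_mem_span_of_directed {V : Type*} [AddCommGroup V] [Module ℂ V] {s : Set V}
    {κ : Type*} [SemilatticeSup κ] [Nonempty κ] (P : κ → Submodule ℂ V)
    (h : ∀ p ∈ s, ∃ A₀, ∀ A, A₀ ≤ A → p ∈ P A) {p : V} (hp : p ∈ Submodule.span ℂ s) :
    ∃ A₀, ∀ A, A₀ ≤ A → p ∈ P A := by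
  induction hp using Submodule.span_induction with
  | mem p hp => exact h p hp
  | zero => exact ⟨Classical.arbitrary κ, fun A _ => (P A).zero_mem⟩
  | add p q _ _ hp hq =>
    obtain ⟨A, hA⟩ := hp
    obtain ⟨A', hA'⟩ := hq
    exact ⟨A ⊔ A', fun B hB =>
      (P B).add_mem (hA B (le_sup_left.trans hB)) (hA' B (le_sup_right.trans hB))⟩
  | smul c p _ hp =>
    obtain ⟨A, hA⟩ := hp
    exact ⟨A, fun B hB => (P B).smul_mem c (hA B hB)⟩

end Graph

/-! ### Simple Wigner integrals -/

/-- The coefficients that vanish on words with a repeated letter. -/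
def nodupCoeffs (ι : Type*) : Submodule ℂ (List ι → ℂ) where
  carrier := {c | ∀ w, ¬ w.Nodup → c w = 0}
  add_mem' hc hd w hw := by rw [Pi.add_apply, hc w hw, hd w hw, add_zero]
  zero_mem' _ _ := rfl
  smul_mem' z c hc w hw := by rw [Pi.smul_apply, hc w hw, smul_zero]

namespace TracialWStarSpace.FreeBrownianMotion

variable {H : Type u} [NormedAddCommGroup H] [InnerProductSpace ℂ H] [CompleteSpace H]
  {W : TracialWStarSpace H} (B : FreeBrownianMotion W)

/-- The increments of a free Brownian motion over the first `m` cells of a grid, normalised to have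
variance one. -/
def gridIncrement (t : ℕ → ℝ≥0) (m : ℕ) (i : Fin m) : W.Alg :=
  (((√(cellWidth t i))⁻¹ : ℝ) : ℂ) • (B.S (t (i + 1)) - B.S (t i))

theorem isWickFamily_gridIncrement {t : ℕ → ℝ≥0} (ht : StrictMono t) (m : ℕ) :
    W.IsWickFamily (B.gridIncrement t m) :=
  B.isWickFamily (fun i : Fin m => t i) (fun i => t (i + 1)) (fun _ => ht (Nat.lt_succ_self _))
    fun _ _ hij => ht.monotone (Nat.succ_le_of_lt hij)

/-- The bi-integral with coefficients `c`, where the first `k` letters of a word belong to the left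
factor. -/
def biSum {ι : Type*} [Fintype ι] [DecidableEq ι] (x : ι → W.Alg) (n k : ℕ) (c : List ι → ℂ) :
    W.L2Tensor :=
  wordSum n fun w => c w • W.tmul (wick x (w.take k)) (wick x (w.drop k))

theorem norm_sq_biSum {ι : Type*} [Fintype ι] [DecidableEq ι] {x : ι → W.Alg}
    (hx : W.IsWickFamily x) (n k : ℕ) (c : List ι → ℂ) :
    ‖biSum x n k c‖ ^ 2 = coeffNormSq n c := by
  refine norm_sq_wordSum_smul
    (e := fun w : List ι => W.tmul (wick x (w.take k)) (wick x (w.drop k))) (fun u v => ?_) n c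
  rw [hx.inner_tmul_wick]
  by_cases h : u = v
  · simp [h]
  · have : ¬ (u.take k = v.take k ∧ u.drop k = v.drop k) := by
      rintro ⟨h1, h2⟩
      exact h (by rw [← List.take_append_drop k u, h1, h2, List.take_append_drop])
    rw [if_neg h]
    by_cases h1 : u.take k = v.take k
    · rw [if_neg fun h2 => this ⟨h1, h2⟩, mul_zero]
    · rw [if_neg h1, zero_mul]

theorem increments_eq_map {t : ℕ → ℝ≥0} (ht : StrictMono t) {m n : ℕ} {α β : Fin n → ℕ}
    (hαβ : α ≤ β) (hβ : ∀ k, β k ≤ m) :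
    B.increments (fun k => t (α k)) (fun k => t (β k)) =
      (List.ofFn fun k => intervalCoeff t (m := m) (α k) (β k)).map fun d =>
        ∑ i, d i • B.gridIncrement t m i := by
  rw [increments, List.map_ofFn]
  congr 1
  funext k
  exact (sum_intervalCoeff_smul ht (fun i => B.S (t i)) (hαβ k) (hβ k)).symm

theorem increments_cells {t : ℕ → ℝ≥0} (ht : StrictMono t) {m n : ℕ} (u : Fin n → Fin m) :
    B.increments (fun k => t (u k)) (fun k => t (u k + 1)) =
      (List.ofFn u).map fun i : Fin m => ((√(cellWidth t i) : ℝ) : ℂ) • B.gridIncrement t m i := by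
  rw [increments, List.map_ofFn]
  congr 1
  funext k
  simp only [Function.comp_apply, gridIncrement]
  rw [Complex.ofReal_inv, smul_inv_smul₀ (sqrt_cellWidth_ne_zero ht _)]

theorem prod_map_smul {ι A : Type*} [Ring A] [Algebra ℂ A] (z : ι → ℂ) (x : ι → A) (w : List ι) :
    (w.map fun i => z i • x i).prod = (w.map z).prod • (w.map x).prod := by
  induction w with
  | nil => simp
  | cons i w ih => simp only [List.map_cons, List.prod_cons, ih, smul_mul_smul_comm]

theorem biSum_tensorCoeff {ι : Type*} [Fintype ι] [DecidableEq ι] (x : ι → W.Alg)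
    {ds : List (ι → ℂ)} {k : ℕ} (hk : k ≤ ds.length)
    (h1 : (ds.take k).Pairwise fun d d' => ∀ i, d i = 0 ∨ d' i = 0)
    (h2 : (ds.drop k).Pairwise fun d d' => ∀ i, d i = 0 ∨ d' i = 0) :
    biSum x ds.length k (tensorCoeff ds) =
      W.tmul ((ds.map fun d => ∑ i, d i • x i).take k).prod
        ((ds.map fun d => ∑ i, d i • x i).drop k).prod := by
  have hlen1 : (ds.take k).length = k := by rw [List.length_take, min_eq_left hk]
  have hlen2 : (ds.drop k).length = ds.length - k := List.length_drop
  rw [← List.map_take, ← List.map_drop, prod_map_sum_smul_eq_wick x h1,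
    prod_map_sum_smul_eq_wick x h2, hlen1, hlen2, ← tmulₗ_apply,
    map_wordSum W.tmulₗ, wordSum_apply]
  refine (congrArg (fun j => wordSum j _) (Nat.add_sub_cancel' hk).symm).trans ?_
  rw [wordSum_append]
  refine wordSum_congr fun u hu => ?_
  rw [map_wordSum]
  refine wordSum_congr fun v hv => ?_
  rw [List.take_left' hu, List.drop_left' hu, map_smul, map_smul, LinearMap.smul_apply,
    tmulₗ_apply, smul_smul, mul_comm (tensorCoeff (ds.drop k) v),
    ← tensorCoeff_append (hu.trans hlen1.symm), List.take_append_drop]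

/-- The pairs of a simple kernel and its Wigner integral, as an element of the algebra. -/
def simpleWigner (n : ℕ) : Submodule ℂ (Lp ℂ 2 (lebPos n) × W.Alg) :=
  Submodule.span ℂ {p | ∃ a b : Fin n → ℝ≥0, a ≤ b ∧ DisjointSides a b ∧
    p = (boxIndicator a b, (B.increments a b).prod)}

/-- The pairs of a simple kernel and its bi-integral. -/
def simpleBi (n k : ℕ) : Submodule ℂ (Lp ℂ 2 (lebPos n) × W.L2Tensor) :=
  Submodule.span ℂ {p | ∃ a b : Fin n → ℝ≥0, a ≤ b ∧
    (∀ i j : Fin n, i ≠ j → ((i : ℕ) < k ↔ (j : ℕ) < k) →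
      Disjoint (Set.Ioc (a i) (b i)) (Set.Ioc (a j) (b j))) ∧
    p = (boxIndicator a b, W.tmul ((B.increments a b).take k).prod
      ((B.increments a b).drop k).prod)}

/-- The pair of the grid kernel and of the Wigner integral with given coefficients. -/
def gridWigner (t : ℕ → ℝ≥0) (m n : ℕ) :
    (List (Fin m) → ℂ) →ₗ[ℂ] Lp ℂ 2 (lebPos n) × W.Alg where
  toFun c := (gridLp t m n c, wickSum (B.gridIncrement t m) n c)
  map_add' c d := by
    refine Prod.ext (gridLp_add t m n c d) ?_
    simp only [wickSum, Prod.snd_add, ← wordSum_add, Pi.add_apply, add_smul]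
  map_smul' z c := by
    refine Prod.ext (gridLp_smul t m n z c) ?_
    simp only [wickSum, Prod.smul_snd, Pi.smul_apply, smul_assoc, RingHom.id_apply]
    exact (map_wordSum (DistribSMul.toAddMonoidHom W.Alg z) n _).symm

/-- The pair of the grid kernel and of the bi-integral with given coefficients. -/
def gridBi (t : ℕ → ℝ≥0) (m n k : ℕ) :
    (List (Fin m) → ℂ) →ₗ[ℂ] Lp ℂ 2 (lebPos n) × W.L2Tensor where
  toFun c := (gridLp t m n c, biSum (B.gridIncrement t m) n k c)
  map_add' c d := by
    refine Prod.ext (gridLp_add t m n c d) ?_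
    simp only [biSum, Prod.snd_add, ← wordSum_add, Pi.add_apply, add_smul]
  map_smul' z c := by
    refine Prod.ext (gridLp_smul t m n z c) ?_
    simp only [biSum, Prod.smul_snd, Pi.smul_apply, smul_assoc, RingHom.id_apply]
    exact (map_wordSum (DistribSMul.toAddMonoidHom W.L2Tensor z) n _).symm

theorem exists_gridOf_endpoints {n : ℕ} {a b : Fin n → ℝ≥0} (hab : a ≤ b) {A : Finset ℝ≥0}
    (hA : Finset.univ.image a ∪ Finset.univ.image b ≤ A) :
    ∃ α β : Fin n → ℕ, α ≤ β ∧ (∀ k, β k ≤ A.card) ∧ (a = fun k => gridOf A (α k)) ∧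
      b = fun k => gridOf A (β k) := by
  have ha : ∀ k, a k ∈ A := fun k =>
    hA (Finset.mem_union_left _ (Finset.mem_image_of_mem _ (by simp)))
  have hb : ∀ k, b k ∈ A := fun k =>
    hA (Finset.mem_union_right _ (Finset.mem_image_of_mem _ (by simp)))
  choose α hα1 hα2 using fun k => exists_gridOf_eq (ha k)
  choose β hβ1 hβ2 using fun k => exists_gridOf_eq (hb k)
  refine ⟨α, β, fun k => ?_, hβ1, funext fun k => (hα2 k).symm, funext fun k => (hβ2 k).symm⟩
  have := hab k
  rw [← hα2, ← hβ2] at this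
  exact (strictMono_gridOf A).le_iff_le.mp this

/-- A simple kernel is a grid kernel for any grid that is fine enough, and its Wigner integral is
the corresponding sum of Wick words. -/
theorem exists_grid_of_mem_simpleWigner {n : ℕ} {p : Lp ℂ 2 (lebPos n) × W.Alg}
    (hp : p ∈ B.simpleWigner n) :
    ∃ t : ℕ → ℝ≥0, StrictMono t ∧ ∃ m, ∃ c ∈ nodupCoeffs (Fin m), B.gridWigner t m n c = p := by
  obtain ⟨A, hA⟩ := mem_of_mem_span_of_directed
    (fun A : Finset ℝ≥0 => (nodupCoeffs (Fin A.card)).map (B.gridWigner (gridOf A) A.card n))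
    (s := {p | ∃ a b : Fin n → ℝ≥0, a ≤ b ∧ DisjointSides a b ∧
      p = (boxIndicator a b, (B.increments a b).prod)}) (by
    rintro _ ⟨a, b, hab, hd, rfl⟩
    refine ⟨Finset.univ.image a ∪ Finset.univ.image b, fun A hA => ?_⟩
    obtain ⟨α, β, hαβ, hβ, rfl, rfl⟩ := exists_gridOf_endpoints hab hA
    have ht := strictMono_gridOf A
    have hpw : (List.ofFn fun k => intervalCoeff (gridOf A) (m := A.card) (α k) (β k)).Pairwise
        fun d d' => ∀ i, d i = 0 ∨ d' i = 0 := by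
      rw [List.pairwise_ofFn]
      exact fun i j hij => intervalCoeff_mul_eq_zero ht (hd i j hij.ne)
    refine ⟨tensorCoeff (List.ofFn fun k => intervalCoeff (gridOf A) (α k) (β k)),
      fun w hw => by_contra fun h => hw (nodup_of_tensorCoeff_ne_zero hpw h), ?_⟩
    refine Prod.ext (boxIndicator_eq_gridLp ht hαβ hβ).symm ?_
    rw [B.increments_eq_map ht hαβ hβ, prod_map_sum_smul_eq_wick _ hpw, List.length_ofFn]
    rfl) hp
  exact ⟨gridOf A, strictMono_gridOf A, A.card, hA A le_rfl⟩

/-- The boxes of a bi-integral may meet the diagonals between the two groups of variables, so that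
the coefficients need not vanish on words with a repeated letter. -/
theorem exists_grid_of_mem_simpleBi {n k : ℕ} (hk : k ≤ n) {p : Lp ℂ 2 (lebPos n) × W.L2Tensor}
    (hp : p ∈ B.simpleBi n k) :
    ∃ t : ℕ → ℝ≥0, StrictMono t ∧ ∃ m c, B.gridBi t m n k c = p := by
  obtain ⟨A, hA⟩ := mem_of_mem_span_of_directed
    (fun A : Finset ℝ≥0 => LinearMap.range (B.gridBi (gridOf A) A.card n k))
    (s := {p | ∃ a b : Fin n → ℝ≥0, a ≤ b ∧
      (∀ i j : Fin n, i ≠ j → ((i : ℕ) < k ↔ (j : ℕ) < k) →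
        Disjoint (Set.Ioc (a i) (b i)) (Set.Ioc (a j) (b j))) ∧
      p = (boxIndicator a b, W.tmul ((B.increments a b).take k).prod
        ((B.increments a b).drop k).prod)}) (by
    rintro _ ⟨a, b, hab, hd, rfl⟩
    refine ⟨Finset.univ.image a ∪ Finset.univ.image b, fun A hA => ?_⟩
    obtain ⟨α, β, hαβ, hβ, rfl, rfl⟩ := exists_gridOf_endpoints hab hA
    have ht := strictMono_gridOf A
    obtain ⟨ds, hds⟩ : ∃ ds, ds = List.ofFn fun k => intervalCoeff (gridOf A) (m := A.card)
      (α k) (β k) := ⟨_, rfl⟩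
    have hlen : ds.length = n := by rw [hds, List.length_ofFn]
    have hget : ∀ i (hi : i < ds.length), ds[i] = intervalCoeff (gridOf A) (m := A.card)
        (α ⟨i, hlen ▸ hi⟩) (β ⟨i, hlen ▸ hi⟩) := by
      subst hds; intro i hi; simp
    refine ⟨tensorCoeff ds, Prod.ext (hds ▸ (boxIndicator_eq_gridLp ht hαβ hβ).symm) ?_⟩
    have hpw1 : (ds.take k).Pairwise fun d d' => ∀ i, d i = 0 ∨ d' i = 0 := by
      rw [List.pairwise_iff_getElem]
      intro i j hi hj hij
      simp only [List.length_take, hlen, lt_min_iff] at hi hj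
      simp only [List.getElem_take, hget]
      exact intervalCoeff_mul_eq_zero ht (hd ⟨i, hi.2⟩ ⟨j, hj.2⟩ (by simpa using hij.ne)
        (by simp [hi.1, hj.1]))
    have hpw2 : (ds.drop k).Pairwise fun d d' => ∀ i, d i = 0 ∨ d' i = 0 := by
      rw [List.pairwise_iff_getElem]
      intro i j hi hj hij
      simp only [List.length_drop, hlen] at hi hj
      simp only [List.getElem_drop, hget]
      exact intervalCoeff_mul_eq_zero ht (hd ⟨k + i, by omega⟩ ⟨k + j, by omega⟩
        (by simpa using hij.ne) (by simp))
    change biSum (B.gridIncrement (gridOf A) A.card) n k (tensorCoeff ds) =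
      W.tmul ((B.increments _ _).take k).prod ((B.increments _ _).drop k).prod
    rw [B.increments_eq_map ht hαβ hβ, ← hds, ← hlen,
      biSum_tensorCoeff _ (hlen.symm ▸ hk) hpw1 hpw2]) hp
  exact ⟨gridOf A, strictMono_gridOf A, A.card, hA A le_rfl⟩

theorem disjointSides_cells {t : ℕ → ℝ≥0} (ht : StrictMono t) {m n : ℕ} {u : Fin n → Fin m}
    (hu : Function.Injective u) : DisjointSides (fun k => t (u k)) fun k => t (u k + 1) :=
  fun _ _ hij => disjoint_Ioc_succ (fun h => hij (hu (Fin.ext h))) ht.monotone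

theorem prod_inv_sqrt_cellWidth {t : ℕ → ℝ≥0} (ht : StrictMono t) {m n : ℕ} (u : Fin n → Fin m) :
    (∏ k, (((√(cellWidth t (u k)))⁻¹ : ℝ) : ℂ)) *
      ((List.ofFn u).map fun i : Fin m => ((√(cellWidth t i) : ℝ) : ℂ)).prod = 1 := by
  rw [List.map_ofFn, List.prod_ofFn, ← Finset.prod_mul_distrib]
  refine Finset.prod_eq_one fun k _ => ?_
  rw [Complex.ofReal_inv, Function.comp_apply, inv_mul_cancel₀ (sqrt_cellWidth_ne_zero ht _)]

/-- Conversely, for coefficients that vanish on words with a repeated letter, a Wick word is a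
product of normalized increments over disjoint intervals. -/
theorem gridWigner_mem {t : ℕ → ℝ≥0} (ht : StrictMono t) {m n : ℕ} {c : List (Fin m) → ℂ}
    (hc : c ∈ nodupCoeffs (Fin m)) : B.gridWigner t m n c ∈ B.simpleWigner n := by
  have h : B.gridWigner t m n c = ∑ u : Fin n → Fin m, c (List.ofFn u) •
      ((memLp_cellProd t u).toLp _, wick (B.gridIncrement t m) (List.ofFn u)) := by
    change (gridLp t m n c, wickSum (B.gridIncrement t m) n c) = _
    rw [gridLp_eq_sum, wickSum, wordSum_eq_sum_ofFn]
    refine Prod.ext ?_ ?_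
    · rw [Prod.fst_sum]; rfl
    · rw [Prod.snd_sum]; rfl
  rw [h]
  refine Submodule.sum_mem _ fun u _ => ?_
  by_cases hu : (List.ofFn u).Nodup
  · refine Submodule.smul_mem _ _ ?_
    have hinj := List.nodup_ofFn.mp hu
    have : ((memLp_cellProd t u).toLp _, wick (B.gridIncrement t m) (List.ofFn u)) =
        (∏ k, (((√(cellWidth t (u k)))⁻¹ : ℝ) : ℂ)) •
          (boxIndicator (fun k => t (u k)) fun k => t (u k + 1),
            (B.increments (fun k => t (u k)) fun k => t (u k + 1)).prod) := by
      refine Prod.ext (toLp_cellProd t u) ?_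
      rw [Prod.smul_snd, B.increments_cells ht, prod_map_smul, smul_smul,
        prod_inv_sqrt_cellWidth ht, one_smul]
      exact wick_eq_prod_of_isChain _ (List.Pairwise.isChain hu)
    rw [this]
    exact Submodule.smul_mem _ _
      (Submodule.subset_span ⟨_, _, fun k => (ht (Nat.lt_succ_self _)).le,
        disjointSides_cells ht hinj, rfl⟩)
  · rw [hc _ hu, zero_smul]
    exact Submodule.zero_mem _

theorem gridBi_mem {t : ℕ → ℝ≥0} (ht : StrictMono t) {m n : ℕ} (k : ℕ) {c : List (Fin m) → ℂ}
    (hc : c ∈ nodupCoeffs (Fin m)) : B.gridBi t m n k c ∈ B.simpleBi n k := by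
  have h : B.gridBi t m n k c = ∑ u : Fin n → Fin m, c (List.ofFn u) •
      ((memLp_cellProd t u).toLp _, W.tmul (wick (B.gridIncrement t m) ((List.ofFn u).take k))
        (wick (B.gridIncrement t m) ((List.ofFn u).drop k))) := by
    change (gridLp t m n c, biSum (B.gridIncrement t m) n k c) = _
    rw [gridLp_eq_sum, biSum, wordSum_eq_sum_ofFn]
    refine Prod.ext ?_ ?_
    · rw [Prod.fst_sum]; rfl
    · rw [Prod.snd_sum]; rfl
  rw [h]
  refine Submodule.sum_mem _ fun u _ => ?_
  by_cases hu : (List.ofFn u).Nodup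
  · refine Submodule.smul_mem _ _ ?_
    have hinj := List.nodup_ofFn.mp hu
    have : ((memLp_cellProd t u).toLp _, W.tmul (wick (B.gridIncrement t m) ((List.ofFn u).take k))
        (wick (B.gridIncrement t m) ((List.ofFn u).drop k))) =
        (∏ k, (((√(cellWidth t (u k)))⁻¹ : ℝ) : ℂ)) •
          (boxIndicator (fun k => t (u k)) fun k => t (u k + 1),
            W.tmul ((B.increments (fun k => t (u k)) fun k => t (u k + 1)).take k).prod
              ((B.increments (fun k => t (u k)) fun k => t (u k + 1)).drop k).prod) := by
      refine Prod.ext (toLp_cellProd t u) ?_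
      have hz : ∀ z : Fin m → ℂ, (((List.ofFn u).drop k).map z).prod *
          (((List.ofFn u).take k).map z).prod = ((List.ofFn u).map z).prod := fun z => by
        rw [mul_comm, ← List.prod_append, ← List.map_append, List.take_append_drop]
      rw [Prod.smul_snd, B.increments_cells ht, ← List.map_take, ← List.map_drop, prod_map_smul,
        prod_map_smul, ← tmulₗ_apply, ← tmulₗ_apply, map_smul, map_smul, LinearMap.smul_apply,
        smul_smul, smul_smul, mul_assoc, hz, prod_inv_sqrt_cellWidth ht, one_smul, tmulₗ_apply,
        wick_eq_prod_of_isChain _ (List.Pairwise.isChain (hu.sublist (List.take_sublist _ _))),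
        wick_eq_prod_of_isChain _ (List.Pairwise.isChain (hu.sublist (List.drop_sublist _ _)))]
      rfl
    rw [this]
    exact Submodule.smul_mem _ _
      (Submodule.subset_span ⟨_, _, fun k => (ht (Nat.lt_succ_self _)).le,
        fun i j hij _ => disjointSides_cells ht hinj i j hij, rfl⟩)
  · rw [hc _ hu, zero_smul]
    exact Submodule.zero_mem _

/-! ### Multiple Wigner integrals and bi-integrals as bounded operators -/

theorem exists_wignerOp (n : ℕ) : ∃ J : Lp ℂ 2 (lebPos n) →L[ℂ] W.Alg,
    ∀ p, p ∈ (B.simpleWigner n).topologicalClosure ↔ p.2 = J p.1 := by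
  have hbound : ∀ p ∈ B.simpleWigner n, ‖p.2‖ ≤ (n + 1 : ℝ) * ‖p.1‖ := by
    intro p hp
    obtain ⟨t, ht, m, c, -, rfl⟩ := B.exists_grid_of_mem_simpleWigner hp
    have h := norm_wickSum_le (B.isWickFamily_gridIncrement ht m) n c
    rw [← norm_sq_gridLp ht, Real.sqrt_sq (norm_nonneg _)] at h
    exact h
  obtain ⟨J, hJ, -⟩ := Submodule.exists_clm_of_norm_snd_le (by positivity) hbound (by
    rw [← top_le_iff, ← topologicalClosure_span_boxIndicator n]
    refine Submodule.topologicalClosure_mono (Submodule.span_le.mpr ?_)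
    rintro _ ⟨a, b, hab, hd, rfl⟩
    exact ⟨_, Submodule.subset_span ⟨a, b, hab, hd, rfl⟩, rfl⟩)
  exact ⟨J, hJ⟩

/-- The multiple Wigner integral as a bounded operator with values in the algebra: by Haagerup's
inequality the integrals of `L²` kernels are bounded elements. -/
def wignerOp (n : ℕ) : Lp ℂ 2 (lebPos n) →L[ℂ] W.Alg := (B.exists_wignerOp n).choose

theorem wignerOp_eq_of_mem {n : ℕ} {p : Lp ℂ 2 (lebPos n) × W.Alg} (hp : p ∈ B.simpleWigner n) :
    B.wignerOp n p.1 = p.2 :=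
  (((B.exists_wignerOp n).choose_spec p).mp (Submodule.le_topologicalClosure _ hp)).symm

/-- The Wigner isometry; in particular the graph determines the integral. -/
theorem norm_sq_toL2_wignerOp (n : ℕ) {f : Lp ℂ 2 (lebPos n)} (X : W.L2)
    (hX : (f, X) ∈ B.wignerGraph n) : ‖X‖ ^ 2 = ‖f‖ ^ 2 := by
  have hcl : IsClosed {p : Lp ℂ 2 (lebPos n) × W.L2 | ‖p.2‖ ^ 2 = ‖p.1‖ ^ 2} :=
    isClosed_eq (by fun_prop) (by fun_prop)
  refine closure_minimal (s := (_ : Set (Lp ℂ 2 (lebPos n) × W.L2))) (fun p hp => ?_) hcl hX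
  set T := (LinearMap.id : Lp ℂ 2 (lebPos n) →ₗ[ℂ] _).prodMap W.toL2L.toLinearMap with hT
  have hmap : p ∈ (B.simpleWigner n).map T := by
    rw [simpleWigner, Submodule.map_span]
    refine Submodule.span_mono ?_ hp
    rintro _ ⟨a, b, hab, hd, rfl⟩
    exact ⟨_, ⟨a, b, hab, hd, rfl⟩, rfl⟩
  obtain ⟨q, hq, rfl⟩ := hmap
  obtain ⟨t, ht, m, c, -, rfl⟩ := B.exists_grid_of_mem_simpleWigner hq
  exact (norm_sq_toL2_wickSum (B.isWickFamily_gridIncrement ht m) n c).trans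
    (norm_sq_gridLp ht m n c).symm

theorem toL2_wignerOp_mem (n : ℕ) (f : Lp ℂ 2 (lebPos n)) :
    (f, W.toL2 (B.wignerOp n f)) ∈ B.wignerGraph n := by
  have h := ((B.exists_wignerOp n).choose_spec (f, B.wignerOp n f)).mpr rfl
  set T := (ContinuousLinearMap.id ℂ (Lp ℂ 2 (lebPos n))).prodMap W.toL2L with hT
  have := T.continuous.continuousOn.image_closure (s := (B.simpleWigner n : Set _))
    ⟨_, h, rfl⟩
  refine closure_mono ?_ this
  rintro _ ⟨q, hq, rfl⟩
  have hmap : T q ∈ (B.simpleWigner n).map T.toLinearMap := ⟨q, hq, rfl⟩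
  rw [simpleWigner, Submodule.map_span] at hmap
  refine Submodule.span_mono ?_ hmap
  rintro _ ⟨_, ⟨a, b, hab, hd, rfl⟩, rfl⟩
  exact ⟨a, b, hab, hd, rfl⟩

/-- The `L²` valued integral coincides with the algebra valued one. -/
theorem wignerIntegral_eq {n : ℕ} {f : (Fin n → ℝ) → ℂ} (hf : MemLp f 2 (lebPos n)) :
    B.wignerIntegral n f = W.toL2 (B.wignerOp n (hf.toLp f)) := by
  have h : ∃ X : W.L2, ∃ hf : MemLp f 2 (lebPos n), (hf.toLp f, X) ∈ B.wignerGraph n :=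
    ⟨_, hf, B.toL2_wignerOp_mem n _⟩
  rw [wignerIntegral, dif_pos h]
  obtain ⟨hf', h1⟩ := h.choose_spec
  have h2 := (B.wignerGraph n).sub_mem h1 (B.toL2_wignerOp_mem n (hf.toLp f))
  rw [Prod.mk_sub_mk] at h2
  have := B.norm_sq_toL2_wignerOp n _ h2
  simpa [sub_eq_zero] using this

/-- The bi-integral is an isometry on simple kernels, hence an everywhere defined contraction. -/
theorem exists_biOp {n k : ℕ} (hk : k ≤ n) : ∃ T : Lp ℂ 2 (lebPos n) →L[ℂ] W.L2Tensor,
    (∀ p, p ∈ B.biGraph n k ↔ p.2 = T p.1) ∧ ∀ f, ‖T f‖ ≤ ‖f‖ := by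
  have hbound : ∀ p ∈ B.simpleBi n k, ‖p.2‖ ≤ 1 * ‖p.1‖ := by
    intro p hp
    obtain ⟨t, ht, m, c, rfl⟩ := B.exists_grid_of_mem_simpleBi hk hp
    rw [one_mul]
    refine le_of_sq_le_sq (le_of_eq ?_) (norm_nonneg _)
    exact (norm_sq_biSum (B.isWickFamily_gridIncrement ht m) n k c).trans
      (norm_sq_gridLp ht m n c).symm
  obtain ⟨T, hT, hT'⟩ := Submodule.exists_clm_of_norm_snd_le zero_le_one hbound (by
    rw [← top_le_iff, ← topologicalClosure_span_boxIndicator n]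
    refine Submodule.topologicalClosure_mono (Submodule.span_le.mpr ?_)
    rintro _ ⟨a, b, hab, hd, rfl⟩
    exact ⟨_, Submodule.subset_span ⟨a, b, hab, fun i j hij _ => hd i j hij, rfl⟩, rfl⟩)
  exact ⟨T, hT, fun f => by simpa using hT' f⟩

end TracialWStarSpace.FreeBrownianMotion

/-! ### Fibers of kernels -/

section Fiber

variable {N : ℕ}

theorem sq_eLpNorm_two {X E : Type*} [MeasurableSpace X] [NormedAddCommGroup E] (f : X → E)
    (μ : Measure X) : eLpNorm f 2 μ ^ 2 = ∫⁻ x, ‖f x‖ₑ ^ 2 ∂μ := by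
  have := eLpNorm_nnreal_pow_eq_lintegral (f := f) (μ := μ) (p := 2) two_ne_zero
  norm_num at this
  exact this

/-- The kernel `f` with its `k`-th variable fixed to be `s`. -/
def fiber (f : (Fin (N + 1) → ℝ) → ℂ) (k : Fin (N + 1)) (s : ℝ) (x : Fin N → ℝ) : ℂ :=
  f (Fin.insertNth (α := fun _ => ℝ) k s x)

theorem measurePreserving_insertNth (k : Fin (N + 1)) :
    MeasurePreserving (fun p : ℝ × (Fin N → ℝ) => Fin.insertNth (α := fun _ => ℝ) k p.1 p.2)
      ((volume.restrict (Set.Ici 0)).prod (lebPos N)) (lebPos (N + 1)) :=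
  (measurePreserving_piFinSuccAbove
    (fun _ : Fin (N + 1) => (volume : Measure ℝ).restrict (Set.Ici 0)) k).symm

theorem ae_ae_insertNth {P : (Fin (N + 1) → ℝ) → Prop} (h : ∀ᵐ y ∂lebPos (N + 1), P y)
    (k : Fin (N + 1)) : ∀ᵐ s ∂volume.restrict (Set.Ici (0 : ℝ)), ∀ᵐ x ∂lebPos N,
      P (Fin.insertNth (α := fun _ => ℝ) k s x) :=
  Measure.ae_ae_of_ae_prod ((measurePreserving_insertNth k).quasiMeasurePreserving.ae h)

variable {f : (Fin (N + 1) → ℝ) → ℂ} (hf : MemLp f 2 (lebPos (N + 1))) (k : Fin (N + 1))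
include hf

theorem aestronglyMeasurable_comp_insertNth :
    AEStronglyMeasurable
      (fun p : ℝ × (Fin N → ℝ) => f (Fin.insertNth (α := fun _ => ℝ) k p.1 p.2))
      ((volume.restrict (Set.Ici 0)).prod (lebPos N)) :=
  hf.1.comp_measurePreserving (measurePreserving_insertNth k)

theorem aemeasurable_eLpNorm_fiber :
    AEMeasurable (fun s => eLpNorm (fiber f k s) 2 (lebPos N) ^ 2)
      (volume.restrict (Set.Ici 0)) := by
  simp only [sq_eLpNorm_two]
  exact ((aestronglyMeasurable_comp_insertNth hf k).enorm.pow_const 2).lintegral_prod_right'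

/-- Tonelli's theorem for the `L²` norms of the fibers. -/
theorem lintegral_eLpNorm_fiber :
    ∫⁻ s in Set.Ici 0, eLpNorm (fiber f k s) 2 (lebPos N) ^ 2 =
      eLpNorm f 2 (lebPos (N + 1)) ^ 2 := by
  simp only [sq_eLpNorm_two]
  rw [← (measurePreserving_insertNth k).map_eq, lintegral_map', lintegral_prod]
  · rfl
  · exact (aestronglyMeasurable_comp_insertNth hf k).enorm.pow_const 2
  · rw [(measurePreserving_insertNth k).map_eq]; exact hf.1.enorm.pow_const 2
  · exact (measurePreserving_insertNth k).measurable.aemeasurable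

theorem ae_memLp_fiber : ∀ᵐ s ∂volume.restrict (Set.Ici (0 : ℝ)),
    MemLp (fiber f k s) 2 (lebPos N) := by
  have h := ae_lt_top' (aemeasurable_eLpNorm_fiber hf k) (by
    rw [lintegral_eLpNorm_fiber hf k]; exact ENNReal.pow_ne_top hf.2.ne)
  filter_upwards [h, (aestronglyMeasurable_comp_insertNth hf k).prodMk_left] with s h1 h2
  exact ⟨h2, lt_top_iff_ne_top.mpr fun h => by rw [h] at h1; simp at h1⟩

end Fiber

namespace TracialWStarSpace.FreeBrownianMotion

variable {H : Type u} [NormedAddCommGroup H] [InnerProductSpace ℂ H] [CompleteSpace H]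
  {W : TracialWStarSpace H} (B : FreeBrownianMotion W) {N : ℕ}

/-- The bi-integral `I_k ⊗ I_{n-k}` as a contraction. -/
def biOp (n : ℕ) (k : Fin (n + 1)) : Lp ℂ 2 (lebPos n) →L[ℂ] W.L2Tensor :=
  (B.exists_biOp (Nat.lt_succ_iff.mp k.2)).choose

theorem mem_biGraph_iff {n : ℕ} (k : Fin (n + 1)) (p : Lp ℂ 2 (lebPos n) × W.L2Tensor) :
    p ∈ B.biGraph n k ↔ p.2 = B.biOp n k p.1 :=
  (B.exists_biOp (Nat.lt_succ_iff.mp k.2)).choose_spec.1 p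

theorem norm_biOp_le {n : ℕ} (k : Fin (n + 1)) (f : Lp ℂ 2 (lebPos n)) : ‖B.biOp n k f‖ ≤ ‖f‖ :=
  (B.exists_biOp (Nat.lt_succ_iff.mp k.2)).choose_spec.2 f

theorem biIntegral_eq {n : ℕ} (k : Fin (n + 1)) {f : (Fin n → ℝ) → ℂ} (hf : MemLp f 2 (lebPos n)) :
    B.biIntegral n k f = B.biOp n k (hf.toLp f) := by
  have h : ∃ X : W.L2Tensor, ∃ hf : MemLp f 2 (lebPos n), (hf.toLp f, X) ∈ B.biGraph n k :=
    ⟨_, hf, (B.mem_biGraph_iff k (hf.toLp f, B.biOp n k (hf.toLp f))).mpr rfl⟩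
  rw [biIntegral, dif_pos h]
  obtain ⟨hf', h1⟩ := h.choose_spec
  exact (B.mem_biGraph_iff k _).mp h1

theorem biOp_gridLp {t : ℕ → ℝ≥0} (ht : StrictMono t) {m n : ℕ} (k : Fin (n + 1))
    {c : List (Fin m) → ℂ} (hc : c ∈ nodupCoeffs (Fin m)) :
    B.biOp n k (gridLp t m n c) = biSum (B.gridIncrement t m) n k c :=
  ((B.mem_biGraph_iff k (B.gridBi t m n k c)).mp
    (Submodule.le_topologicalClosure _ (B.gridBi_mem ht k hc))).symm

/-! ### The free gradient as a bounded operator -/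

/-- The `k`-th term of the free gradient. -/
def gradientTerm (k : Fin (N + 1)) (f : (Fin (N + 1) → ℝ) → ℂ) (s : ℝ) : W.L2Tensor :=
  B.biIntegral N k (fiber f k s)

theorem gradient_eq_sum (f : (Fin (N + 1) → ℝ) → ℂ) (s : ℝ) :
    B.gradient (N + 1) f s = ∑ k, B.gradientTerm k f s := rfl

/-- Linearity only holds for almost all `s`, since a fiber of a square integrable kernel may fail
to be square integrable on a null set of `s`, where the bi-integral takes its default value. -/
theorem ae_gradientTerm_linear (k : Fin (N + 1)) {f g h : (Fin (N + 1) → ℝ) → ℂ}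
    (hf : MemLp f 2 (lebPos (N + 1))) (hg : MemLp g 2 (lebPos (N + 1))) (z z' : ℂ)
    (hh : h =ᵐ[lebPos (N + 1)] fun y => z * f y + z' * g y) :
    ∀ᵐ s ∂volume.restrict (Set.Ici (0 : ℝ)),
      B.gradientTerm k h s = z • B.gradientTerm k f s + z' • B.gradientTerm k g s := by
  filter_upwards [ae_memLp_fiber hf k, ae_memLp_fiber hg k, ae_ae_insertNth hh k] with s h1 h2 h3
  have h3' : fiber h k s =ᵐ[lebPos N] z • fiber f k s + z' • fiber g k s := h3
  have h4 : MemLp (fiber h k s) 2 (lebPos N) :=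
    ((h1.const_smul z).add (h2.const_smul z')).ae_eq h3'.symm
  have h5 : h4.toLp _ = z • h1.toLp _ + z' • h2.toLp _ := by
    rw [← MemLp.toLp_const_smul, ← MemLp.toLp_const_smul, ← MemLp.toLp_add]
    exact MemLp.toLp_congr _ _ h3'
  rw [gradientTerm, gradientTerm, gradientTerm, B.biIntegral_eq k h1, B.biIntegral_eq k h2,
    B.biIntegral_eq k h4, h5, map_add, map_smul, map_smul]

theorem ae_enorm_gradientTerm_le (k : Fin (N + 1)) {f : (Fin (N + 1) → ℝ) → ℂ}
    (hf : MemLp f 2 (lebPos (N + 1))) : ∀ᵐ s ∂volume.restrict (Set.Ici (0 : ℝ)),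
      ‖B.gradientTerm k f s‖ₑ ≤ eLpNorm (fiber f k s) 2 (lebPos N) := by
  filter_upwards [ae_memLp_fiber hf k] with s h1
  rw [gradientTerm, B.biIntegral_eq k h1, ← Lp.enorm_toLp (f := fiber f k s) h1]
  exact enorm_le_iff_norm_le.mpr (B.norm_biOp_le k _)

theorem eLpNorm_gradientTerm_le (k : Fin (N + 1)) {f : (Fin (N + 1) → ℝ) → ℂ}
    (hf : MemLp f 2 (lebPos (N + 1))) :
    eLpNorm (B.gradientTerm k f) 2 (volume.restrict (Set.Ici (0 : ℝ))) ≤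
      eLpNorm f 2 (lebPos (N + 1)) := by
  rw [← ENNReal.pow_le_pow_left_iff two_ne_zero, ← lintegral_eLpNorm_fiber hf k, sq_eLpNorm_two]
  refine lintegral_mono_ae ?_
  filter_upwards [B.ae_enorm_gradientTerm_le k hf] with s hs
  gcongr

/-- The pairs of a kernel and of the `k`-th term of its free gradient. -/
def gradientTermGraph (k : Fin (N + 1)) :
    Submodule ℂ (Lp ℂ 2 (lebPos (N + 1)) × Lp W.L2Tensor 2 (volume.restrict (Set.Ici (0 : ℝ)))) where
  carrier := {p | B.gradientTerm k p.1 =ᵐ[volume.restrict (Set.Ici 0)] p.2}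
  add_mem' {p q} hp hq := by
    have h := B.ae_gradientTerm_linear k (Lp.memLp p.1) (Lp.memLp q.1) 1 1
      ((Lp.coeFn_add p.1 q.1).trans (ae_of_all _ fun y => by simp))
    filter_upwards [h, hp, hq, Lp.coeFn_add p.2 q.2] with s h1 h2 h3 h4
    rw [Prod.fst_add, Prod.snd_add, h1, h4, h2, h3, one_smul, one_smul, Pi.add_apply]
  zero_mem' := by
    have h := B.ae_gradientTerm_linear k (Lp.memLp (0 : Lp ℂ 2 (lebPos (N + 1))))
      (Lp.memLp (0 : Lp ℂ 2 (lebPos (N + 1)))) 0 0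
      ((Lp.coeFn_zero ℂ 2 (lebPos (N + 1))).trans (ae_of_all _ fun y => by simp))
    filter_upwards [h, Lp.coeFn_zero W.L2Tensor 2 (volume.restrict (Set.Ici (0 : ℝ)))] with s h1 h2
    rw [Prod.fst_zero, Prod.snd_zero, h1, h2, zero_smul, add_zero, Pi.zero_apply]
  smul_mem' z p hp := by
    have h := B.ae_gradientTerm_linear k (Lp.memLp p.1) (Lp.memLp p.1) z 0
      ((Lp.coeFn_smul z p.1).trans (ae_of_all _ fun y => by simp))
    filter_upwards [h, hp, Lp.coeFn_smul z p.2] with s h1 h2 h3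
    rw [Prod.smul_fst, Prod.smul_snd, h1, h2, h3, zero_smul, add_zero, Pi.smul_apply]

theorem norm_snd_le_of_mem_gradientTermGraph (k : Fin (N + 1))
    {p : Lp ℂ 2 (lebPos (N + 1)) × Lp W.L2Tensor 2 (volume.restrict (Set.Ici (0 : ℝ)))}
    (hp : p ∈ B.gradientTermGraph k) : ‖p.2‖ ≤ 1 * ‖p.1‖ := by
  rw [one_mul, Lp.norm_def, Lp.norm_def, ← eLpNorm_congr_ae hp]
  exact ENNReal.toReal_mono (Lp.memLp p.1).2.ne (B.eLpNorm_gradientTerm_le k (Lp.memLp p.1))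

/-- The graph is closed: the difference of `∇ f` and of a limit of gradients `∇ fⱼ` is bounded, for
almost all `s`, by measurable functions with arbitrarily small integrals. -/
theorem isClosed_gradientTermGraph (k : Fin (N + 1)) :
    IsClosed (B.gradientTermGraph k : Set (Lp ℂ 2 (lebPos (N + 1)) ×
      Lp W.L2Tensor 2 (volume.restrict (Set.Ici (0 : ℝ))))) := by
  refine IsSeqClosed.isClosed fun p q hp hpq => ?_
  have h1 : Filter.Tendsto (fun j => ‖q.1 - (p j).1‖ₑ ^ 2 + ‖q.2 - (p j).2‖ₑ ^ 2) Filter.atTop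
      (nhds 0) := by
    have hc : Continuous fun r : Lp ℂ 2 (lebPos (N + 1)) ×
        Lp W.L2Tensor 2 (volume.restrict (Set.Ici (0 : ℝ))) =>
        ‖q.1 - r.1‖ₑ ^ 2 + ‖q.2 - r.2‖ₑ ^ 2 :=
      ((ENNReal.continuous_pow 2).comp (continuous_const.sub continuous_fst).enorm).add
        ((ENNReal.continuous_pow 2).comp (continuous_const.sub continuous_snd).enorm)
    have h := (hc.tendsto q).comp hpq
    simp only [sub_self, enorm_zero, ne_eq, two_ne_zero, not_false_eq_true, zero_pow, add_zero] at h
    exact h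
  set d : ℕ → Lp ℂ 2 (lebPos (N + 1)) := fun j => q.1 - (p j).1 with hdef
  set g : ℕ → ℝ → ℝ≥0∞ := fun j s => eLpNorm (fiber (d j) k s) 2 (lebPos N) ^ 2 +
    ‖(q.2 - (p j).2) s‖ₑ ^ 2 with hg
  have hgm : ∀ j, AEMeasurable (g j) (volume.restrict (Set.Ici (0 : ℝ))) := fun j =>
    (aemeasurable_eLpNorm_fiber (Lp.memLp _) k).add ((Lp.memLp _).1.enorm.pow_const 2)
  have hint : ∀ j, ∫⁻ s in Set.Ici 0, g j s = ‖q.1 - (p j).1‖ₑ ^ 2 + ‖q.2 - (p j).2‖ₑ ^ 2 := by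
    intro j
    rw [lintegral_add_left' (aemeasurable_eLpNorm_fiber (Lp.memLp _) k),
      lintegral_eLpNorm_fiber (Lp.memLp _) k, Lp.enorm_def, Lp.enorm_def,
      sq_eLpNorm_two ⇑(q.2 - (p j).2)]
  have hle : ∀ j, ∀ᵐ s ∂volume.restrict (Set.Ici (0 : ℝ)),
      ‖B.gradientTerm k q.1 s - q.2 s‖ₑ ^ 2 ≤ 2 * g j s := by
    intro j
    have hd := B.ae_gradientTerm_linear k (Lp.memLp q.1) (Lp.memLp (p j).1) 1 (-1)
      ((Lp.coeFn_sub q.1 (p j).1).trans (ae_of_all _ fun y => by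
        rw [Pi.sub_apply]; ring))
    filter_upwards [hd, hp j, Lp.coeFn_sub q.2 (p j).2,
      B.ae_enorm_gradientTerm_le k (Lp.memLp (q.1 - (p j).1))] with s h1 h2 h3 h4
    have h5 : B.gradientTerm k q.1 s - q.2 s =
        B.gradientTerm k (d j) s - (q.2 - (p j).2) s := by
      rw [h1, h3, Pi.sub_apply, h2, one_smul, neg_one_smul]; abel
    rw [h5]
    calc _ ≤ (‖B.gradientTerm k (d j) s‖ₑ + ‖(q.2 - (p j).2) s‖ₑ) ^ 2 := by
          gcongr; exact enorm_sub_le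
      _ ≤ (eLpNorm (fiber (d j) k s) 2 (lebPos N) + ‖(q.2 - (p j).2) s‖ₑ) ^ 2 := by
          gcongr
      _ ≤ 2 * g j s := by
          have := ENNReal.rpow_add_le_mul_rpow_add_rpow
            (eLpNorm (fiber (d j) k s) 2 (lebPos N)) ‖(q.2 - (p j).2) s‖ₑ
            (p := 2) (by norm_num)
          norm_num at this
          exact this
  have hinf : ∀ᵐ s ∂volume.restrict (Set.Ici (0 : ℝ)), ⨅ j, g j s = 0 := by
    refine (lintegral_eq_zero_iff' (AEMeasurable.iInf hgm)).mp (le_antisymm ?_ zero_le)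
    refine ge_of_tendsto h1 (.of_forall fun j => ?_)
    rw [← hint j]
    exact lintegral_mono fun s => iInf_le _ j
  filter_upwards [hinf, ae_all_iff.mpr hle] with s h2 h3
  have h4 : ‖B.gradientTerm k q.1 s - q.2 s‖ₑ ^ 2 ≤ 2 * ⨅ j, g j s := by
    rw [ENNReal.mul_iInf_of_ne two_ne_zero ENNReal.ofNat_ne_top]
    exact le_iInf h3
  rw [h2, mul_zero] at h4
  have h5 := pow_eq_zero_iff two_ne_zero |>.mp (le_antisymm h4 zero_le)
  exact sub_eq_zero.mp (enorm_eq_zero.mp h5)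

end TracialWStarSpace.FreeBrownianMotion

/-! ### The free gradient of simple kernels -/

theorem List.ofFn_insertNth {α : Type*} {N : ℕ} (k : Fin (N + 1)) (i : α) (u : Fin N → α) :
    List.ofFn (Fin.insertNth (α := fun _ => α) k i u) =
      (List.ofFn u).take k ++ i :: (List.ofFn u).drop k := by
  have hk : (k : ℕ) ≤ N := Nat.lt_succ_iff.mp k.2
  refine List.ext_getElem (by simp; omega) fun j h1 h2 => ?_
  rw [List.getElem_ofFn]
  have hj : j < N + 1 := by simpa using h1
  rcases lt_trichotomy j k with h | h | h
  · rw [List.getElem_append_left (by simp; omega), List.getElem_take, List.getElem_ofFn,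
      Fin.insertNth_apply_below (show (⟨j, hj⟩ : Fin (N + 1)) < k from h)]
    simp only [eq_rec_constant]
    rfl
  · subst h
    rw [List.getElem_append_right (by simp)]
    have : (⟨(k : ℕ), hj⟩ : Fin (N + 1)) = k := rfl
    simp [this, min_eq_left hk]
  · rw [List.getElem_append_right (by simp; omega),
      Fin.insertNth_apply_above (show k < (⟨j, hj⟩ : Fin (N + 1)) from h)]
    have hlen : ((List.ofFn u).take k).length = k := by simp [min_eq_left hk]
    obtain ⟨l, hl⟩ : ∃ l, j - ((List.ofFn u).take k).length = l + 1 := ⟨j - k - 1, by omega⟩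
    simp only [hl, List.getElem_cons_succ, List.getElem_drop, List.getElem_ofFn]
    have h3 : j - 1 = k + l := by omega
    simp only [eq_rec_constant]
    congr 1
    exact Fin.ext h3

/-- The coefficients of the kernel with its `k`-th variable in the `i`-th cell. -/
def sliceCoeff {ι : Type*} (c : List ι → ℂ) (k : ℕ) (i : ι) (w : List ι) : ℂ :=
  c (w.take k ++ i :: w.drop k)

theorem sliceCoeff_mem {ι : Type*} {c : List ι → ℂ} (hc : c ∈ nodupCoeffs ι) (k : ℕ) (i : ι) :
    sliceCoeff c k i ∈ nodupCoeffs ι := by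
  refine fun w hw => hc _ fun h => hw (h.sublist ?_)
  conv_lhs => rw [← List.take_append_drop k w]
  exact (List.sublist_cons_self i _).append_left _

theorem fiber_gridKernel (t : ℕ → ℝ≥0) (m : ℕ) {N : ℕ} (c : List (Fin m) → ℂ) (k : Fin (N + 1))
    (s : ℝ) : fiber (gridKernel t m (N + 1) c) k s =
      ∑ i : Fin m, cellFun t i s • gridKernel t m N (sliceCoeff c k i) := by
  funext x
  rw [fiber, gridKernel, ← (Fin.insertNthEquiv (fun _ : Fin (N + 1) => Fin m) k).sum_comp,
    Fintype.sum_prod_type, Finset.sum_apply]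
  refine Finset.sum_congr rfl fun i _ => ?_
  rw [Pi.smul_apply, gridKernel, Finset.smul_sum]
  refine Finset.sum_congr rfl fun u _ => ?_
  change c (List.ofFn (Fin.insertNth (α := fun _ => Fin m) k i u)) *
    cellProd t (Fin.insertNth (α := fun _ => Fin m) k i u)
      (Fin.insertNth (α := fun _ => ℝ) k s x) = _
  rw [List.ofFn_insertNth, cellProd, Fin.prod_univ_succAbove _ k]
  simp only [Fin.insertNth_apply_same, Fin.insertNth_apply_succAbove]
  rw [smul_eq_mul, sliceCoeff, cellProd]
  ring

theorem memLp_cellFun_smul {E : Type*} [NormedAddCommGroup E] [NormedSpace ℂ E] (t : ℕ → ℝ≥0)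
    (i : ℕ) (X : E) : MemLp (fun s => cellFun t i s • X) 2 (volume.restrict (Set.Ici (0 : ℝ))) := by
  have : (fun s => cellFun t i s • X) = (Set.Ioc (t i : ℝ) (t (i + 1))).indicator
      fun _ => (((√(cellWidth t i))⁻¹ : ℝ) : ℂ) • X := by
    funext s
    by_cases hs : s ∈ Set.Ioc (t i : ℝ) (t (i + 1))
    · rw [cellFun, Set.indicator_of_mem hs, Set.indicator_of_mem hs]
    · rw [cellFun, Set.indicator_of_notMem hs, Set.indicator_of_notMem hs, zero_smul]
  rw [this]
  refine memLp_indicator_const _ measurableSet_Ioc _ (.inr ?_)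
  refine ne_top_of_le_ne_top ?_ (Measure.restrict_apply_le _ _)
  simp

namespace TracialWStarSpace.FreeBrownianMotion

variable {H : Type u} [NormedAddCommGroup H] [InnerProductSpace ℂ H] [CompleteSpace H]
  {W : TracialWStarSpace H} (B : FreeBrownianMotion W) {N : ℕ}

/-- On a cell of the grid, the gradient of a grid kernel is constant. -/
theorem gradientTerm_gridKernel {t : ℕ → ℝ≥0} (ht : StrictMono t) {m : ℕ} {c : List (Fin m) → ℂ}
    (hc : c ∈ nodupCoeffs (Fin m)) (k : Fin (N + 1)) (s : ℝ) :
    B.gradientTerm k (gridKernel t m (N + 1) c) s =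
      ∑ i : Fin m, cellFun t i s • biSum (B.gridIncrement t m) N k (sliceCoeff c k i) := by
  have hmem : ∀ i : Fin m, MemLp (gridKernel t m N (sliceCoeff c k i)) 2 (lebPos N) :=
    fun i => memLp_gridKernel t m N _
  have h : MemLp (fiber (gridKernel t m (N + 1) c) k s) 2 (lebPos N) := by
    rw [fiber_gridKernel]
    exact memLp_finsetSum' _ fun i _ => (hmem i).const_smul _
  have hsum : h.toLp _ = ∑ i : Fin m, cellFun t i s • gridLp t m N (sliceCoeff c k i) := by
    refine Lp.ext ?_
    have hi : ∀ i : Fin m, ∀ᵐ y ∂lebPos N,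
        (cellFun t i s • gridLp t m N (sliceCoeff c k i) : Lp ℂ 2 (lebPos N)) y =
          cellFun t i s • gridKernel t m N (sliceCoeff c k i) y := by
      intro i
      filter_upwards [Lp.coeFn_smul (cellFun t i s) (gridLp t m N (sliceCoeff c k i)),
        (hmem i).coeFn_toLp] with y h1 h2
      rw [h1, Pi.smul_apply, gridLp, h2]
    filter_upwards [h.coeFn_toLp, ae_all_iff.mpr hi, Lp.coeFn_finsetSum Finset.univ fun i : Fin m =>
      cellFun t i s • gridLp t m N (sliceCoeff c k i)] with y h1 h2 h3
    rw [h1, h3, fiber_gridKernel, Finset.sum_apply, Finset.sum_apply]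
    exact Finset.sum_congr rfl fun i _ => (h2 i).symm
  rw [gradientTerm, B.biIntegral_eq k h, hsum, map_sum]
  refine Finset.sum_congr rfl fun i _ => ?_
  rw [map_smul, B.biOp_gridLp ht k (sliceCoeff_mem hc k i)]

theorem ae_eq_gridKernel (t : ℕ → ℝ≥0) (m n : ℕ) (c : List (Fin m) → ℂ) :
    gridLp t m n c =ᵐ[lebPos n] gridKernel t m n c :=
  (memLp_gridKernel t m n c).coeFn_toLp

theorem gradientTerm_congr (k : Fin (N + 1)) {f g : (Fin (N + 1) → ℝ) → ℂ}
    (hg : MemLp g 2 (lebPos (N + 1))) (h : f =ᵐ[lebPos (N + 1)] g) :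
    B.gradientTerm k f =ᵐ[volume.restrict (Set.Ici (0 : ℝ))] B.gradientTerm k g := by
  have := B.ae_gradientTerm_linear k hg hg 1 0 (h.trans (ae_of_all _ fun y => by simp))
  filter_upwards [this] with s hs
  rw [hs, one_smul, zero_smul, add_zero]

/-- The graph of the `k`-th term is closed, bounded, and contains all grid kernels, so that it is
the graph of a bounded operator. -/
theorem exists_gradientTermOp (k : Fin (N + 1)) :
    ∃ T : Lp ℂ 2 (lebPos (N + 1)) →L[ℂ] Lp W.L2Tensor 2 (volume.restrict (Set.Ici (0 : ℝ))),
      ∀ f : Lp ℂ 2 (lebPos (N + 1)), B.gradientTerm k f =ᵐ[volume.restrict (Set.Ici 0)] T f := by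
  obtain ⟨T, hT, -⟩ := Submodule.exists_clm_of_norm_snd_le zero_le_one
    (fun p hp => B.norm_snd_le_of_mem_gradientTermGraph k hp) (by
    rw [← top_le_iff, ← topologicalClosure_span_boxIndicator (N + 1)]
    refine Submodule.topologicalClosure_mono (Submodule.span_le.mpr ?_)
    rintro _ ⟨a, b, hab, hd, rfl⟩
    obtain ⟨t, ht, m, c, hc, hp⟩ := B.exists_grid_of_mem_simpleWigner
      (Submodule.subset_span ⟨a, b, hab, hd, rfl⟩)
    have hp1 : gridLp t m (N + 1) c = boxIndicator a b := congrArg Prod.fst hp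
    have hmem : MemLp (fun s => ∑ i : Fin m, cellFun t i s •
        biSum (B.gridIncrement t m) N k (sliceCoeff c k i)) 2 (volume.restrict (Set.Ici (0 : ℝ))) :=
      memLp_finsetSum _ fun i _ => memLp_cellFun_smul t i _
    refine ⟨(boxIndicator a b, hmem.toLp _), ?_, rfl⟩
    change B.gradientTerm k (boxIndicator a b) =ᵐ[volume.restrict (Set.Ici 0)] hmem.toLp _
    rw [← hp1]
    refine (B.gradientTerm_congr k (memLp_gridKernel t m _ c) (ae_eq_gridKernel t m _ c)).trans ?_
    refine Filter.EventuallyEq.trans (ae_of_all _ fun s => ?_) hmem.coeFn_toLp.symm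
    exact B.gradientTerm_gridKernel ht hc k s)
  refine ⟨T, fun f => ?_⟩
  have h := (hT (f, T f)).mpr rfl
  rw [(B.isClosed_gradientTermGraph k).submodule_topologicalClosure_eq] at h
  exact h

/-- The free gradient of Wigner integrals of order `N + 1`, as a bounded operator with values in the
square integrable biprocesses. -/
def gradientOp (N : ℕ) :
    Lp ℂ 2 (lebPos (N + 1)) →L[ℂ] Lp W.L2Tensor 2 (volume.restrict (Set.Ici (0 : ℝ))) :=
  ∑ k : Fin (N + 1), (B.exists_gradientTermOp k).choose

/-- The pointwise defined free gradient represents the bounded operator. -/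
theorem gradient_ae_eq {f : (Fin (N + 1) → ℝ) → ℂ} (hf : MemLp f 2 (lebPos (N + 1))) :
    B.gradient (N + 1) f =ᵐ[volume.restrict (Set.Ici 0)] B.gradientOp N (hf.toLp f) := by
  have h1 : ∀ k : Fin (N + 1), B.gradientTerm k f =ᵐ[volume.restrict (Set.Ici 0)]
      (B.exists_gradientTermOp k).choose (hf.toLp f) := fun k =>
    (B.gradientTerm_congr k (Lp.memLp _) hf.coeFn_toLp.symm).trans
      ((B.exists_gradientTermOp k).choose_spec _)
  have h2 : B.gradientOp N (hf.toLp f) =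
      ∑ k : Fin (N + 1), (B.exists_gradientTermOp k).choose (hf.toLp f) := by
    rw [gradientOp, _root_.sum_apply]
  rw [h2]
  filter_upwards [ae_all_iff.mpr h1, Lp.coeFn_finsetSum Finset.univ fun k : Fin (N + 1) =>
    (B.exists_gradientTermOp k).choose (hf.toLp f)] with s h3 h4
  rw [h4, gradient_eq_sum, Finset.sum_apply]
  exact Finset.sum_congr rfl fun k _ => h3 k

/-! ### The integral of the sharp product -/

/-- The pairing of `a ⊗ b` with `∫ ∇ₛ (N₀⁻¹ F) ♯ (∇ₛ F)* ds`, where `F` is the Wigner integral of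
`f`. -/
def sharpPairing (N : ℕ) (a b : W.Alg) (f : Lp ℂ 2 (lebPos (N + 1))) : ℂ :=
  ⟪(W.sharpL a b).compLp (B.gradientOp N f), ((N + 1 : ℕ) : ℂ)⁻¹ • B.gradientOp N f⟫_ℂ

theorem continuous_sharpPairing (N : ℕ) (a b : W.Alg) : Continuous (B.sharpPairing N a b) := by
  have h : Continuous fun g : Lp W.L2Tensor 2 (volume.restrict (Set.Ici (0 : ℝ))) =>
      (W.sharpL a b).compLp g :=
    ((W.sharpL a b).compLpL 2 (volume.restrict (Set.Ici (0 : ℝ)))).continuous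
  exact (h.comp (B.gradientOp N).continuous).inner
    (((N + 1 : ℕ) : ℂ)⁻¹ • B.gradientOp N).continuous

/-- Square integrability of the gradients makes the pairings integrable. -/
theorem sharpPairing_eq {f : (Fin (N + 1) → ℝ) → ℂ} (hf : MemLp f 2 (lebPos (N + 1)))
    (a b : W.Alg) :
    IntegrableOn (fun s => ⟪W.sharp a b (B.gradient (N + 1) f s),
      B.gradient (N + 1) (numberInvKernel (N + 1) f) s⟫_ℂ) (Set.Ici 0) ∧
    B.sharpPairing N a b (hf.toLp f) = ∫ s in Set.Ici (0 : ℝ),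
      ⟪W.sharp a b (B.gradient (N + 1) f s),
        B.gradient (N + 1) (numberInvKernel (N + 1) f) s⟫_ℂ := by
  have hf' : MemLp (numberInvKernel (N + 1) f) 2 (lebPos (N + 1)) :=
    hf.const_mul _
  have hsmul : hf'.toLp _ = ((N + 1 : ℕ) : ℂ)⁻¹ • hf.toLp f := by
    rw [← MemLp.toLp_const_smul]; rfl
  have hU := B.gradient_ae_eq hf'
  rw [hsmul, map_smul] at hU
  have h : (fun s => ⟪(W.sharpL a b).compLp (B.gradientOp N (hf.toLp f)) s,
      (((N + 1 : ℕ) : ℂ)⁻¹ • B.gradientOp N (hf.toLp f) :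
        Lp W.L2Tensor 2 (volume.restrict (Set.Ici (0 : ℝ)))) s⟫_ℂ)
      =ᵐ[volume.restrict (Set.Ici 0)] fun s => ⟪W.sharp a b (B.gradient (N + 1) f s),
        B.gradient (N + 1) (numberInvKernel (N + 1) f) s⟫_ℂ := by
    filter_upwards [hU, B.gradient_ae_eq hf,
      (W.sharpL a b).coeFn_compLp (B.gradientOp N (hf.toLp f))] with s h1 h2 h3
    rw [h3, h1, h2, sharpL_apply]
  refine ⟨(L2.integrable_inner _ _).congr h, ?_⟩
  rw [sharpPairing, L2.inner_def]
  exact integral_congr_ae h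

end TracialWStarSpace.FreeBrownianMotion

namespace TracialWStarSpace

variable {H : Type u} [NormedAddCommGroup H] [InnerProductSpace ℂ H] [CompleteSpace H]
  {W : TracialWStarSpace H}

/-! ### The sharp product for simple kernels -/

/-- The action `♯` is moved to the other side of the inner product by the trace property. -/
theorem inner_sharp_tmul_tmul (a b c d c' d' : W.Alg) :
    ⟪W.sharp a b (W.tmul c' d'), W.tmul c d⟫_ℂ =
      ⟪W.tmul a b, W.tmul (c * star c') (star d' * d)⟫_ℂ := by
  rw [sharp_tmul, inner_tmul, inner_tmul, star_mul, star_mul]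
  congr 1
  rw [mul_assoc, W.φ_trace, mul_assoc]

theorem integrable_conj_cellFun_mul (t : ℕ → ℝ≥0) (i j : ℕ) :
    IntegrableOn (fun s => (starRingEnd ℂ) (cellFun t i s) * cellFun t j s) (Set.Ici 0) := by
  have h : ∀ i, MemLp (cellFun t i) 2 (volume.restrict (Set.Ici (0 : ℝ))) := fun i => by
    simpa using memLp_cellFun_smul t i (1 : ℂ)
  exact (h i).star.integrable_mul (h j)

/-- The value of the free gradient of a simple kernel on the `i`-th cell, up to normalisation. -/
def cellGradient {ι : Type*} [Fintype ι] [DecidableEq ι] (x : ι → W.Alg) (N : ℕ)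
    (c : List ι → ℂ) (i : ι) : W.L2Tensor :=
  ∑ k : Fin (N + 1), FreeBrownianMotion.biSum x N k (sliceCoeff c k i)

theorem cellGradient_eq {ι : Type*} [Fintype ι] [DecidableEq ι] (x : ι → W.Alg) (N : ℕ)
    (c : List ι → ℂ) (i : ι) :
    cellGradient x N c i = ∑ k ∈ Finset.range (N + 1), wordSum k fun u => wordSum (N - k) fun v =>
      c (u ++ i :: v) • W.tmul (wick x u) (wick x v) := by
  rw [← Fin.sum_univ_eq_sum_range fun k => wordSum k fun u => wordSum (N - k) fun v =>
      c (u ++ i :: v) • W.tmul (wick x u) (wick x v)]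
  refine Finset.sum_congr rfl fun k _ => ?_
  have hk : (k : ℕ) ≤ N := Nat.lt_succ_iff.mp k.2
  rw [FreeBrownianMotion.biSum]
  refine (congrArg (fun j => wordSum j _) (Nat.add_sub_cancel' hk).symm).trans ?_
  rw [wordSum_append]
  refine wordSum_congr fun u hu => wordSum_congr fun v _ => ?_
  rw [sliceCoeff, List.take_left' hu, List.drop_left' hu]

theorem sum_inner_sharp_cellGradient {ι : Type*} [Fintype ι] [DecidableEq ι] (x : ι → W.Alg)
    (N : ℕ) (c : List ι → ℂ) (a b : W.Alg) :
    ∑ i, ((N + 1 : ℕ) : ℂ)⁻¹ * ⟪W.sharp a b (cellGradient x N c i), cellGradient x N c i⟫_ℂ =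
      ⟪W.tmul a b, sharpGradient x (N + 1) c⟫_ℂ := by
  have h : ∀ i, ⟪W.sharp a b (cellGradient x N c i), cellGradient x N c i⟫_ℂ =
      ∑ k ∈ Finset.range (N + 1), ∑ l ∈ Finset.range (N + 1), wordSum k fun u => wordSum l fun u' =>
        wordSum (N - l) fun v' => wordSum (N - k) fun v =>
          (c (u ++ i :: v) * (starRingEnd ℂ) (c (u' ++ i :: v'))) *
            ⟪W.tmul a b, W.tmul (wick x u * star (wick x u')) (star (wick x v') * wick x v)⟫_ℂ := by
    intro i
    rw [← sharpL_apply, cellGradient_eq, map_sum, sum_inner]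
    simp only [inner_sum]
    rw [Finset.sum_comm]
    refine Finset.sum_congr rfl fun k _ => Finset.sum_congr rfl fun l _ => ?_
    rw [inner_wordSum_right]
    refine wordSum_congr fun u _ => ?_
    rw [map_wordSum, inner_wordSum_left]
    refine wordSum_congr fun u' _ => ?_
    rw [map_wordSum, inner_wordSum_left]
    refine wordSum_congr fun v' _ => ?_
    rw [inner_wordSum_right]
    refine wordSum_congr fun v _ => ?_
    rw [map_smul, inner_smul_left, inner_smul_right, sharpL_apply, inner_sharp_tmul_tmul]
    ring
  rw [sharpGradient, inner_smul_right, ← Finset.mul_sum]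
  simp only [h, inner_sum, inner_wordSum_right, inner_smul_right]
  congr 1
  rw [Finset.sum_comm]
  refine Finset.sum_congr rfl fun k _ => ?_
  rw [Finset.sum_comm]
  refine Finset.sum_congr rfl fun l _ => ?_
  rw [← wordSum_finsetSum]
  refine wordSum_congr fun u _ => ?_
  rw [← wordSum_finsetSum]
  refine wordSum_congr fun u' _ => ?_
  rw [← wordSum_finsetSum]
  refine wordSum_congr fun v' _ => ?_
  rw [← wordSum_finsetSum]
  rfl

namespace FreeBrownianMotion

variable (B : FreeBrownianMotion W) {N : ℕ}

theorem gradientOp_gridLp {t : ℕ → ℝ≥0} (ht : StrictMono t) {m : ℕ} {c : List (Fin m) → ℂ}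
    (hc : c ∈ nodupCoeffs (Fin m)) :
    B.gradientOp N (gridLp t m (N + 1) c) =ᵐ[volume.restrict (Set.Ici 0)] fun s =>
      ∑ i : Fin m, cellFun t i s • cellGradient (B.gridIncrement t m) N c i := by
  refine (B.gradient_ae_eq (memLp_gridKernel t m (N + 1) c)).symm.trans (ae_of_all _ fun s => ?_)
  change ∑ k : Fin (N + 1), B.gradientTerm k (gridKernel t m (N + 1) c) s = _
  simp only [B.gradientTerm_gridKernel ht hc, cellGradient, Finset.smul_sum]
  exact Finset.sum_comm

/-- For simple kernels the integral of the sharp product is the explicit sum `sharpGradient`: the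
normalized indicator functions of the cells are orthonormal. -/
theorem sharpPairing_gridLp {t : ℕ → ℝ≥0} (ht : StrictMono t) {m : ℕ} {c : List (Fin m) → ℂ}
    (hc : c ∈ nodupCoeffs (Fin m)) (a b : W.Alg) :
    B.sharpPairing N a b (gridLp t m (N + 1) c) =
      ⟪W.tmul a b, sharpGradient (B.gridIncrement t m) (N + 1) c⟫_ℂ := by
  rw [sharpPairing, inner_smul_right, L2.inner_def, ← sum_inner_sharp_cellGradient,
    ← Finset.mul_sum]
  congr 1
  set X := cellGradient (B.gridIncrement t m) N c with hX
  have h : (fun s => ⟪(W.sharpL a b).compLp (B.gradientOp N (gridLp t m (N + 1) c)) s,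
      B.gradientOp N (gridLp t m (N + 1) c) s⟫_ℂ) =ᵐ[volume.restrict (Set.Ici 0)] fun s =>
        ∑ i : Fin m, ∑ j : Fin m, ((starRingEnd ℂ) (cellFun t i s) * cellFun t j s) *
          ⟪W.sharp a b (X i), X j⟫_ℂ := by
    filter_upwards [B.gradientOp_gridLp ht hc (N := N),
      (W.sharpL a b).coeFn_compLp (B.gradientOp N (gridLp t m (N + 1) c))] with s h1 h2
    rw [h2, h1, map_sum, sum_inner]
    refine Finset.sum_congr rfl fun i _ => ?_
    rw [inner_sum]
    refine Finset.sum_congr rfl fun j _ => ?_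
    rw [map_smul, inner_smul_left, inner_smul_right, sharpL_apply, mul_assoc]
  rw [integral_congr_ae h, integral_finsetSum]
  · refine Finset.sum_congr rfl fun i _ => ?_
    rw [integral_finsetSum]
    · simp only [integral_mul_const, integral_cellFun ht, Fin.val_inj, ite_mul, one_mul, zero_mul,
        Finset.sum_ite_eq, Finset.mem_univ, if_true]
    · exact fun j _ => (integrable_conj_cellFun_mul t i j).mul_const _
  · exact fun i _ => integrable_finsetSum _ fun j _ =>
      (integrable_conj_cellFun_mul t i j).mul_const _

end FreeBrownianMotion
end TracialWStarSpace

/-! ### Symmetric kernels -/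

section Symmetric

theorem exists_perm_of_ofFn_perm {ι : Type*} {n : ℕ} {u v : Fin n → ι} (hv : Function.Injective v)
    (h : (List.ofFn u).Perm (List.ofFn v)) : ∃ σ : Equiv.Perm (Fin n), ∀ k, u (σ k) = v k := by
  have hmem : ∀ k, ∃ l, u l = v k := fun k => by
    have : v k ∈ List.ofFn u := h.mem_iff.mpr (List.mem_ofFn.mpr ⟨k, rfl⟩)
    exact List.mem_ofFn.mp this
  choose τ hτ using hmem
  have hinj : Function.Injective τ := fun k l hkl => hv (by rw [← hτ, ← hτ, hkl])
  exact ⟨Equiv.ofBijective τ (Finite.injective_iff_bijective.mp hinj), hτ⟩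

theorem measurePreserving_comp_perm {n : ℕ} (σ : Equiv.Perm (Fin n)) :
    MeasurePreserving (fun (y : Fin n → ℝ) i => y (σ i)) (lebPos n) (lebPos n) := by
  have h := measurePreserving_piCongrLeft
    (fun _ : Fin n => (volume : Measure ℝ).restrict (Set.Ici 0)) σ.symm
  have heq : ⇑(MeasurableEquiv.piCongrLeft (fun _ : Fin n => ℝ) σ.symm) =
      fun (y : Fin n → ℝ) i => y (σ i) := by
    funext y i
    have := Equiv.piCongrLeft_apply_apply (fun _ : Fin n => ℝ) σ.symm y (σ i)
    rwa [Equiv.symm_apply_apply] at this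
  rw [heq] at h
  exact h

variable (t : ℕ → ℝ≥0) (m : ℕ) {n : ℕ}

/-- The coefficients of the orthogonal projection of `f` to the span of the products of indicator
functions of pairwise distinct cells. -/
def projCoeff (f : Lp ℂ 2 (lebPos n)) (w : List (Fin m)) : ℂ :=
  open Classical in
  if h : w.length = n then
    if w.Nodup then ⟪(memLp_cellProd t fun k : Fin n => w.get (k.cast h.symm)).toLp _, f⟫_ℂ else 0
  else 0

theorem projCoeff_mem (f : Lp ℂ 2 (lebPos n)) : projCoeff t m f ∈ nodupCoeffs (Fin m) := by
  intro w hw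
  rw [projCoeff]
  split_ifs <;> rfl

variable {m}

theorem projCoeff_ofFn (f : Lp ℂ 2 (lebPos n)) {u : Fin n → Fin m} (hu : Function.Injective u) :
    projCoeff t m f (List.ofFn u) = ⟪(memLp_cellProd t u).toLp _, f⟫_ℂ := by
  rw [projCoeff, dif_pos List.length_ofFn, if_pos (List.nodup_ofFn.mpr hu)]
  congr 2
  ext1
  congr 1
  funext k
  simp

theorem inner_toLp_cellProd_eq_integral {f : (Fin n → ℝ) → ℂ} (hf : MemLp f 2 (lebPos n))
    (u : Fin n → Fin m) : ⟪(memLp_cellProd t u).toLp _, hf.toLp f⟫_ℂ =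
      ∫ y, (starRingEnd ℂ) (cellProd t u y) * f y ∂lebPos n := by
  rw [L2.inner_def]
  refine integral_congr_ae ?_
  filter_upwards [(memLp_cellProd t u).coeFn_toLp, hf.coeFn_toLp] with y h1 h2
  rw [h1, h2, RCLike.inner_apply, mul_comm]

theorem conj_cellProd (u : Fin n → Fin m) (y : Fin n → ℝ) :
    (starRingEnd ℂ) (cellProd t u y) = cellProd t u y := by
  classical
  rw [cellProd_eq_indicator, Set.indicator_apply]
  split_ifs
  · rw [map_prod]
    exact Finset.prod_congr rfl fun k _ => Complex.conj_ofReal _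
  · exact map_zero _

theorem conj_projCoeff {f : (Fin n → ℝ) → ℂ} (hf : MemLp f 2 (lebPos n))
    (hreal : ∀ᵐ y ∂lebPos n, (f y).im = 0) (w : List (Fin m)) :
    (starRingEnd ℂ) (projCoeff t m (hf.toLp f) w) = projCoeff t m (hf.toLp f) w := by
  rw [projCoeff]
  split_ifs
  · rw [inner_toLp_cellProd_eq_integral, ← integral_conj]
    refine integral_congr_ae ?_
    filter_upwards [hreal] with y hy
    rw [map_mul, conj_cellProd, conj_cellProd, Complex.conj_eq_iff_im.mpr hy]
  · exact map_zero _
  · exact map_zero _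

/-- The projection inherits the symmetry of the kernel, because permutations of the variables
preserve the measure. -/
theorem projCoeff_perm {f : (Fin n → ℝ) → ℂ} (hf : MemLp f 2 (lebPos n))
    (hsymm : ∀ σ : Equiv.Perm (Fin n), ∀ᵐ x ∂lebPos n, f (fun i => x (σ i)) = f x)
    {w w' : List (Fin m)} (h : w.Perm w') :
    projCoeff t m (hf.toLp f) w = projCoeff t m (hf.toLp f) w' := by
  by_cases hn : w.length = n
  · by_cases hd : w.Nodup
    · obtain ⟨u, rfl⟩ : ∃ u : Fin n → Fin m, w = List.ofFn u := by
        subst hn; exact ⟨w.get, (List.ofFn_get w).symm⟩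
      obtain ⟨v, rfl⟩ : ∃ v : Fin n → Fin m, w' = List.ofFn v := by
        have hn' : w'.length = n := h.length_eq.symm.trans hn
        clear h
        subst hn'; exact ⟨w'.get, (List.ofFn_get w').symm⟩
      have hv := List.nodup_ofFn.mp (h.nodup_iff.mp hd)
      obtain ⟨σ, hσ⟩ := exists_perm_of_ofFn_perm hv h
      rw [projCoeff_ofFn t _ (List.nodup_ofFn.mp hd), projCoeff_ofFn t _ hv,
        inner_toLp_cellProd_eq_integral, inner_toLp_cellProd_eq_integral]
      set F : (Fin n → ℝ) → ℂ := fun y => (starRingEnd ℂ) (cellProd t v y) * f y with hF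
      have hFm : AEStronglyMeasurable F (lebPos n) :=
        (Complex.continuous_conj.comp_aestronglyMeasurable (memLp_cellProd t v).1).mul hf.1
      have h1 : ∫ y, F y ∂lebPos n = ∫ y, F (fun i => y (σ i)) ∂lebPos n := by
        have hmp := measurePreserving_comp_perm σ
        conv_lhs => rw [← hmp.map_eq]
        exact integral_map hmp.measurable.aemeasurable (by rw [hmp.map_eq]; exact hFm)
      rw [h1]
      refine integral_congr_ae ?_
      filter_upwards [hsymm σ] with y hy
      rw [hF]
      simp only [hy]
      congr 2
      rw [cellProd, cellProd, ← Equiv.prod_comp σ]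
      exact Finset.prod_congr rfl fun k _ => by rw [hσ]
    · rw [projCoeff_mem t m _ w hd, projCoeff_mem t m _ w' (mt h.nodup_iff.mpr hd)]
  · rw [projCoeff, projCoeff, dif_neg hn, dif_neg fun h' => hn (h.length_eq.trans h')]

variable {t}

theorem inner_toLp_cellProd_gridLp (ht : StrictMono t) (u : Fin n → Fin m)
    (c : List (Fin m) → ℂ) :
    ⟪(memLp_cellProd t u).toLp _, gridLp t m n c⟫_ℂ = c (List.ofFn u) := by
  rw [gridLp_eq_sum, inner_sum]
  simp [inner_smul_right, inner_toLp_cellProd ht]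

/-- The orthogonal projection is the best approximation, so symmetrizing costs nothing. -/
theorem norm_sub_gridLp_projCoeff_le (ht : StrictMono t) (f : Lp ℂ 2 (lebPos n))
    {d : List (Fin m) → ℂ} (hd : d ∈ nodupCoeffs (Fin m)) :
    ‖f - gridLp t m n (projCoeff t m f)‖ ≤ ‖f - gridLp t m n d‖ := by
  set c := projCoeff t m f with hc
  have hdecomp : f - gridLp t m n d =
      (f - gridLp t m n c) + gridLp t m n fun w => c w + -1 * d w := by
    rw [gridLp_add, gridLp_smul]; module
  have horth : ⟪f - gridLp t m n c, gridLp t m n fun w => c w + -1 * d w⟫_ℂ = 0 := by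
    rw [gridLp_eq_sum t m n fun w => c w + -1 * d w, inner_sum]
    refine Finset.sum_eq_zero fun u _ => ?_
    rw [inner_smul_right]
    by_cases hu : Function.Injective u
    · rw [← inner_conj_symm, inner_sub_right, inner_toLp_cellProd_gridLp ht, hc,
        projCoeff_ofFn t f hu, sub_self, map_zero, mul_zero]
    · have hu' : ¬ (List.ofFn u).Nodup := mt List.nodup_ofFn.mp hu
      rw [hd _ hu', hc, projCoeff_mem t m f _ hu', mul_zero, add_zero, zero_mul]
  have h := norm_add_sq_eq_norm_sq_add_norm_sq_of_inner_eq_zero _ _ horth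
  rw [← hdecomp] at h
  nlinarith [norm_nonneg (f - gridLp t m n c), norm_nonneg (f - gridLp t m n d),
    norm_nonneg (gridLp t m n fun w => c w + -1 * d w)]

end Symmetric

/-! ### Weak limits -/

/-- A bounded sequence of a Hilbert space whose inner products with a total set converge has a weak
limit, and the norm is weakly lower semicontinuous. -/
theorem exists_weak_limit {E : Type*} [NormedAddCommGroup E] [InnerProductSpace ℂ E]
    [CompleteSpace E] {κ : Type*} {x : κ → E}
    (hx : (Submodule.span ℂ (Set.range x)).topologicalClosure = ⊤) {D : ℕ → E}
    {R : ℕ → ℝ} {r : ℝ} (hD : ∀ j, ‖D j‖ ^ 2 ≤ R j) (hR : Filter.Tendsto R Filter.atTop (nhds r))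
    {ℓ : κ → ℂ} (hℓ : ∀ i, Filter.Tendsto (fun j => ⟪x i, D j⟫_ℂ) Filter.atTop (nhds (ℓ i))) :
    ∃ D' : E, ‖D'‖ ^ 2 ≤ r ∧ ∀ i, ⟪x i, D'⟫_ℂ = ℓ i := by
  have hr : 0 ≤ r := ge_of_tendsto' hR fun j => (sq_nonneg _).trans (hD j)
  let M : Submodule ℂ (E × ℂ) :=
    { carrier := {p | Filter.Tendsto (fun j => ⟪D j, p.1⟫_ℂ) Filter.atTop (nhds p.2)}
      add_mem' := fun {p q} hp hq => by
        simpa only [Set.mem_ofPred_eq, Prod.fst_add, Prod.snd_add, inner_add_right] using hp.add hq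
      zero_mem' := by simp
      smul_mem' := fun z p hp => by
        simpa only [Set.mem_ofPred_eq, Prod.smul_fst, Prod.smul_snd, inner_smul_right, smul_eq_mul]
          using hp.const_mul z }
  have hM : ∀ p ∈ M, ‖p.2‖ ≤ √r * ‖p.1‖ := by
    intro p hp
    refine le_of_tendsto_of_tendsto' (Filter.Tendsto.norm hp)
      ((hR.sqrt).mul_const ‖p.1‖) fun j => ?_
    refine (norm_inner_le_norm _ _).trans ?_
    gcongr
    exact Real.le_sqrt_of_sq_le (hD j)
  have hmem : ∀ i, (x i, (starRingEnd ℂ) (ℓ i)) ∈ M := by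
    intro i
    change Filter.Tendsto (fun j => ⟪D j, x i⟫_ℂ) Filter.atTop (nhds ((starRingEnd ℂ) (ℓ i)))
    simpa only [Function.comp_def, inner_conj_symm] using
      (Complex.continuous_conj.tendsto _).comp (hℓ i)
  obtain ⟨T, hT, hTn⟩ := Submodule.exists_clm_of_norm_snd_le (Real.sqrt_nonneg r) hM (by
    rw [← top_le_iff, ← hx]
    refine Submodule.topologicalClosure_mono (Submodule.span_le.mpr ?_)
    rintro _ ⟨i, rfl⟩
    exact ⟨_, hmem i, rfl⟩)
  refine ⟨(InnerProductSpace.toDual ℂ E).symm T, ?_, fun i => ?_⟩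
  · rw [LinearIsometryEquiv.norm_map, ← Real.le_sqrt (norm_nonneg _) hr]
    exact T.opNorm_le_bound (Real.sqrt_nonneg r) hTn
  · have h1 := (hT _).mp (Submodule.le_topologicalClosure _ (hmem i))
    rw [← inner_conj_symm, InnerProductSpace.toDual_symm_apply]
    change (starRingEnd ℂ) (T (x i)) = ℓ i
    rw [← show (starRingEnd ℂ) (ℓ i) = T (x i) from h1, Complex.conj_conj]

namespace TracialWStarSpace

variable {H : Type u} [NormedAddCommGroup H] [InnerProductSpace ℂ H] [CompleteSpace H]
  {W : TracialWStarSpace H}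

theorem topologicalClosure_span_tmul (W : TracialWStarSpace H) :
    (Submodule.span ℂ (Set.range fun ab : W.Alg × W.Alg =>
      W.tmul ab.1 ab.2)).topologicalClosure = ⊤ := by
  rw [← Submodule.dense_iff_topologicalClosure_eq_top]
  refine UniformSpace.Completion.denseRange_coe.mono ?_
  rintro _ ⟨X, rfl⟩
  induction X using W.preTensor_induction with
  | h0 => rw [UniformSpace.Completion.coe_zero]; exact Submodule.zero_mem _
  | ht a b => exact Submodule.subset_span ⟨(a, b), rfl⟩
  | ha x y hx hy => rw [UniformSpace.Completion.coe_add]; exact Submodule.add_mem _ hx hy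

/-- Symmetric kernels are limits of symmetric kernels on grids that vanish on the diagonals. -/
theorem FreeBrownianMotion.exists_symmetric_grid_approx (B : FreeBrownianMotion W) {n : ℕ}
    {f : (Fin n → ℝ) → ℂ}
    (hf : MemLp f 2 (lebPos n)) (hsymm : IsFullySymmetric f) {ε : ℝ} (hε : 0 < ε) :
    ∃ t : ℕ → ℝ≥0, StrictMono t ∧ ∃ (m : ℕ) (c : List (Fin m) → ℂ), c ∈ nodupCoeffs (Fin m) ∧
      (∀ w w' : List (Fin m), w.Perm w' → c w = c w') ∧ (∀ w, (starRingEnd ℂ) (c w) = c w) ∧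
      ‖hf.toLp f - gridLp t m n c‖ < ε := by
  have hcl : hf.toLp f ∈ closure ((Submodule.span ℂ {g : Lp ℂ 2 (lebPos n) |
      ∃ a b : Fin n → ℝ≥0, a ≤ b ∧ DisjointSides a b ∧ g = boxIndicator a b} :
        Submodule ℂ (Lp ℂ 2 (lebPos n))) : Set (Lp ℂ 2 (lebPos n))) := by
    rw [← Submodule.topologicalClosure_coe, topologicalClosure_span_boxIndicator]; trivial
  obtain ⟨g, hg, hdist⟩ := Metric.mem_closure_iff.mp hcl ε hε
  have hmap : g ∈ (B.simpleWigner n).map (LinearMap.fst ℂ _ _) := by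
    rw [simpleWigner, Submodule.map_span]
    refine Submodule.span_mono ?_ hg
    rintro _ ⟨a, b, hab, hd, rfl⟩
    exact ⟨_, ⟨a, b, hab, hd, rfl⟩, rfl⟩
  obtain ⟨p, hp, rfl⟩ := hmap
  obtain ⟨t, ht, m, d, hd, rfl⟩ := B.exists_grid_of_mem_simpleWigner hp
  refine ⟨t, ht, m, projCoeff t m (hf.toLp f), projCoeff_mem t m _,
    fun w w' h => projCoeff_perm t hf hsymm.2 h, conj_projCoeff t hf hsymm.1,
    (norm_sub_gridLp_projCoeff_le ht _ hd).trans_lt ?_⟩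
  rw [← dist_eq_norm]
  exact hdist

end TracialWStarSpace

end

theorem theorem3p4 {H : Type*} [NormedAddCommGroup H] [InnerProductSpace ℂ H] [CompleteSpace H]
    (W : TracialWStarSpace H) (B : W.FreeBrownianMotion) (n : ℕ) (hn : 1 ≤ n)
    (f : (Fin n → ℝ) → ℂ) (hf : MemLp f 2 (lebPos n)) (hsymm : IsFullySymmetric f)
    (hnorm : eLpNorm f 2 (lebPos n) = 1) :
    ∃ F : W.Alg, W.toL2 F = B.wignerIntegral n f ∧ IsSelfAdjoint F ∧
      ∃ G : W.L2Tensor,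
        W.IsSharpIntegral (B.gradient n (numberInvKernel n f)) (B.gradient n f) G ∧
        ‖G - W.tmul 1 1‖ ^ 2 ≤ constC n * ((W.φ (F ^ 4)).re - 2) := by
  obtain ⟨N, rfl⟩ : ∃ N, n = N + 1 := ⟨n - 1, by omega⟩
  -- symmetric grid kernels that converge to `f`
  choose t ht m c hc hperm hreal hlt using fun j : ℕ =>
    B.exists_symmetric_grid_approx hf hsymm (ε := 1 / ((j : ℝ) + 1)) (by positivity)
  have hlim : Filter.Tendsto (fun j => gridLp (t j) (m j) (N + 1) (c j)) Filter.atTop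
      (nhds (hf.toLp f)) := by
    rw [tendsto_iff_norm_sub_tendsto_zero]
    refine squeeze_zero (fun _ => norm_nonneg _) (fun j => ?_)
      (tendsto_one_div_add_atTop_nhds_zero_nat (𝕜 := ℝ))
    rw [norm_sub_rev]
    exact (hlt j).le
  have hwick : ∀ j, B.wignerOp (N + 1) (gridLp (t j) (m j) (N + 1) (c j)) =
      TracialWStarSpace.wickSum (B.gridIncrement (t j) (m j)) (N + 1) (c j) := fun j =>
    B.wignerOp_eq_of_mem (B.gridWigner_mem (ht j) (hc j))
  -- their Wigner integrals converge in operator norm, hence so do the fourth moments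
  have hF := ((B.wignerOp (N + 1)).continuous.tendsto _).comp hlim
  simp only [Function.comp_def, hwick] at hF
  set F := B.wignerOp (N + 1) (hf.toLp f) with hFdef
  have hx := fun j => B.isWickFamily_gridIncrement (ht j) (m j)
  have hcoeff : Filter.Tendsto (fun j => TracialWStarSpace.coeffNormSq (N + 1) (c j)) Filter.atTop
      (nhds 1) := by
    have h := (hlim.norm).pow 2
    rw [Lp.norm_toLp, hnorm, ENNReal.toReal_one, one_pow] at h
    simpa only [norm_sq_gridLp (ht _)] using h
  refine ⟨F, (B.wignerIntegral_eq hf).symm, ?_, ?_⟩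
  · refine tendsto_nhds_unique (((continuous_star.tendsto F).comp hF).congr fun j => ?_) hF
    exact TracialWStarSpace.star_wickSum_of_symm (hx j) (hperm j) (hreal j) (N + 1)
  have hconst : ∀ q, 1 ≤ q → q ≤ N + 1 - 1 →
      1 / (((N + 1 : ℕ) : ℝ)) ^ 2 * constP (N + 1) q ≤ constC (N + 1) :=
    fun q _ hq => constP_le_constC (by omega)
  have hbound := fun j => TracialWStarSpace.norm_sq_sharpGradient_sub_le_fourth_moment (hx j)
    (hperm j) (hreal j) hn hconst
  have hR : Filter.Tendsto (fun j => constC (N + 1) *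
      ((W.φ (TracialWStarSpace.wickSum (B.gridIncrement (t j) (m j)) (N + 1) (c j) ^ 4)).re -
        2 * TracialWStarSpace.coeffNormSq (N + 1) (c j) ^ 2)) Filter.atTop
      (nhds (constC (N + 1) * ((W.φ (F ^ 4)).re - 2))) := by
    have h1 := (Complex.continuous_re.tendsto _).comp ((W.continuous_φ.tendsto _).comp (hF.pow 4))
    have h2 := (h1.sub ((hcoeff.pow 2).const_mul 2)).const_mul (constC (N + 1))
    simpa using h2
  -- the differences of the integrals for the approximating kernels and of `‖fⱼ‖² 1 ⊗ 1` are bounded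
  -- in `L²`, and their pairings with elementary tensors converge; `D` is their weak limit
  obtain ⟨D, hD, hDin⟩ := exists_weak_limit W.topologicalClosure_span_tmul hbound hR
    (ℓ := fun ab => B.sharpPairing N ab.1 ab.2 (hf.toLp f) -
      ⟪W.tmul ab.1 ab.2, W.tmul 1 1⟫_ℂ) (by
    rintro ⟨a, b⟩
    have h1 := ((B.continuous_sharpPairing N a b).tendsto _).comp hlim
    have h2 : Filter.Tendsto (fun j => ((TracialWStarSpace.coeffNormSq (N + 1) (c j) : ℝ) : ℂ) *
        ⟪W.tmul a b, W.tmul 1 1⟫_ℂ) Filter.atTop (nhds (((1 : ℝ) : ℂ) *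
          ⟪W.tmul a b, W.tmul 1 1⟫_ℂ)) :=
      ((Complex.continuous_ofReal.tendsto _).comp hcoeff).mul_const _
    rw [Complex.ofReal_one, one_mul] at h2
    refine (h1.sub h2).congr fun j => ?_
    rw [Function.comp_apply, B.sharpPairing_gridLp (ht j) (hc j), inner_sub_right,
      inner_smul_right])
  refine ⟨D + W.tmul 1 1, fun a b => ⟨(B.sharpPairing_eq hf a b).1, ?_⟩, ?_⟩
  · rw [← (B.sharpPairing_eq hf a b).2, inner_add_right, hDin (a, b), sub_add_cancel]
  · rw [add_sub_cancel_right]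
    exact hD
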